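/- Let $m>2$. Let $\mathfrak V$ be a $2m$-dimensional complex vector space with a nondegenerate symmetric bilinear form $g_{ab}$ and an orientation, let $\mathfrak S=\mathfrak S^+\oplus\mathfrak S^-$ be its $2^m$-dimensional spinor space, i.e. a module over the Clifford algebra with relations $v\cdot v=-g(v,v)$, split into the $\pm1$-eigenspaces of the orientation. Primed and unprimed indices refer to $\mathfrak S^+$ and $\mathfrak S^-$, $\gamma_{aA'}{}^{B}$ and $\gamma_{aA}{}^{B'}$ denote Clifford multiplication, and $\gamma_{abA'}{}^{B'}=\gamma_{[a|A'}{}^{C}\gamma_{|b]C}{}^{B'}$. Let $\xi^{A'}\in\mathfrak S^+$ be a pure spinor: $\xi\neq0$ and the space $\mathfrak V^{1/2}=\{v\in\mathfrak V: v^a\xi_a^{A}=0\}$ is $m$-dimensional, where $\xi_a^A=\xi^{B'}\gamma_{aB'}{}^{A}$. Put $\xi_{ab}{}^{A'}=\xi^{B'}\gamma_{abB'}{}^{A'}$. Let $\mathfrak g=\mathfrak{so}(\mathfrak V,g)\cong\wedge^2\mathfrak V^*$ and let $\mathfrak p=\{\phi\in\mathfrak g:\phi_{ab}\,\xi^{abA'}\propto\xi^{A'}\}$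 be the parabolic subalgebra stabilising $\langle\xi\rangle$. The $\mathfrak p$-module $\mathfrak W=\mathfrak V\otimes(\mathfrak g/\mathfrak p)$ has the filtration by $\mathfrak p$-submodules $$\mathfrak W^{1/2}=0\subset\mathfrak W^{-1/2}=\mathfrak V^{1/2}\otimes(\mathfrak g/\mathfrak p)\subset\mathfrak W^{-3/2}=\mathfrak W ,\qquad \mathrm{gr}_{-1/2}(\mathfrak W)=\mathfrak W^{-1/2},\quad \mathrm{gr}_{-3/2}(\mathfrak W)=\mathfrak W^{-3/2}/\mathfrak W^{-1/2}.$$ For $\Gamma_{abc}=\Gamma_{a[bc]}\in\mathfrak V\otimes\mathfrak g$ define $$\Pi_{-3/2}^0(\Gamma)=\Gamma_{abc}\xi^{a[A}\xi^{bB}\xi^{cC]},\qquad \Pi_{-3/2}^1(\Gamma)=\Gamma_{abc}\xi^{a(A}\xi^{bB)}\xi^{cC},$$ $$\Pi_{-1/2}^0(\Gamma)=\xi^{A'}\Gamma_{bcd}\xi^{cdD'}\gamma^b{}_{D'}{}^{B}-\xi^{bB}\Gamma_{bcd}\xi^{cdA'},$$ $$\Pi_{-1/2}^1(\Gamma)=\Gamma_{abc}\xi^{bB}\xi^{cC}-\tfrac1{2(m-1)}\Big(\xi_a^{[B|}\Gamma_{bcd}\xi^{cdD'}\gamma^b{}_{D'}{}^{|C]}+\xi^{b[B|}\Gamma_{bcd}\xi^{cdD'}\gamma_{aD'}{}^{|C]}\Big)+\delta_{m,3}\,\tfrac16\,\xi^{bA}\Gamma_{bcd}\xi^{cd}{}_A\,\gamma_a{}^{BC},$$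 where in the last term, present only for $m=3$, primed indices are converted by an isomorphism $\mathfrak S^+\cong(\mathfrak S^-)^*$ given by a nondegenerate $\mathrm{Spin}$-invariant bilinear form on $\mathfrak S$. A splitting is a totally null complement $\mathfrak V_{-1/2}$ of $\mathfrak V_{1/2}:=\mathfrak V^{1/2}$ in $\mathfrak V$. It determines the reductive part $\mathfrak g_0=\{\phi\in\mathfrak p:\phi\mathfrak V_{-1/2}\subset\mathfrak V_{-1/2}\}\cong\mathfrak{gl}(m,\mathbb C)$ of $\mathfrak p$; the nilpotent part is $\mathfrak g_1=\{\phi\in\mathfrak g:\xi^{bA}\phi_{ba}=0\}$. Then: (1) There are direct sum decompositions into $\mathfrak p$-submodules $$\mathrm{gr}_{-1/2}(\mathfrak W)=\mathfrak W_{-1/2}^0\oplus\mathfrak W_{-1/2}^1,\qquad \mathrm{gr}_{-3/2}(\mathfrak W)=\mathfrak W_{-3/2}^0\oplus\mathfrak W_{-3/2}^1 .$$ Each $\mathfrak W_i^j$ is irreducible, as a $\mathfrak p$-module and, for every splitting, as a $\mathfrak g_0$-module, and for every splitting there are isomorphisms of $\mathfrak g_0$-modules $$\mathfrak W_{-3/2}^0\cong\wedge^3\mathfrak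 V_{-1/2},\qquad \mathfrak W_{-3/2}^1\cong\{T^{ABC}=T^{A[BC]}:T^{[ABC]}=0\}\subset\mathfrak V_{-1/2}\otimes\wedge^2\mathfrak V_{-1/2},$$ $$\mathfrak W_{-1/2}^0\cong\mathfrak V_{-1/2},\qquad \mathfrak W_{-1/2}^1\cong\{T_A{}^{BC}=T_A{}^{[BC]}:T_A{}^{AC}=0\}\subset\mathfrak V_{1/2}\otimes\wedge^2\mathfrak V_{-1/2}.$$ Their dimensions are $\tfrac16m(m-1)(m-2)$, $\tfrac13m(m^2-1)$, $m$ and $\tfrac12m(m+1)(m-2)$ respectively. Let $\varpi_1,\dots,\varpi_m$ be the fundamental weights of $\mathfrak g$ for the simple roots $\varepsilon_1-\varepsilon_2,\dots,\varepsilon_{m-1}-\varepsilon_m,\varepsilon_{m-1}+\varepsilon_m$, where $\varepsilon_1,\dots,\varepsilon_m$ are the weights of $\mathfrak V_{1/2}$. The highest weights are $\varpi_{m-3}-2\varpi_m$, $\varpi_{m-2}+\varpi_{m-1}-3\varpi_m$, $\varpi_{m-1}-\varpi_m$ and $\varpi_1+\varpi_{m-2}-2\varpi_m$ respectively, where $\varpi_0=0$.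 (2) For $i=-\tfrac32,-\tfrac12$ and $j=0,1$, $$\mathfrak W_i^j=\{[\Gamma]\in\mathfrak W^i:\Pi_i^k(\Gamma)=0\text{ for }k\neq j\}/\mathfrak W^{i+1},$$ where $[\Gamma]$ is the class in $\mathfrak W$ of $\Gamma\in\mathfrak V\otimes\mathfrak g$ and the condition does not depend on the choice of $\Gamma$. (3) For every splitting, each $\mathfrak W_i^j$ is isomorphic to some $\mathfrak g_0$-submodule of $\mathfrak W$, and for any choice of $\mathfrak g_0$-submodules $\breve{\mathfrak W}_i^j\subset\mathfrak W$ isomorphic to $\mathfrak W_i^j$ one has $$\breve{\mathfrak W}_{-1/2}^1\subset\mathfrak g_1\cdot\breve{\mathfrak W}_{-3/2}^1,\qquad \breve{\mathfrak W}_{-1/2}^0\subset\mathfrak g_1\cdot\breve{\mathfrak W}_{-3/2}^1,\qquad \breve{\mathfrak W}_{-1/2}^0\subset\mathfrak g_1\cdot\breve{\mathfrak W}_{-3/2}^0,$$ while $\breve{\mathfrak W}_{-1/2}^1\subset\mathfrak g_1\cdot\breve{\mathfrak W}_{-3/2}^0$ holds if and only if $m>3$. -/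

import Mathlib

open scoped TensorProduct

attribute [local instance 100] LieRing.ofAssociativeRing

noncomputable section

namespace IntrinsicTorsion

/-! ### Permutations, symmetrisers and contraction on three-fold tensors -/

section Tensors

variable {U : Type*} [AddCommGroup U] [Module ℂ U]

/-- `x ⊗ y ⊗ z ↦ y ⊗ x ⊗ z`. -/
def swap12 : (U ⊗[ℂ] (U ⊗[ℂ] U)) →ₗ[ℂ] (U ⊗[ℂ] (U ⊗[ℂ] U)) :=
  (TensorProduct.leftComm ℂ U U U).toLinearMap

/-- `x ⊗ y ⊗ z ↦ x ⊗ z ⊗ y`. -/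
def swap23 : (U ⊗[ℂ] (U ⊗[ℂ] U)) →ₗ[ℂ] (U ⊗[ℂ] (U ⊗[ℂ] U)) :=
  TensorProduct.map LinearMap.id (TensorProduct.comm ℂ U U).toLinearMap

/-- Symmetrisation of the first two indices, `T^{ABC} ↦ T^{(AB)C}`. -/
def symm12 : (U ⊗[ℂ] (U ⊗[ℂ] U)) →ₗ[ℂ] (U ⊗[ℂ] (U ⊗[ℂ] U)) :=
  (1 / 2 : ℂ) • (LinearMap.id + swap12)

/-- Total skew-symmetrisation, `T^{ABC} ↦ T^{[ABC]}`. -/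
def alt3 : (U ⊗[ℂ] (U ⊗[ℂ] U)) →ₗ[ℂ] (U ⊗[ℂ] (U ⊗[ℂ] U)) :=
  (1 / 6 : ℂ) • (LinearMap.id - swap12 - swap23 - swap12 ∘ₗ swap23 ∘ₗ swap12
    + swap12 ∘ₗ swap23 + swap23 ∘ₗ swap12)

/-- Skew product of two vectors, `x^{[B} y^{C]} = (x ⊗ y - y ⊗ x) / 2`. -/
def alt : U →ₗ[ℂ] U →ₗ[ℂ] (U ⊗[ℂ] U) :=
  (1 / 2 : ℂ) • (TensorProduct.mk ℂ U U - (TensorProduct.mk ℂ U U).flip)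

/-- Contraction of the first two indices with a bilinear form: `x ⊗ y ⊗ z ↦ B(x, y) z`. -/
def contract12 (B : LinearMap.BilinForm ℂ U) : (U ⊗[ℂ] (U ⊗[ℂ] U)) →ₗ[ℂ] U :=
  (TensorProduct.lid ℂ U).toLinearMap ∘ₗ
    TensorProduct.map (TensorProduct.lift B) LinearMap.id ∘ₗ
    (TensorProduct.assoc ℂ U U U).symm.toLinearMap

/-- For a nondegenerate form `B`, the isomorphism `U ⊗ U ≅ End U` which lowers the first index,
`x ⊗ y ↦ (u ↦ B(x, u) y)`. -/
def tensorEquivEnd [FiniteDimensional ℂ U] (B : LinearMap.BilinForm ℂ U) (hB : B.Nondegenerate) :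
    (U ⊗[ℂ] U) ≃ₗ[ℂ] Module.End ℂ U :=
  (TensorProduct.congr (B.toDual hB) (LinearEquiv.refl ℂ U)).trans (dualTensorHomEquiv ℂ U U)

theorem tensorEquivEnd_tmul [FiniteDimensional ℂ U] (B : LinearMap.BilinForm ℂ U)
    (hB : B.Nondegenerate) (x y u : U) : tensorEquivEnd B hB (x ⊗ₜ y) u = B x u • y := by
  simp [tensorEquivEnd, dualTensorHomEquiv, LinearMap.BilinForm.toDual_def]

end Tensors

/-! ### Spinors -/

section Setting

variable {V : Type*} [AddCommGroup V] [Module ℂ V]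

/-- The quadratic form `v ↦ - g(v, v)`, so that `v * v = - g(v, v)` in its Clifford algebra. -/
abbrev cliffordForm (g : LinearMap.BilinForm ℂ V) : QuadraticForm ℂ V :=
  -(LinearMap.BilinMap.toQuadraticMap g)

/-- An orientation of the `2m`-dimensional space `(V, g)`, viewed as an element of the Clifford
algebra: a multiple of `e₁ ⋯ e₂ₘ`, with `e` an orthonormal basis, normalised to square to `1`. -/
def IsOrientation (g : LinearMap.BilinForm ℂ V) (m : ℕ) (ω : CliffordAlgebra (cliffordForm g)) :
    Prop :=
  ω * ω = 1 ∧ ∃ (e : Module.Basis (Fin (2 * m)) ℂ V) (c : ℂ),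
    (∀ i j, g (e i) (e j) = if i = j then 1 else 0) ∧
    ω = c • (List.ofFn fun i => CliffordAlgebra.ι (cliffordForm g) (e i)).prod

end Setting

/-- A `2m`-dimensional complex vector space `V` with a nondegenerate symmetric bilinear form `g`
and an orientation `ω`, its `2 ^ m`-dimensional spinor space `S`, i.e. a Clifford module of that
dimension, and a positive pure spinor `ξ`. -/
structure PureSpinor (m : ℕ) (V S : Type*) [AddCommGroup V] [Module ℂ V]
    [AddCommGroup S] [Module ℂ S] where
  g : LinearMap.BilinForm ℂ V
  symm : g.IsSymm
  nondeg : g.Nondegenerate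
  finrank_V : Module.finrank ℂ V = 2 * m
  /-- Clifford multiplication on spinors. -/
  ρ : CliffordAlgebra (cliffordForm g) →ₐ[ℂ] Module.End ℂ S
  finrank_S : Module.finrank ℂ S = 2 ^ m
  ω : CliffordAlgebra (cliffordForm g)
  orientation : IsOrientation g m ω
  ξ : S
  ξ_ne_zero : ξ ≠ 0
  /-- `ξ` is of positive chirality. -/
  ξ_pos : ρ ω ξ = ξ
  /-- `ξ` is pure: the space of `v` with `v · ξ = 0` is `m`-dimensional. -/
  ξ_pure : Module.finrank ℂ
    (LinearMap.ker ((ρ.toLinearMap ∘ₗ CliffordAlgebra.ι (cliffordForm g)).flip ξ)) = m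

namespace PureSpinor

variable {m : ℕ} {V S : Type*} [AddCommGroup V] [Module ℂ V] [AddCommGroup S] [Module ℂ S]

section Basic

variable (D : PureSpinor m V S)

/-- Clifford multiplication by vectors, `v ↦ (s ↦ v · s)`; in indices `v^a γ_a`. -/
def cl : V →ₗ[ℂ] Module.End ℂ S :=
  D.ρ.toLinearMap ∘ₗ CliffordAlgebra.ι (cliffordForm D.g)

/-- The map `ξ_a^A : v ↦ v · ξ`. -/
def xi : V →ₗ[ℂ] S := D.cl.flip D.ξ

/-- `x ⊗ y ↦ (1/2) (y x - x y)` acting on spinors.  In indices: `T^{ab} ↦ T^{ab} γ_{ab}`, where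
`γ_{ab} = γ_{[a} γ_{b]}` is composed from left to right, `s^{B'} γ_{a B'}^C γ_{b C}^{A'}`. -/
def cl2 : (V ⊗[ℂ] V) →ₗ[ℂ] Module.End ℂ S :=
  TensorProduct.lift ((1 / 2 : ℂ) •
    (((LinearMap.mul ℂ (Module.End ℂ S)).compl₁₂ D.cl D.cl).flip -
      (LinearMap.mul ℂ (Module.End ℂ S)).compl₁₂ D.cl D.cl))

theorem cl_mul_cl_add (v w : V) :
    D.cl v * D.cl w + D.cl w * D.cl v = (-2 * D.g v w) • (1 : Module.End ℂ S) := by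
  have h := CliffordAlgebra.ι_mul_ι_add_swap (Q := cliffordForm D.g) v w
  have h2 := congrArg D.ρ h
  rw [map_add, map_mul, map_mul, AlgHom.commutes, Algebra.algebraMap_eq_smul_one] at h2
  refine h2.trans ?_
  congr 1
  have := D.symm.eq w v
  simp [QuadraticMap.polar, LinearMap.BilinMap.toQuadraticMap_apply, this]
  ring

theorem cl2_tmul (x y : V) :
    D.cl2 (x ⊗ₜ y) = (1 / 2 : ℂ) • (D.cl y * D.cl x - D.cl x * D.cl y) := by
  simp [cl2]

/-- The Lie algebra `𝔤 = 𝔰𝔬(V, g)`. -/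
abbrev so : LieSubalgebra ℂ (Module.End ℂ V) := skewAdjointLieSubalgebra D.g

theorem skew {φ : Module.End ℂ V} (h : φ ∈ D.so) (v w : V) : D.g (φ v) w = - D.g v (φ w) := by
  have h' : φ ∈ D.g.skewAdjointSubmodule := h
  rw [LinearMap.mem_skewAdjointSubmodule] at h'
  simpa using h' v w

variable [FiniteDimensional ℂ V]

/-- The `2`-form `φ_{ab} = g(φ e_a, e_b)` of an endomorphism `φ`, with both indices raised. -/
def twoForm : Module.End ℂ V →ₗ[ℂ] (V ⊗[ℂ] V) :=
  (tensorEquivEnd D.g D.nondeg).symm.toLinearMap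

theorem tensorEquivEnd_twoForm (φ : Module.End ℂ V) :
    tensorEquivEnd D.g D.nondeg (D.twoForm φ) = φ := by
  simp [twoForm]

theorem cl2_comm (t : V ⊗[ℂ] V) (v : V) :
    D.cl2 t * D.cl v - D.cl v * D.cl2 t =
      (2 : ℂ) • D.cl (tensorEquivEnd D.g D.nondeg (TensorProduct.comm ℂ V V t) v
        - tensorEquivEnd D.g D.nondeg t v) := by
  induction t with
  | zero => simp
  | add a b ha hb =>
    simp only [map_add, LinearMap.add_apply, add_mul, mul_add]
    rw [add_sub_add_comm, ha, hb, ← smul_add, ← map_add]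
    congr 2
    abel
  | tmul x y =>
    simp only [TensorProduct.comm_tmul, tensorEquivEnd_tmul, cl2_tmul, map_sub, map_smul]
    have h1 := D.cl_mul_cl_add x v
    have h2 := D.cl_mul_cl_add y v
    set X := D.cl x
    set Y := D.cl y
    set Z := D.cl v
    have e1 : X * Z = (-2 * D.g x v) • 1 - Z * X := eq_sub_of_add_eq h1
    have e2 : Y * Z = (-2 * D.g y v) • 1 - Z * Y := eq_sub_of_add_eq h2
    have f1 : Y * X * Z = (-2 * D.g x v) • Y - (-2 * D.g y v) • X + Z * Y * X := by
      rw [mul_assoc, e1, mul_sub, ← mul_assoc, e2, sub_mul]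
      simp only [mul_smul_comm, smul_mul_assoc, mul_one, one_mul]
      abel
    have f2 : X * Y * Z = (-2 * D.g y v) • X - (-2 * D.g x v) • Y + Z * X * Y := by
      rw [mul_assoc, e2, mul_sub, ← mul_assoc, e1, sub_mul]
      simp only [mul_smul_comm, smul_mul_assoc, mul_one, one_mul]
      abel
    rw [smul_mul_assoc, mul_smul_comm, sub_mul, mul_sub, f1, f2, ← mul_assoc, ← mul_assoc]
    module

theorem swap_twoForm {φ : Module.End ℂ V} (h : φ ∈ D.so) :
    tensorEquivEnd D.g D.nondeg (TensorProduct.comm ℂ V V (D.twoForm φ)) = -φ := by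
  have key : ∀ (t : V ⊗[ℂ] V) (v w : V), D.g (tensorEquivEnd D.g D.nondeg t v) w =
      D.g v (tensorEquivEnd D.g D.nondeg (TensorProduct.comm ℂ V V t) w) := by
    intro t v w
    induction t with
    | zero => simp
    | add a b ha hb => simp only [map_add, LinearMap.add_apply, ha, hb]
    | tmul x y =>
      have := D.symm.eq v x
      simp [tensorEquivEnd_tmul, this, mul_comm]
  ext w
  have h0 : ∀ v, D.g v (tensorEquivEnd D.g D.nondeg (TensorProduct.comm ℂ V V (D.twoForm φ)) w
      - (-φ) w) = 0 := by
    intro v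
    rw [map_sub, ← key, tensorEquivEnd_twoForm, D.skew h]
    simp
  exact sub_eq_zero.mp (D.nondeg.2 _ h0)

/-- Minus a quarter of `cl2 (twoForm φ)` is the spin action of `φ ∈ 𝔰𝔬(V, g)`. -/
theorem spin_comm {φ : Module.End ℂ V} (h : φ ∈ D.so) (v : V) :
    D.cl2 (D.twoForm φ) * D.cl v - D.cl v * D.cl2 (D.twoForm φ) = (-4 : ℂ) • D.cl (φ v) := by
  rw [cl2_comm, D.swap_twoForm h, tensorEquivEnd_twoForm]
  simp only [LinearMap.neg_apply, map_sub, map_neg]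
  module

theorem twoForm_lie {φ : Module.End ℂ V} (h : φ ∈ D.so) (ψ : Module.End ℂ V) :
    D.twoForm ⁅φ, ψ⁆ = TensorProduct.map φ LinearMap.id (D.twoForm ψ)
      + TensorProduct.map LinearMap.id φ (D.twoForm ψ) := by
  apply (tensorEquivEnd D.g D.nondeg).injective
  rw [tensorEquivEnd_twoForm]
  have key : ∀ t : V ⊗[ℂ] V, tensorEquivEnd D.g D.nondeg (TensorProduct.map φ LinearMap.id t
      + TensorProduct.map LinearMap.id φ t) = ⁅φ, tensorEquivEnd D.g D.nondeg t⁆ := by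
    intro t
    induction t with
    | zero => simp
    | add a b ha hb =>
      rw [map_add (tensorEquivEnd D.g D.nondeg) a b, lie_add, ← ha, ← hb]
      simp only [map_add]
      abel
    | tmul x y =>
      ext u
      simp [tensorEquivEnd_tmul, LieRing.of_associative_ring_bracket, D.skew h]
      abel
  rw [key, tensorEquivEnd_twoForm]

theorem spin_lie {φ ψ : Module.End ℂ V} (h : φ ∈ D.so) :
    D.cl2 (D.twoForm φ) * D.cl2 (D.twoForm ψ) - D.cl2 (D.twoForm ψ) * D.cl2 (D.twoForm φ) =
      (-4 : ℂ) • D.cl2 (D.twoForm ⁅φ, ψ⁆) := by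
  rw [D.twoForm_lie h ψ]
  generalize D.twoForm ψ = t
  set A := D.cl2 (D.twoForm φ) with hA
  induction t with
  | zero => simp
  | add a b ha hb =>
    simp only [map_add, add_mul, mul_add, smul_add] at ha hb ⊢
    rw [add_sub_add_comm, ha, hb]
    abel
  | tmul x y =>
    have hx : A * D.cl x = D.cl x * A + (-4 : ℂ) • D.cl (φ x) := by
      rw [← D.spin_comm h x]; abel
    have hy : A * D.cl y = D.cl y * A + (-4 : ℂ) • D.cl (φ y) := by
      rw [← D.spin_comm h y]; abel
    simp only [TensorProduct.map_tmul, LinearMap.id_apply, map_add, cl2_tmul]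
    rw [mul_smul_comm, smul_mul_assoc, mul_sub, sub_mul, ← mul_assoc A, ← mul_assoc A, hx, hy,
      add_mul, add_mul, mul_assoc (D.cl y) A, mul_assoc (D.cl x) A, hx, hy]
    simp only [mul_add, smul_mul_assoc, mul_smul_comm, mul_assoc]
    module

/-- The parabolic subalgebra `𝔭 ⊆ 𝔤` stabilising the line `⟨ξ⟩`: all `φ ∈ 𝔤` such that
`φ_{ab} γ^{ab} ξ` is proportional to `ξ`. -/
def par : LieSubalgebra ℂ D.so where
  carrier := {φ | ∃ c : ℂ, D.cl2 (D.twoForm φ) D.ξ = c • D.ξ}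
  add_mem' := by
    rintro a b ⟨c, hc⟩ ⟨d, hd⟩
    exact ⟨c + d, by simp [hc, hd, add_smul]⟩
  zero_mem' := ⟨0, by simp⟩
  smul_mem' := by
    rintro r a ⟨c, hc⟩
    exact ⟨r * c, by simp [hc, mul_smul]⟩
  lie_mem' := by
    rintro a b ⟨c, hc⟩ ⟨d, hd⟩
    refine ⟨0, ?_⟩
    have h := congrArg (fun T : Module.End ℂ S => T D.ξ) (D.spin_lie (ψ := (b : Module.End ℂ V)) a.2)
    simp only [LinearMap.sub_apply, Module.End.mul_apply, hc, hd, map_smul, LinearMap.smul_apply]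
      at h
    rw [smul_comm d c, sub_self] at h
    rw [zero_smul]
    exact (smul_eq_zero.mp h.symm).resolve_left (by norm_num)

/-- `V^{1/2}`, the `α`-plane of all `v` with `v · ξ = 0`, as a `𝔭`-module. -/
def alphaPlane : LieSubmodule ℂ D.par V where
  __ := LinearMap.ker D.xi
  lie_mem := by
    intro φ v hv
    obtain ⟨c, hc⟩ := φ.2
    have hv' : D.cl v D.ξ = 0 := hv
    have h := congrArg (fun T : Module.End ℂ S => T D.ξ) (D.spin_comm φ.1.2 v)
    simp only [LinearMap.sub_apply, Module.End.mul_apply, hc, hv', map_zero, map_smul, smul_zero,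
      sub_self, LinearMap.smul_apply] at h
    exact (smul_eq_zero.mp h.symm).resolve_left (by norm_num)

/-- The `𝔭`-module `W = V ⊗ (𝔤 / 𝔭)`, equal to the first step `W^{-3/2}` of its filtration. -/
abbrev W := V ⊗[ℂ] (D.so ⧸ D.par.toLieSubmodule)

/-- The second step of the filtration, `W^{-1/2} = V^{1/2} ⊗ (𝔤 / 𝔭) ⊆ W`. -/
def Whalf : LieSubmodule ℂ D.par D.W :=
  (TensorProduct.LieModule.map D.alphaPlane.incl
    (LieModuleHom.id : (D.so ⧸ D.par.toLieSubmodule) →ₗ⁅ℂ, D.par⁆ _)).range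

/-- `gr_{-1/2}(W) = W^{-1/2}`. -/
abbrev grHalf := ↥D.Whalf

/-- `gr_{-3/2}(W) = W^{-3/2} / W^{-1/2}`. -/
abbrev grThreeHalf := D.W ⧸ D.Whalf

/-- The class in `W` of `Γ ∈ V ⊗ 𝔤`. -/
def toW : (V ⊗[ℂ] D.so) →ₗ[ℂ] D.W :=
  TensorProduct.map LinearMap.id
    (LieSubmodule.Quotient.mk' D.par.toLieSubmodule : D.so →ₗ[ℂ] D.so ⧸ D.par.toLieSubmodule)

/-! ### The projection maps -/

/-- The inclusion `𝔤 → V ⊗ V`, `φ ↦ φ^{ab}`. -/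
def soTwoForm : D.so →ₗ[ℂ] (V ⊗[ℂ] V) := D.twoForm ∘ₗ D.so.toSubmodule.subtype

/-- `φ ↦ φ_{bc} ξ^{bB} ξ^{cC}`. -/
def xiXi : D.so →ₗ[ℂ] (S ⊗[ℂ] S) := TensorProduct.map D.xi D.xi ∘ₗ D.soTwoForm

/-- `φ ↦ φ_{cd} ξ^{cd D'}`, where `ξ_{cd}^{D'} = ξ^{B'} γ_{cd B'}^{D'}`. -/
def xi2 : D.so →ₗ[ℂ] S := (D.cl2.flip D.ξ) ∘ₗ D.soTwoForm

/-- `Π_{-3/2}^0 : Γ ↦ Γ_{abc} ξ^{a[A} ξ^{bB} ξ^{cC]}`. -/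
def Pi30 : (V ⊗[ℂ] D.so) →ₗ[ℂ] (S ⊗[ℂ] (S ⊗[ℂ] S)) := alt3 ∘ₗ TensorProduct.map D.xi D.xiXi

/-- `Π_{-3/2}^1 : Γ ↦ Γ_{abc} ξ^{a(A} ξ^{bB)} ξ^{cC}`. -/
def Pi31 : (V ⊗[ℂ] D.so) →ₗ[ℂ] (S ⊗[ℂ] (S ⊗[ℂ] S)) := symm12 ∘ₗ TensorProduct.map D.xi D.xiXi

/-- `Π_{-1/2}^0 : Γ ↦ ξ^{A'} Γ_{bcd} ξ^{cd D'} γ^b_{D'}^B - ξ^{bB} Γ_{bcd} ξ^{cd A'}`. -/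
def Pi10 : (V ⊗[ℂ] D.so) →ₗ[ℂ] (S ⊗[ℂ] S) :=
  TensorProduct.lift (LinearMap.mk₂ ℂ
    (fun (u : V) (φ : D.so) => D.ξ ⊗ₜ[ℂ] (D.cl u (D.xi2 φ)) - (D.xi2 φ) ⊗ₜ[ℂ] (D.xi u))
    (by intros; simp only [map_add, LinearMap.add_apply, TensorProduct.tmul_add]; abel)
    (by intros; simp only [map_smul, LinearMap.smul_apply, TensorProduct.tmul_smul, smul_sub])
    (by intros; simp only [map_add, TensorProduct.tmul_add, TensorProduct.add_tmul]; abel)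
    (by intros; simp only [map_smul, TensorProduct.tmul_smul, TensorProduct.smul_tmul',
          smul_sub]))

variable [FiniteDimensional ℂ S]

/-- A nondegenerate `Spin`-invariant bilinear form on the spinor space.  For odd `m` it pairs `S⁺`
with `S⁻`, which gives the isomorphism `S⁺ ≅ (S⁻)*`. -/
def IsSpinForm (ε : LinearMap.BilinForm ℂ S) : Prop :=
  ε.Nondegenerate ∧
    ∀ (v w : V) (s t : S), ε (D.cl v (D.cl w s)) t = ε s (D.cl w (D.cl v t))

/-- For `v ∈ V`, the element `v^a γ_a^{BC}` of `S⁻ ⊗ S⁻`, which is `γ_{a A'}^C : S⁺ → S⁻` with its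
index `A'` raised by `ε`: if it equals `∑ x ⊗ y` then `∑ ε(s, x) y` is `v · s` for `s ∈ S⁺` and `0`
for `s ∈ S⁻`. -/
def gammaUp (ε : LinearMap.BilinForm ℂ S) (hε : D.IsSpinForm ε) : V →ₗ[ℂ] (S ⊗[ℂ] S) :=
  (tensorEquivEnd ε.flip (LinearMap.flip_nondegenerate.mpr hε.1)).symm.toLinearMap ∘ₗ
    (LinearMap.mulRight ℂ ((1 / 2 : ℂ) • (1 + D.ρ D.ω))) ∘ₗ D.cl

/-- `Γ ↦ ξ_a^{[B} Γ_{bcd} ξ^{cd D'} γ^b_{D'}^{C]} + ξ^{b[B} Γ_{bcd} ξ^{cd D'} γ_{a D'}^{C]}`, with the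
free index `a` as the argument of a linear map on `V`. -/
def traceTerm : (V ⊗[ℂ] D.so) →ₗ[ℂ] (V →ₗ[ℂ] (S ⊗[ℂ] S)) :=
  TensorProduct.lift (LinearMap.mk₂ ℂ
    (fun (u : V) (φ : D.so) =>
      (alt.flip (D.cl u (D.xi2 φ))) ∘ₗ D.xi + (alt (D.xi u)) ∘ₗ (D.cl.flip (D.xi2 φ)))
    (by intros; simp only [map_add, LinearMap.add_apply, LinearMap.add_comp]; abel)
    (by intros; simp only [map_smul, LinearMap.smul_apply, LinearMap.smul_comp, smul_add])
    (by intros; simp only [map_add, LinearMap.add_comp, LinearMap.comp_add]; abel)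
    (by intros; simp only [map_smul, LinearMap.smul_comp, LinearMap.comp_smul, smul_add]))

/-- `Γ ↦ Γ_{abc} ξ^{bB} ξ^{cC}`, with the free index `a` as the argument of a linear map on `V`. -/
def mainTerm : (V ⊗[ℂ] D.so) →ₗ[ℂ] (V →ₗ[ℂ] (S ⊗[ℂ] S)) :=
  dualTensorHom ℂ V (S ⊗[ℂ] S) ∘ₗ TensorProduct.map D.g D.xiXi

/-- `Γ ↦ ξ^{bA} Γ_{bcd} ξ^{cd}_A`, where the index `A` is lowered by `ε`. -/
def scalarTerm (ε : LinearMap.BilinForm ℂ S) : (V ⊗[ℂ] D.so) →ₗ[ℂ] ℂ :=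
  TensorProduct.lift ((ε.compl₁₂ D.xi2 D.xi).flip)

/-- `Π_{-1/2}^1`: for `m > 3`,
`Γ ↦ Γ_{abc} ξ^{bB} ξ^{cC} - 1/(2(m-1)) (ξ_a^{[B} Γ_{bcd} ξ^{cd D'} γ^b_{D'}^{C]}
  + ξ^{b[B} Γ_{bcd} ξ^{cd D'} γ_{a D'}^{C]})`,
and for `m = 3` the term `(1/6) ξ^{bA} Γ_{bcd} ξ^{cd}_A γ_a^{BC}` is added. -/
def Pi11 (ε : LinearMap.BilinForm ℂ S) (hε : D.IsSpinForm ε) :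
    (V ⊗[ℂ] D.so) →ₗ[ℂ] (V →ₗ[ℂ] (S ⊗[ℂ] S)) :=
  D.mainTerm - (1 / (2 * ((m : ℂ) - 1))) • D.traceTerm
    + (if m = 3 then (1 / 6 : ℂ) • (D.scalarTerm ε).smulRight (D.gammaUp ε hε) else 0)

end Basic

/-! ### Splittings, weights and the action of `𝔤₁` -/

section Splitting

variable [FiniteDimensional ℂ V] (D : PureSpinor m V S)

/-- A splitting `V = V_{1/2} ⊕ V_{-1/2}`: `M = V_{-1/2}` is a totally null complement of the
`α`-plane. -/
def IsSplitting (M : Submodule ℂ V) : Prop :=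
  IsCompl (D.alphaPlane : Submodule ℂ V) M ∧ ∀ x ∈ M, ∀ y ∈ M, D.g x y = 0

/-- The reductive part `𝔤₀` of `𝔭` determined by `V_{-1/2} = M`. -/
def g0 (M : Submodule ℂ V) : LieSubalgebra ℂ D.par where
  carrier := {φ | ∀ v ∈ M, ⁅φ, v⁆ ∈ M}
  add_mem' := by
    intro a b ha hb v hv
    rw [add_lie]
    exact M.add_mem (ha v hv) (hb v hv)
  zero_mem' := by
    intro v _
    rw [zero_lie]
    exact M.zero_mem
  smul_mem' := by
    intro c a ha v hv
    rw [smul_lie]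
    exact M.smul_mem c (ha v hv)
  lie_mem' := by
    intro a b ha hb v hv
    rw [lie_lie]
    exact M.sub_mem (ha _ (hb v hv)) (hb _ (ha v hv))

/-- The nilpotent part `𝔤₁` of `𝔭`: all `φ` with `ξ^{bA} φ_{ba} = 0`. -/
def g1 : Set D.par :=
  {φ | TensorProduct.map D.xi LinearMap.id (D.twoForm φ) = 0}

/-- `𝔤₁ · B`, the span of all `φ · w` with `φ ∈ 𝔤₁` and `w ∈ B`. -/
def g1Span (B : Submodule ℂ D.W) : Submodule ℂ D.W :=
  Submodule.span ℂ {w | ∃ φ ∈ D.g1, ∃ b ∈ B, w = ⁅φ, b⁆}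

/-- The image of `X ⊗ Y ⊗ Z` in `V ⊗ V ⊗ V`. -/
def tensor3 (X Y Z : Submodule ℂ V) : Submodule ℂ (V ⊗[ℂ] (V ⊗[ℂ] V)) :=
  LinearMap.range (TensorProduct.map X.subtype (TensorProduct.map Y.subtype Z.subtype))

/-- `Λ³ V_{-1/2}`: totally skew tensors in `V_{-1/2} ⊗ V_{-1/2} ⊗ V_{-1/2}`. -/
def wedge3 (M : Submodule ℂ V) : Submodule ℂ (V ⊗[ℂ] (V ⊗[ℂ] V)) :=
  tensor3 M M M ⊓ LinearMap.ker (swap12 + LinearMap.id) ⊓ LinearMap.ker (swap23 + LinearMap.id)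

/-- `V_{-1/2} ⊙ Λ² V_{-1/2}`, the Cartan part of `V_{-1/2} ⊗ Λ² V_{-1/2}`: tensors with
`T^{ABC} = T^{A[BC]}` and `T^{[ABC]} = 0`. -/
def cartan (M : Submodule ℂ V) : Submodule ℂ (V ⊗[ℂ] (V ⊗[ℂ] V)) :=
  tensor3 M M M ⊓ LinearMap.ker (swap23 + LinearMap.id) ⊓ LinearMap.ker alt3

/-- `V_{1/2} ⊗_∘ Λ² V_{-1/2}`: tensors with `T_A^{BC} = T_A^{[BC]}` and `T_A^{AC} = 0`. -/
def traceFree (M : Submodule ℂ V) : Submodule ℂ (V ⊗[ℂ] (V ⊗[ℂ] V)) :=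
  tensor3 D.alphaPlane M M ⊓ LinearMap.ker (swap23 + LinearMap.id) ⊓
    LinearMap.ker (contract12 D.g)

/-- `T M`, a subspace of the `𝔤`-module `U`, is isomorphic to `X` as a `𝔤₀`-module. -/
def IsModel (X : Type*) [AddCommGroup X] [Module ℂ X] [LieRingModule D.par X]
    {U : Type*} [AddCommGroup U] [Module ℂ U] [LieRingModule D.par U]
    (M : Submodule ℂ V) (T : Submodule ℂ U) : Prop :=
  ∃ f : X →ₗ[ℂ] U, Function.Injective f ∧ LinearMap.range f = T ∧
    ∀ φ ∈ D.g0 M, ∀ x : X, f ⁅φ, x⁆ = ⁅φ, f x⁆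

/-- The `𝔭`-module `X` has highest weight `l₁ ε₁ + ⋯ + lₘ εₘ` with Dynkin labels `a₁, …, aₘ`, for
the simple roots `ε₁ - ε₂, …, εₘ₋₁ - εₘ, εₘ₋₁ + εₘ` defined by the basis `e` of `V_{1/2}`: there is
a nonzero vector on which every element of `𝔭` that acts on `V_{1/2}` by an upper triangular
matrix `A` acts by the scalar `l₁ A₁₁ + ⋯ + lₘ Aₘₘ`. -/
def HasDynkinLabels (X : Type*) [AddCommGroup X] [Module ℂ X] [LieRingModule D.par X]
    (e : Module.Basis (Fin m) ℂ D.alphaPlane) (a : ℕ → ℤ) : Prop :=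
  ∃ l : ℕ → ℤ, (∀ k, 1 ≤ k → k < m → l k - l (k + 1) = a k) ∧ l (m - 1) + l m = a m ∧
    ∃ x : X, x ≠ 0 ∧ ∀ (φ : D.par) (A : Matrix (Fin m) (Fin m) ℂ),
      (∀ j, ⁅φ, (e j : V)⁆ = ∑ i, A i j • (e i : V)) → (∀ i j, j < i → A i j = 0) →
        ⁅φ, x⁆ = (∑ k : Fin m, (l (k + 1) : ℂ) * A k k) • x

/-- `X` is an irreducible `𝔭`-module of dimension `d` with Dynkin labels `a`, which for every
splitting `V_{-1/2} = M` is irreducible under `𝔤₀` and isomorphic to the `𝔤₀`-module `T M`. -/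
def IsIrreducibleOfType (X : Type*) [AddCommGroup X] [Module ℂ X] [LieRingModule D.par X]
    {U : Type*} [AddCommGroup U] [Module ℂ U] [LieRingModule D.par U]
    (T : Submodule ℂ V → Submodule ℂ U) (a : ℕ → ℤ) (d : ℚ) : Prop :=
  LieModule.IsIrreducible ℂ D.par X ∧ (Module.finrank ℂ X : ℚ) = d ∧
    (∀ M, D.IsSplitting M → LieModule.IsIrreducible ℂ (D.g0 M) X ∧ D.IsModel X M (T M)) ∧
    ∀ e : Module.Basis (Fin m) ℂ D.alphaPlane, D.HasDynkinLabels X e a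

/-- `B`, a `𝔤₀`-submodule of `W`, is isomorphic to `X` as a `𝔤₀`-module. -/
def IsCopy {M : Submodule ℂ V} (B : LieSubmodule ℂ (D.g0 M) D.W)
    (X : Type*) [AddCommGroup X] [Module ℂ X] [LieRingModule D.par X] : Prop :=
  Nonempty (B ≃ₗ⁅ℂ, D.g0 M⁆ X)

end Splitting

/-- The label which is `1` at the node `j` and `0` at all others. -/
def node (j : ℕ) : ℕ → ℤ := fun k => if k = j then 1 else 0

end PureSpinor

end IntrinsicTorsion

end

/-! The theorem is reduced to linear algebra of arrays of complex numbers. The plane V_{1/2} is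
totally null, so a basis `e` of it can be completed by dual null vectors `f` to a frame of V, and
the `f` can be taken inside any given splitting. An element φ of 𝔤 lies in 𝔭 exactly when all g(φ
e_j, e_k) vanish (`Frame.mem_par_iff`). With U = V / V_{1/2}, this makes 𝔤/𝔭 a copy of Λ²U, and an
element of W becomes a pair of arrays that are skew in their last two indices: `lo` in U ⊗ Λ²U and
`hi` in U* ⊗ Λ²U. An element of 𝔭 is described by a matrix A, its action on U, and a skew matrix R.
A acts on both arrays as 𝔤𝔩(m), while R adds to `hi` the contraction of R with `lo` (`Frame.lo_lie`,
`Frame.hi_lie`). In these terms W^{-1/2} is `lo` = 0, 𝔤₀ is R = 0 and 𝔤₁ is A = 0.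

The decompositions are then the classical ones: U ⊗ Λ²U is the sum of Λ³U and the arrays with
vanishing cyclic sum, and U* ⊗ Λ²U is the sum of the pure traces and the trace-free arrays. Each
summand is irreducible because matrix units turn one well-chosen nonzero entry of an array into
generators of the whole summand (`Arr.isSimple_totSkew`, `Arr.isSimple_hook`, `Arr.isSimple_traces`,
`Arr.isSimple_noTrace`).

The maps Π are evaluated in a frame, where the spinors f_i · ξ are linearly independent. The two
maps at level -3/2 are symmetrisers applied to `lo`. Where `lo` = 0, the two maps at level -1/2 give
the trace of `hi` and `hi` minus its pure trace part. Since the Π do not refer to a frame, the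
submodules they cut out do not depend on one.

For the action of 𝔤₁, the element with A = 1 and R = 0 acts by 3 on `lo` and by 1 on `hi`, and the
two summands at each level have different dimensions. Hence W contains exactly one 𝔤₀-copy of each
piece (`IsCoord.eq_inf_of_equiv`), and each inclusion asks whether contracting a summand with skew
matrices reaches another one. The resulting span `Arr.raised` is 𝔤𝔩(m)-stable, so finding a few
explicit arrays in it is enough. The exception is m = 3: there Λ³U is a line, and its contractions
with skew matrices are all pure traces. -/

noncomputable section

namespace IntrinsicTorsion

/-! ### Three-index arrays -/

section Arrays

/-- Arrays of complex numbers with three indices. -/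
abbrev Arr (m : ℕ) := Fin m × Fin m × Fin m → ℂ

namespace Arr

variable {m : ℕ}

/-- Action of a matrix on the first index. -/
def slot1 (A : Matrix (Fin m) (Fin m) ℂ) : Module.End ℂ (Arr m) where
  toFun T p := ∑ l, A p.1 l * T (l, p.2.1, p.2.2)
  map_add' T T' := by ext; simp [mul_add, Finset.sum_add_distrib]
  map_smul' c T := by ext; simp [Finset.mul_sum, mul_left_comm]

/-- Action of a matrix on the second index. -/
def slot2 (A : Matrix (Fin m) (Fin m) ℂ) : Module.End ℂ (Arr m) where
  toFun T p := ∑ l, A p.2.1 l * T (p.1, l, p.2.2)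
  map_add' T T' := by ext; simp [mul_add, Finset.sum_add_distrib]
  map_smul' c T := by ext; simp [Finset.mul_sum, mul_left_comm]

/-- Action of a matrix on the third index. -/
def slot3 (A : Matrix (Fin m) (Fin m) ℂ) : Module.End ℂ (Arr m) where
  toFun T p := ∑ l, A p.2.2 l * T (p.1, p.2.1, l)
  map_add' T T' := by ext; simp [mul_add, Finset.sum_add_distrib]
  map_smul' c T := by ext; simp [Finset.mul_sum, mul_left_comm]

theorem slot1_apply (A : Matrix (Fin m) (Fin m) ℂ) (T : Arr m) (i j k : Fin m) :
    slot1 A T (i, j, k) = ∑ l, A i l * T (l, j, k) := rfl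

theorem slot2_apply (A : Matrix (Fin m) (Fin m) ℂ) (T : Arr m) (i j k : Fin m) :
    slot2 A T (i, j, k) = ∑ l, A j l * T (i, l, k) := rfl

theorem slot3_apply (A : Matrix (Fin m) (Fin m) ℂ) (T : Arr m) (i j k : Fin m) :
    slot3 A T (i, j, k) = ∑ l, A k l * T (i, j, l) := rfl

/-- The action of `𝔤𝔩(m)` on arrays `T^{ijk}`. -/
def act3 (A : Matrix (Fin m) (Fin m) ℂ) : Module.End ℂ (Arr m) := slot1 A + slot2 A + slot3 A

/-- The action of `𝔤𝔩(m)` on arrays `T_i^{jk}`. -/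
def act1 (A : Matrix (Fin m) (Fin m) ℂ) : Module.End ℂ (Arr m) :=
  -slot1 A.transpose + slot2 A + slot3 A

theorem act3_apply (A : Matrix (Fin m) (Fin m) ℂ) (T : Arr m) (i j k : Fin m) :
    act3 A T (i, j, k) = ∑ l, A i l * T (l, j, k) + ∑ l, A j l * T (i, l, k)
      + ∑ l, A k l * T (i, j, l) := rfl

theorem act1_apply (A : Matrix (Fin m) (Fin m) ℂ) (T : Arr m) (i j k : Fin m) :
    act1 A T (i, j, k) = -∑ l, A l i * T (l, j, k) + ∑ l, A j l * T (i, l, k)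
      + ∑ l, A k l * T (i, j, l) := rfl

/-- The array with a single nonzero entry, equal to one. -/
def unit (a b c : Fin m) : Arr m := Pi.single (a, b, c) 1

theorem unit_apply (a b c i j k : Fin m) : unit a b c (i, j, k) =
    if i = a ∧ j = b ∧ k = c then 1 else 0 := by
  simp [unit, Pi.single_apply, Prod.ext_iff]

/-- The trace `T_i^{ik}`. -/
def tr : Arr m →ₗ[ℂ] (Fin m → ℂ) where
  toFun T k := ∑ i, T (i, i, k)
  map_add' T T' := by ext; simp [Finset.sum_add_distrib]
  map_smul' c T := by ext; simp [Finset.mul_sum]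

theorem tr_apply (T : Arr m) (k : Fin m) : tr T k = ∑ i, T (i, i, k) := rfl

/-- The pure trace array `δ_i^j t^k - δ_i^k t^j`. -/
def pureTrace : (Fin m → ℂ) →ₗ[ℂ] Arr m where
  toFun t p := (if p.1 = p.2.1 then t p.2.2 else 0) - (if p.1 = p.2.2 then t p.2.1 else 0)
  map_add' t t' := by
    ext p
    simp only [Pi.add_apply]
    split_ifs <;> ring
  map_smul' c t := by
    ext p
    simp only [Pi.smul_apply, smul_eq_mul, RingHom.id_apply]
    split_ifs <;> ring

theorem pureTrace_apply (t : Fin m → ℂ) (i j k : Fin m) :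
    pureTrace t (i, j, k) = (if i = j then t k else 0) - (if i = k then t j else 0) := rfl

theorem tr_pureTrace (t : Fin m → ℂ) : tr (pureTrace t) = ((m : ℂ) - 1) • t := by
  ext k
  simp [tr_apply, pureTrace_apply, Finset.sum_sub_distrib]
  ring

/-- Arrays which are skew in the last two indices. -/
def skew : Submodule ℂ (Arr m) where
  carrier := {T | ∀ i j k, T (i, k, j) = -T (i, j, k)}
  add_mem' h h' i j k := by simp only [Pi.add_apply, h i j k, h' i j k]; ring
  zero_mem' := by simp
  smul_mem' c T h i j k := by simp [h i j k]

/-- Totally skew arrays. -/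
def totSkew : Submodule ℂ (Arr m) where
  carrier := {T | (∀ i j k, T (i, k, j) = -T (i, j, k)) ∧ ∀ i j k, T (j, i, k) = -T (i, j, k)}
  add_mem' h h' := ⟨fun i j k => by simp only [Pi.add_apply, h.1 i j k, h'.1 i j k]; ring,
    fun i j k => by simp only [Pi.add_apply, h.2 i j k, h'.2 i j k]; ring⟩
  zero_mem' := by simp
  smul_mem' c T h := ⟨fun i j k => by simp [h.1 i j k], fun i j k => by simp [h.2 i j k]⟩

/-- Arrays which are skew in the last two indices, with vanishing skew-symmetrisation. -/
def hook : Submodule ℂ (Arr m) where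
  carrier := {T | (∀ i j k, T (i, k, j) = -T (i, j, k)) ∧
    ∀ i j k, T (i, j, k) + T (j, k, i) + T (k, i, j) = 0}
  add_mem' {T T'} h h' := ⟨fun i j k => by simp only [Pi.add_apply, h.1 i j k, h'.1 i j k]; ring,
    fun i j k => by
      simp only [Pi.add_apply]
      linear_combination h.2 i j k + h'.2 i j k⟩
  zero_mem' := by simp
  smul_mem' c T h := ⟨fun i j k => by simp [h.1 i j k], fun i j k => by
      simp only [Pi.smul_apply, smul_eq_mul]
      linear_combination c * h.2 i j k⟩

/-- Arrays which are pure traces. -/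
def traces : Submodule ℂ (Arr m) := LinearMap.range pureTrace

/-- Arrays which are skew in the last two indices and free of traces. -/
def noTrace : Submodule ℂ (Arr m) := skew ⊓ LinearMap.ker tr

theorem pureTrace_mem_skew (t : Fin m → ℂ) : pureTrace t ∈ skew (m := m) := fun i j k => by
  simp only [pureTrace_apply]; ring

theorem traces_le : traces ≤ skew (m := m) := by
  rintro _ ⟨t, rfl⟩
  exact pureTrace_mem_skew t

theorem mem_traces_iff (hm : 2 < m) {T : Arr m} :
    T ∈ traces ↔ T = (1 / ((m : ℂ) - 1)) • pureTrace (tr T) := by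
  have h : (m : ℂ) - 1 ≠ 0 := by
    rw [sub_ne_zero]
    exact_mod_cast (show m ≠ 1 by omega)
  constructor
  · rintro ⟨t, rfl⟩
    rw [tr_pureTrace, map_smul, smul_smul, one_div_mul_cancel h, one_smul]
  · intro hT
    rw [hT, ← map_smul]
    exact ⟨_, rfl⟩

/-- On arrays already skew in the last two indices the cyclic mean is the total skew part, and
subtracting it leaves an array with vanishing cyclic sum. -/
theorem isCompl_hook : totSkew ⊓ hook = (⊥ : Submodule ℂ (Arr m)) ∧
    totSkew ⊔ hook = (skew : Submodule ℂ (Arr m)) := by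
  constructor
  · rw [eq_bot_iff]
    rintro T ⟨h, h'⟩
    rw [Submodule.mem_bot]
    ext ⟨i, j, k⟩
    have := h'.2 i j k
    have e1 : T (j, k, i) = T (i, j, k) := by rw [h.1 j i k, h.2 i j k, neg_neg]
    have e2 : T (k, i, j) = T (i, j, k) := by rw [h.2 i k j, h.1 i j k, neg_neg]
    rw [e1, e2] at this
    simp only [Pi.zero_apply]
    linear_combination (1 / 3) * this
  · apply le_antisymm
    · exact sup_le (fun T h => h.1) (fun T h => h.1)
    · intro T h
      rw [Submodule.mem_sup]
      refine ⟨fun p => (1 / 3) * (T p + T (p.2.1, p.2.2, p.1) + T (p.2.2, p.1, p.2.1)), ?_,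
        fun p => T p - (1 / 3) * (T p + T (p.2.1, p.2.2, p.1) + T (p.2.2, p.1, p.2.1)), ?_, ?_⟩
      · constructor
        · intro i j k
          dsimp only
          rw [h i j k, h k j i, h j k i]
          ring
        · intro i j k
          dsimp only
          rw [h j k i, h i j k, h k j i]
          ring
      · constructor
        · intro i j k
          dsimp only
          rw [h i j k, h k j i, h j k i]
          ring
        · intro i j k
          dsimp only
          ring
      · ext p
        simp

theorem isCompl_noTrace (hm : 2 < m) : traces ⊓ noTrace = (⊥ : Submodule ℂ (Arr m)) ∧
    traces ⊔ noTrace = (skew : Submodule ℂ (Arr m)) := by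
  have hne : (m : ℂ) - 1 ≠ 0 := by
    rw [sub_ne_zero]
    exact_mod_cast (show m ≠ 1 by omega)
  constructor
  · rw [eq_bot_iff]
    rintro T ⟨h, h'⟩
    rw [Submodule.mem_bot]
    have h0 : tr T = 0 := h'.2
    rw [(mem_traces_iff hm).mp h, h0]
    simp
  · apply le_antisymm
    · exact sup_le traces_le inf_le_left
    · intro T h
      rw [Submodule.mem_sup]
      refine ⟨pureTrace ((1 / ((m : ℂ) - 1)) • tr T), ⟨_, rfl⟩,
        T - pureTrace ((1 / ((m : ℂ) - 1)) • tr T), ⟨?_, ?_⟩, by simp⟩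
      · exact skew.sub_mem h (pureTrace_mem_skew _)
      · rw [SetLike.mem_coe, LinearMap.mem_ker, map_sub, tr_pureTrace, smul_smul, mul_one_div_cancel hne, one_smul,
          sub_self]

/-! #### Dimensions -/

/-- A symmetriser is a projection, so the dimension of its image is its trace. This lemma turns the
trace of each rearrangement of indices into a count of fixed triples. -/
theorem trace_funLeft (σ : Fin m × Fin m × Fin m → Fin m × Fin m × Fin m) :
    LinearMap.trace ℂ (Arr m) (LinearMap.funLeft ℂ ℂ σ) =
      ∑ i, ∑ j, ∑ k, if σ (i, j, k) = (i, j, k) then (1 : ℂ) else 0 := by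
  rw [LinearMap.trace_eq_matrix_trace ℂ (Pi.basisFun ℂ (Fin m × Fin m × Fin m)), Matrix.trace,
    Fintype.sum_prod_type]
  refine Finset.sum_congr rfl fun i _ => ?_
  rw [Fintype.sum_prod_type]
  refine Finset.sum_congr rfl fun j _ => Finset.sum_congr rfl fun k _ => ?_
  simp [LinearMap.funLeft_apply, Pi.single_apply]

theorem finrank_skew : (Module.finrank ℂ (skew (m := m)) : ℂ) = ((m : ℂ) ^ 3 - (m : ℂ) ^ 2) / 2 := by
  have hp : LinearMap.IsProj (skew (m := m)) ((1 / 2 : ℂ) • (LinearMap.funLeft ℂ ℂ id -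
      LinearMap.funLeft ℂ ℂ fun p => (p.1, p.2.2, p.2.1))) := by
    constructor
    · intro T i j k
      simp [LinearMap.funLeft_apply]
      ring
    · intro T h
      ext ⟨i, j, k⟩
      simp [LinearMap.funLeft_apply, h i j k]
      ring
  rw [← hp.trace, map_smul, map_sub, trace_funLeft, trace_funLeft]
  have e : ∀ x y : Fin m, (y = x ∧ x = y) ↔ y = x := fun x y => ⟨fun h => h.1, fun h => ⟨h, h.symm⟩⟩
  simp [e]
  ring

theorem finrank_totSkew : (Module.finrank ℂ (totSkew (m := m)) : ℂ) =
    (m : ℂ) * (m - 1) * (m - 2) / 6 := by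
  have hp : LinearMap.IsProj (totSkew (m := m)) ((1 / 6 : ℂ) • (LinearMap.funLeft ℂ ℂ id
      - (LinearMap.funLeft ℂ ℂ fun p => (p.1, p.2.2, p.2.1))
      - (LinearMap.funLeft ℂ ℂ fun p => (p.2.1, p.1, p.2.2))
      - (LinearMap.funLeft ℂ ℂ fun p => (p.2.2, p.2.1, p.1))
      + (LinearMap.funLeft ℂ ℂ fun p => (p.2.1, p.2.2, p.1))
      + (LinearMap.funLeft ℂ ℂ fun p => (p.2.2, p.1, p.2.1)))) := by
    constructor
    · intro T
      constructor
      · intro i j k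
        simp [LinearMap.funLeft_apply]
        ring
      · intro i j k
        simp [LinearMap.funLeft_apply]
        ring
    · intro T h
      ext ⟨i, j, k⟩
      simp [LinearMap.funLeft_apply]
      have e1 := h.1 i j k
      have e2 := h.2 i j k
      have e3 := h.1 j i k
      have e4 := h.2 i k j
      have e5 := h.1 k i j
      linear_combination (-1 / 6) * e1 - 1 / 6 * e2 - 1 / 6 * (e5 - e4 + e1) + 1 / 6 * (e3 - e2)
        + 1 / 6 * (e4 - e1)
  rw [← hp.trace, map_smul]
  simp only [map_sub, map_add, trace_funLeft]
  have e : ∀ x y : Fin m, (y = x ∧ x = y) ↔ y = x := fun x y => ⟨fun h => h.1, fun h => ⟨h, h.symm⟩⟩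
  have e2 : ∀ x y z : Fin m, (y = x ∧ z = y ∧ x = z) ↔ (y = x ∧ z = y) :=
    fun x y z => ⟨fun h => ⟨h.1, h.2.1⟩, fun h => ⟨h.1, h.2, by rw [h.2, h.1]⟩⟩
  have e3 : ∀ x y z : Fin m, (z = x ∧ x = y ∧ y = z) ↔ (x = y ∧ z = x) :=
    fun x y z => ⟨fun h => ⟨h.2.1, h.1⟩, fun h => ⟨h.2, h.1, by rw [h.2, h.1]⟩⟩
  simp [e, e2, e3, ite_and]
  ring

theorem pureTrace_injective (hm : 2 < m) : Function.Injective (pureTrace (m := m)) := by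
  have hne : (m : ℂ) - 1 ≠ 0 := by
    rw [sub_ne_zero]
    exact_mod_cast (show m ≠ 1 by omega)
  intro t t' h
  have := congrArg tr h
  rw [tr_pureTrace, tr_pureTrace] at this
  exact smul_right_injective _ hne this

theorem finrank_traces (hm : 2 < m) : Module.finrank ℂ (traces (m := m)) = m := by
  rw [traces, LinearMap.finrank_range_of_inj (pureTrace_injective hm)]
  simp

theorem finrank_hook : (Module.finrank ℂ (hook (m := m)) : ℂ) = (m : ℂ) * (m ^ 2 - 1) / 3 := by
  have h := Submodule.finrank_sup_add_finrank_inf_eq (totSkew (m := m)) hook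
  rw [isCompl_hook.1, isCompl_hook.2, finrank_bot, add_zero] at h
  have h2 := congrArg (Nat.cast : ℕ → ℂ) h
  push_cast at h2
  rw [finrank_skew, finrank_totSkew] at h2
  linear_combination -h2

theorem finrank_noTrace (hm : 2 < m) : (Module.finrank ℂ (noTrace (m := m)) : ℂ) =
    (m : ℂ) * (m + 1) * (m - 2) / 2 := by
  have h := Submodule.finrank_sup_add_finrank_inf_eq (traces (m := m)) noTrace
  rw [(isCompl_noTrace hm).1, (isCompl_noTrace hm).2, finrank_bot, add_zero, finrank_traces hm] at h
  have h2 := congrArg (Nat.cast : ℕ → ℂ) h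
  push_cast at h2
  rw [finrank_skew] at h2
  linear_combination -h2

end Arr

end Arrays

/-- `Y` is nonzero and contains no proper nonzero subspace stable under all `ρ i`. -/
def IsSimpleUnder {ι E : Type*} [AddCommGroup E] [Module ℂ E] (ρ : ι → Module.End ℂ E)
    (Y : Submodule ℂ E) : Prop :=
  Y ≠ ⊥ ∧ ∀ U ≤ Y, (∀ i, ∀ x ∈ U, ρ i x ∈ U) → U ≠ ⊥ → U = Y

namespace Arr

variable {m : ℕ}

/-! #### Irreducibility -/

theorem slot1_mul (A B : Matrix (Fin m) (Fin m) ℂ) : slot1 A * slot1 B = slot1 (A * B) := by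
  refine LinearMap.ext fun T => funext fun ⟨i, j, k⟩ => ?_
  simp only [Module.End.mul_apply, slot1_apply, Matrix.mul_apply, Finset.mul_sum, Finset.sum_mul]
  rw [Finset.sum_comm]
  simp only [mul_assoc]

theorem slot2_mul (A B : Matrix (Fin m) (Fin m) ℂ) : slot2 A * slot2 B = slot2 (A * B) := by
  refine LinearMap.ext fun T => funext fun ⟨i, j, k⟩ => ?_
  simp only [Module.End.mul_apply, slot2_apply, Matrix.mul_apply, Finset.mul_sum, Finset.sum_mul]
  rw [Finset.sum_comm]
  simp only [mul_assoc]

theorem slot3_mul (A B : Matrix (Fin m) (Fin m) ℂ) : slot3 A * slot3 B = slot3 (A * B) := by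
  refine LinearMap.ext fun T => funext fun ⟨i, j, k⟩ => ?_
  simp only [Module.End.mul_apply, slot3_apply, Matrix.mul_apply, Finset.mul_sum, Finset.sum_mul]
  rw [Finset.sum_comm]
  simp only [mul_assoc]

theorem slot2_slot1 (A B : Matrix (Fin m) (Fin m) ℂ) : slot2 A * slot1 B = slot1 B * slot2 A := by
  refine LinearMap.ext fun T => funext fun ⟨i, j, k⟩ => ?_
  simp only [Module.End.mul_apply, slot1_apply, slot2_apply, Finset.mul_sum]
  rw [Finset.sum_comm]
  simp only [mul_left_comm]

theorem slot3_slot1 (A B : Matrix (Fin m) (Fin m) ℂ) : slot3 A * slot1 B = slot1 B * slot3 A := by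
  refine LinearMap.ext fun T => funext fun ⟨i, j, k⟩ => ?_
  simp only [Module.End.mul_apply, slot1_apply, slot3_apply, Finset.mul_sum]
  rw [Finset.sum_comm]
  simp only [mul_left_comm]

theorem slot3_slot2 (A B : Matrix (Fin m) (Fin m) ℂ) : slot3 A * slot2 B = slot2 B * slot3 A := by
  refine LinearMap.ext fun T => funext fun ⟨i, j, k⟩ => ?_
  simp only [Module.End.mul_apply, slot2_apply, slot3_apply, Finset.mul_sum]
  rw [Finset.sum_comm]
  simp only [mul_left_comm]

/-- Inclusion and exclusion over slots. The product of three actions puts A, B, C into arbitrary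
slots, and the correction terms remove every placement in which two of them share a slot. Hence the
sum over the six placements in distinct slots preserves every stable subspace. -/
theorem act3_polarized (A B C : Matrix (Fin m) (Fin m) ℂ) :
    act3 A * (act3 B * act3 C - act3 (B * C)) - (act3 (A * B) * act3 C - act3 (A * B * C))
      - (act3 B * act3 (A * C) - act3 (B * (A * C))) =
    slot1 A * (slot2 B * slot3 C) + slot1 B * (slot2 A * slot3 C) + slot1 A * (slot2 C * slot3 B)
      + slot1 B * (slot2 C * slot3 A) + slot1 C * (slot2 A * slot3 B)
      + slot1 C * (slot2 B * slot3 A) := by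
  have a11 (A B : Matrix (Fin m) (Fin m) ℂ) (X : Module.End ℂ (Arr m)) :
      slot1 A * (slot1 B * X) = slot1 (A * B) * X := by rw [← mul_assoc, slot1_mul]
  have a22 (A B : Matrix (Fin m) (Fin m) ℂ) (X : Module.End ℂ (Arr m)) :
      slot2 A * (slot2 B * X) = slot2 (A * B) * X := by rw [← mul_assoc, slot2_mul]
  have a21 (A B : Matrix (Fin m) (Fin m) ℂ) (X : Module.End ℂ (Arr m)) :
      slot2 A * (slot1 B * X) = slot1 B * (slot2 A * X) := by
    rw [← mul_assoc, slot2_slot1, mul_assoc]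
  have a31 (A B : Matrix (Fin m) (Fin m) ℂ) (X : Module.End ℂ (Arr m)) :
      slot3 A * (slot1 B * X) = slot1 B * (slot3 A * X) := by
    rw [← mul_assoc, slot3_slot1, mul_assoc]
  have a32 (A B : Matrix (Fin m) (Fin m) ℂ) (X : Module.End ℂ (Arr m)) :
      slot3 A * (slot2 B * X) = slot2 B * (slot3 A * X) := by
    rw [← mul_assoc, slot3_slot2, mul_assoc]
  simp only [act3, mul_add, add_mul, mul_sub, slot1_mul, slot2_mul, slot3_mul, slot2_slot1,
    slot3_slot1, slot3_slot2, a11, a22, a21, a31, a32, mul_assoc]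
  abel

theorem slot_single (T : Arr m) (a b c i j k : Fin m) :
    slot1 (Matrix.single a i 1) (slot2 (Matrix.single b j 1) (slot3 (Matrix.single c k 1) T)) =
      T (i, j, k) • unit a b c := by
  ext ⟨p, q, r⟩
  simp only [slot1_apply, slot2_apply, slot3_apply, Matrix.single_apply, Pi.smul_apply,
    smul_eq_mul, unit_apply, ite_and, ite_mul, one_mul, zero_mul, mul_ite, mul_one, mul_zero, eq_comm (a := a), eq_comm (a := b),
    eq_comm (a := c)]
  by_cases h1 : p = a <;> by_cases h2 : q = b <;> by_cases h3 : r = c <;> simp [h1, h2, h3]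

/-- Filling the three slots with matrix units extracts single entries of T and moves them to the
positions a, b, c. One entry of T and its permutations thus produce an explicit element of U for
every a, b, c. -/
theorem polarized_mem {U : Submodule ℂ (Arr m)} (hU : ∀ A, ∀ T ∈ U, act3 A T ∈ U) {T : Arr m}
    (hT : T ∈ U) (a b c i j k : Fin m) :
    T (i, j, k) • unit a b c + T (j, i, k) • unit b a c + T (i, k, j) • unit a c b
      + T (j, k, i) • unit b c a + T (k, i, j) • unit c a b + T (k, j, i) • unit c b a ∈ U := by
  have h := congrArg (fun X : Module.End ℂ (Arr m) => X T) (act3_polarized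
    (Matrix.single a i 1) (Matrix.single b j 1) (Matrix.single c k 1))
  simp only [LinearMap.add_apply, Module.End.mul_apply, slot_single] at h
  rw [← h]
  simp only [LinearMap.sub_apply, Module.End.mul_apply]
  exact U.sub_mem (U.sub_mem (hU _ _ (U.sub_mem (hU _ _ (hU _ _ hT)) (hU _ _ hT)))
    (U.sub_mem (hU _ _ (hU _ _ hT)) (hU _ _ hT))) (U.sub_mem (hU _ _ (hU _ _ hT)) (hU _ _ hT))

theorem sum_units (T : Arr m) (i j k : Fin m) :
    (∑ a, ∑ b, ∑ c, T (a, b, c) * (if i = a ∧ j = b ∧ k = c then 1 else 0)) = T (i, j, k) := by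
  simp [ite_and]

/-- The skew product of three basis vectors. -/
def skewUnit (a b c : Fin m) : Arr m :=
  unit a b c - unit b a c - unit a c b + unit b c a + unit c a b - unit c b a

theorem skewUnit_mem (a b c : Fin m) : skewUnit a b c ∈ totSkew (m := m) := by
  constructor <;> intro i j k
  all_goals
    simp only [skewUnit, Pi.add_apply, Pi.sub_apply, unit_apply]
    simp only [and_comm, and_left_comm]
    ring

theorem skewUnit_ne_zero {a b c : Fin m} (h1 : a ≠ b) (h2 : a ≠ c) (h3 : b ≠ c) :
    skewUnit a b c ≠ 0 := by
  intro h
  have := congrFun h (a, b, c)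
  simp [skewUnit, unit_apply, h1, h2, h3, h1.symm, h2.symm, h3.symm] at this

theorem exists_ne_zero_of_ne_bot {U : Submodule ℂ (Arr m)} (h : U ≠ ⊥) :
    ∃ T ∈ U, ∃ i j k, T (i, j, k) ≠ 0 := by
  obtain ⟨T, hT, h0⟩ := Submodule.exists_mem_ne_zero_of_ne_bot h
  refine ⟨T, hT, ?_⟩
  by_contra! h1
  exact h0 (by ext ⟨i, j, k⟩; exact h1 i j k)

theorem sum3_mem (U : Submodule ℂ (Arr m)) (T : Arr m) (v : Fin m → Fin m → Fin m → Arr m)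
    (h : ∀ a b c, v a b c ∈ U) : ∑ a, ∑ b, ∑ c, T (a, b, c) • v a b c ∈ U :=
  U.sum_mem fun a _ => U.sum_mem fun b _ => U.sum_mem fun c _ => U.smul_mem _ (h a b c)

theorem sum_units_perm (T : Arr m) (i j k : Fin m) :
    (∑ a, ∑ b, ∑ c, T (a, b, c) * (if i = b ∧ j = a ∧ k = c then 1 else 0)) = T (j, i, k) ∧
    (∑ a, ∑ b, ∑ c, T (a, b, c) * (if i = a ∧ j = c ∧ k = b then 1 else 0)) = T (i, k, j) ∧
    (∑ a, ∑ b, ∑ c, T (a, b, c) * (if i = b ∧ j = c ∧ k = a then 1 else 0)) = T (k, i, j) ∧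
    (∑ a, ∑ b, ∑ c, T (a, b, c) * (if i = c ∧ j = a ∧ k = b then 1 else 0)) = T (j, k, i) ∧
    (∑ a, ∑ b, ∑ c, T (a, b, c) * (if i = c ∧ j = b ∧ k = a then 1 else 0)) = T (k, j, i) := by
  refine ⟨?_, ?_, ?_, ?_, ?_⟩ <;> simp [ite_and]

theorem isSimple_totSkew (hm : 2 < m) : IsSimpleUnder act3 (totSkew (m := m)) := by
  constructor
  · intro h
    have := skewUnit_mem (⟨0, by omega⟩ : Fin m) ⟨1, by omega⟩ ⟨2, by omega⟩
    rw [h, Submodule.mem_bot] at this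
    exact skewUnit_ne_zero (by simp) (by simp) (by simp) this
  · intro U hU hs hne
    obtain ⟨T, hT, i, j, k, h0⟩ := exists_ne_zero_of_ne_bot hne
    have hTs := hU hT
    have mem : ∀ a b c, skewUnit a b c ∈ U := by
      intro a b c
      have h := polarized_mem hs hT a b c i j k
      have e1 := hTs.1 i j k
      have e2 := hTs.2 i j k
      have e3 := hTs.1 j i k
      have e4 := hTs.2 i k j
      have e5 := hTs.1 k i j
      rw [e5, e4, e3, e2, e1] at h
      have e : skewUnit a b c = (T (i, j, k))⁻¹ • (T (i, j, k) • unit a b c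
          + -T (i, j, k) • unit b a c + -T (i, j, k) • unit a c b + - -T (i, j, k) • unit b c a
          + - -T (i, j, k) • unit c a b + - - -T (i, j, k) • unit c b a) := by
        rw [skewUnit]
        simp only [neg_smul, smul_add, smul_neg, inv_smul_smul₀ h0]
        abel
      rw [e]
      exact U.smul_mem _ h
    refine le_antisymm hU fun X hX => ?_
    have e : X = (1 / 6 : ℂ) • ∑ a, ∑ b, ∑ c, X (a, b, c) • skewUnit a b c := by
      ext ⟨i, j, k⟩
      simp only [skewUnit, Finset.sum_apply, Pi.smul_apply, smul_eq_mul, Pi.add_apply, Pi.sub_apply,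
        unit_apply, mul_add, mul_sub, Finset.sum_add_distrib, Finset.sum_sub_distrib, sum_units,
        sum_units_perm]
      have e1 := hX.1 i j k
      have e2 := hX.2 i j k
      have e3 := hX.1 j i k
      have e4 := hX.2 i k j
      have e5 := hX.1 k i j
      linear_combination (1 / 6) * e1 + 1 / 6 * e2 + 1 / 6 * (e5 - e4 + e1) - 1 / 6 * (e3 - e2)
        - 1 / 6 * (e4 - e1)
    rw [e]
    exact U.smul_mem _ (sum3_mem U X _ mem)

/-- The array `e_a ⊙ (e_b ∧ e_c)`. -/
def hookUnit (a b c : Fin m) : Arr m :=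
  unit a b c + unit b a c - unit a c b - unit b c a

theorem hookUnit_mem (a b c : Fin m) : hookUnit a b c ∈ hook (m := m) := by
  constructor <;> intro i j k
  all_goals
    simp only [hookUnit, Pi.add_apply, Pi.sub_apply, unit_apply]
    simp only [and_comm, and_left_comm, and_assoc]
    ring

theorem isSimple_hook (hm : 2 < m) : IsSimpleUnder act3 (hook (m := m)) := by
  constructor
  · intro h
    have := hookUnit_mem (⟨0, by omega⟩ : Fin m) ⟨1, by omega⟩ ⟨2, by omega⟩
    rw [h, Submodule.mem_bot] at this
    have := congrFun this (⟨0, by omega⟩, ⟨1, by omega⟩, ⟨2, by omega⟩)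
    simp [hookUnit, unit_apply] at this
  · intro U hU hs hne
    obtain ⟨T, hT, hT0⟩ := exists_ne_zero_of_ne_bot hne
    have hTs := hU hT
    -- If all these symmetrised entries vanished, T would be totally skew, and the vanishing cyclic
    -- sum would force T = 0.
    obtain ⟨i, j, k, h0⟩ : ∃ i j k, T (i, j, k) + T (j, i, k) ≠ 0 := by
      by_contra! h
      obtain ⟨i, j, k, h0⟩ := hT0
      have e1 := hTs.1 i k j
      have e2 := hTs.1 j i k
      have e3 := hTs.2 i j k
      apply h0
      linear_combination (1 / 3) * e3 - (1 / 3) * e2 + (1 / 3) * h i j k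
        + (1 / 3) * e1 - (1 / 3) * h i k j
    have mem : ∀ a b c, hookUnit a b c ∈ U := by
      intro a b c
      -- Symmetrising in i and j cancels the terms with c in front, and the rest combines to a
      -- multiple of `hookUnit a b c`.
      have h := U.add_mem (polarized_mem hs hT a b c i j k) (polarized_mem hs hT a b c j i k)
      rw [hTs.1 i j k, hTs.1 j i k, hTs.1 k i j] at h
      have e : hookUnit a b c = (T (i, j, k) + T (j, i, k))⁻¹ •
          ((T (i, j, k) + T (j, i, k)) • hookUnit a b c) := by
        rw [inv_smul_smul₀ h0]
      rw [e]
      apply U.smul_mem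
      convert h using 1
      rw [hookUnit]
      module
    refine le_antisymm hU fun X hX => ?_
    have e : X = (1 / 3 : ℂ) • ∑ a, ∑ b, ∑ c, X (a, b, c) • hookUnit a b c := by
      ext ⟨i, j, k⟩
      simp only [hookUnit, Finset.sum_apply, Pi.smul_apply, smul_eq_mul, Pi.add_apply, Pi.sub_apply,
        unit_apply, mul_add, mul_sub, Finset.sum_add_distrib, Finset.sum_sub_distrib, sum_units,
        sum_units_perm]
      have e1 := hX.1 i j k
      have e2 := hX.2 i j k
      have e3 := hX.1 j i k
      linear_combination (1 / 3) * e1 + (1 / 3) * e2 - (1 / 3) * e3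
    rw [e]
    exact U.smul_mem _ (sum3_mem U X _ mem)

theorem act1_pureTrace (A : Matrix (Fin m) (Fin m) ℂ) (t : Fin m → ℂ) :
    act1 A (pureTrace t) = pureTrace (A.mulVec t) := by
  ext ⟨i, j, k⟩
  simp only [act1_apply, pureTrace_apply, mul_sub, Finset.sum_sub_distrib, mul_ite, mul_zero,
    Finset.sum_ite_eq', Finset.sum_ite_eq, Finset.mem_univ, if_true, Matrix.mulVec, dotProduct]
  split_ifs <;> simp_all
  ring

theorem isSimple_traces (hm : 2 < m) : IsSimpleUnder act1 (traces (m := m)) := by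
  constructor
  · intro h
    have h1 := finrank_traces hm
    rw [h, finrank_bot] at h1
    omega
  · intro U hU hs hne
    obtain ⟨T, hT, hT0⟩ := Submodule.exists_mem_ne_zero_of_ne_bot hne
    obtain ⟨t, rfl⟩ := hU hT
    obtain ⟨k, hk⟩ : ∃ k, t k ≠ 0 := by
      by_contra! h
      exact hT0 (by rw [show t = 0 from funext h, map_zero])
    refine le_antisymm hU ?_
    rintro _ ⟨s, rfl⟩
    -- A matrix of rank one carrying the nonzero vector t to the arbitrary vector s.
    have h := hs (Matrix.of fun a b => if b = k then (t k)⁻¹ * s a else 0) _ hT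
    rw [act1_pureTrace] at h
    convert h using 2
    ext a
    simp only [Matrix.mulVec, dotProduct, Matrix.of_apply, ite_mul, zero_mul, Finset.sum_ite_eq',
      Finset.mem_univ, if_true]
    field_simp

end Arr

/-! ### Irreducibility of the trace-free arrays. -/

namespace Arr

variable {m : ℕ}

theorem act1_single (a b : Fin m) (T : Arr m) (i j k : Fin m) :
    act1 (Matrix.single a b 1) T (i, j, k) = -(if i = b then T (a, j, k) else 0)
      + (if j = a then T (i, b, k) else 0) + (if k = a then T (i, j, b) else 0) := by
  simp only [act1_apply, Matrix.single_apply, ite_and, ite_mul, one_mul, zero_mul,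
    eq_comm (a := a), eq_comm (a := b)]
  congr 1
  · congr 1
    · congr 1
      split_ifs <;> simp
    · split_ifs <;> simp
  · split_ifs <;> simp

/-- The array `e^a ⊗ (e_b ∧ e_c)`. -/
def mixed (a b c : Fin m) : Arr m := unit a b c - unit a c b

theorem mixed_apply (a b c i j k : Fin m) : mixed a b c (i, j, k) =
    (if i = a ∧ j = b ∧ k = c then 1 else 0) - (if i = a ∧ j = c ∧ k = b then 1 else 0) := by
  simp [mixed, unit_apply]

theorem mixed_swap (a b c : Fin m) : mixed a c b = -mixed a b c := by
  simp [mixed]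

theorem mixed_self (a b : Fin m) : mixed a b b = 0 := by
  simp [mixed]

theorem mixed_mem_skew (a b c : Fin m) : mixed a b c ∈ skew (m := m) := by
  intro i j k
  simp only [mixed_apply, and_comm]
  ring

theorem mixed_mem {a b c : Fin m} (h1 : a ≠ b) (h2 : a ≠ c) : mixed a b c ∈ noTrace (m := m) := by
  refine ⟨mixed_mem_skew a b c, ?_⟩
  rw [SetLike.mem_coe, LinearMap.mem_ker]
  ext k
  simp only [tr_apply, mixed_apply, Pi.zero_apply, Finset.sum_sub_distrib]
  have e1 : ∀ i : Fin m, ¬ (i = a ∧ i = b ∧ k = c) := fun i h => h1 (h.1 ▸ h.2.1)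
  have e2 : ∀ i : Fin m, ¬ (i = a ∧ i = c ∧ k = b) := fun i h => h2 (h.1 ▸ h.2.1)
  simp [e1, e2]

theorem mixed_ne_zero {b c : Fin m} (a : Fin m) (h : b ≠ c) : mixed a b c ≠ 0 := by
  intro h0
  have := congrFun h0 (a, b, c)
  simp [mixed_apply, h, h.symm] at this

theorem act1_unit (p q a b c : Fin m) : act1 (Matrix.single p q 1) (unit a b c) =
    -(if p = a then unit q b c else 0) + (if q = b then unit a p c else 0)
      + (if q = c then unit a b p else 0) := by
  ext ⟨i, j, k⟩
  rw [act1_single]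
  have e (P : Prop) [Decidable P] (X : Arr m) (x : Fin m × Fin m × Fin m) :
      (if P then X else 0) x = if P then X x else 0 := by split_ifs <;> rfl
  simp only [Pi.add_apply, Pi.neg_apply, e, unit_apply, ite_and]
  congr 1
  · congr 1
    · congr 1
      split_ifs <;> rfl
    · split_ifs <;> rfl
  · split_ifs <;> rfl

theorem act1_mixed (p q a b c : Fin m) : act1 (Matrix.single p q 1) (mixed a b c) =
    -(if p = a then mixed q b c else 0) + (if q = b then mixed a p c else 0)
      + (if q = c then mixed a b p else 0) := by
  rw [mixed, map_sub, act1_unit, act1_unit]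
  simp only [mixed]
  split_ifs <;> abel

/-- A property of triples of distinct indices, invariant under permutations and under changing the
last index, holds for all such triples if it holds for one. -/
theorem forall_distinct {α : Type*} (P : α → α → α → Prop)
    (h23 : ∀ a b c, P a b c → P a c b)
    (h13 : ∀ a b c, a ≠ b → a ≠ c → b ≠ c → P a b c → P c b a)
    (hl : ∀ a b c d, a ≠ b → a ≠ c → b ≠ c → d ≠ a → d ≠ b → P a b c → P a b d)
    {i j k : α} (hij : i ≠ j) (hik : i ≠ k) (hjk : j ≠ k) (h0 : P i j k)
    {a b c : α} (hab : a ≠ b) (hac : a ≠ c) (hbc : b ≠ c) : P a b c := by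
  have h12 : ∀ a b c, a ≠ b → a ≠ c → b ≠ c → P a b c → P b a c := fun a b c h1 h2 h3 h =>
    h23 _ _ _ (h13 _ _ _ h2 h1 h3.symm (h23 _ _ _ h))
  obtain ⟨j', k', h1, h2, h3, h⟩ : ∃ j' k', a ≠ j' ∧ a ≠ k' ∧ j' ≠ k' ∧ P a j' k' := by
    by_cases e1 : a = i
    · exact ⟨j, k, e1 ▸ hij, e1 ▸ hik, hjk, e1 ▸ h0⟩
    by_cases e2 : a = j
    · exact ⟨i, k, e2 ▸ hij.symm, e2 ▸ hjk, hik, e2 ▸ h12 _ _ _ hij hik hjk h0⟩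
    have h := h13 _ _ _ hij (Ne.symm e1) (Ne.symm e2) (hl i j k a hij hik hjk e1 e2 h0)
    exact ⟨j, i, e2, e1, hij.symm, h⟩
  obtain ⟨k'', h4, h5, h⟩ : ∃ k'', a ≠ k'' ∧ b ≠ k'' ∧ P a b k'' := by
    by_cases e1 : b = j'
    · exact ⟨k', h2, e1 ▸ h3, e1 ▸ h⟩
    · exact ⟨j', h1, e1, h23 _ _ _ (hl a j' k' b h1 h2 h3 hab.symm e1 h)⟩
  exact hl a b k'' c hab h4 h5 hac.symm hbc.symm h

theorem mixed_mem_of_stable {U : Submodule ℂ (Arr m)} (hU : ∀ A, ∀ T ∈ U, act1 A T ∈ U)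
    {i j k : Fin m} (hij : i ≠ j) (hik : i ≠ k) (hjk : j ≠ k) (h0 : mixed i j k ∈ U) :
    ∀ {a b c : Fin m}, a ≠ b → a ≠ c → b ≠ c → mixed a b c ∈ U := by
  refine fun {a b c} => forall_distinct (fun a b c => mixed a b c ∈ U) ?_ ?_ ?_ hij hik hjk h0
  · intro a b c h
    rw [mixed_swap]
    exact U.neg_mem h
  · intro a b c h1 h2 h3 h
    -- Applied twice, this matrix unit must act once on the lower index a and once on the upper
    -- index c. The two orders give the same term, hence the factor -2.
    have h' := hU (Matrix.single a c 1) _ (hU (Matrix.single a c 1) _ h)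
    simp only [act1_mixed, map_add, map_neg, if_true, h2, h2.symm, h3.symm,
      if_false, add_zero, neg_zero, zero_add] at h'
    have e : mixed c b a = (-1 / 2 : ℂ) • (-mixed c b a + -mixed c b a) := by module
    rw [e]
    exact U.smul_mem _ h'
  · intro a b c d h1 h2 h3 h4 h5 h
    have h' := hU (Matrix.single d c 1) _ h
    simpa only [act1_mixed, h4, h3.symm, if_true, if_false, neg_zero, zero_add] using h'

/-- If all entries at distinct indices vanished throughout U, moving them by matrix units would make
T(i, i, k) independent of i ≠ k. Trace-freeness then gives (m - 1) T(i, i, k) = 0, so every array in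
U would be zero. -/
theorem exists_distinct_ne_zero (hm : 2 < m) {U : Submodule ℂ (Arr m)} (hle : U ≤ noTrace)
    (hU : ∀ A, ∀ T ∈ U, act1 A T ∈ U) (hne : U ≠ ⊥) :
    ∃ T ∈ U, ∃ i j k, i ≠ j ∧ i ≠ k ∧ j ≠ k ∧ T (i, j, k) ≠ 0 := by
  obtain ⟨T, hT, i, j, k, h0⟩ := exists_ne_zero_of_ne_bot hne
  have hs : ∀ i j k, T (i, k, j) = -T (i, j, k) := (hle hT).1
  have ht : tr T = 0 := (hle hT).2
  have hd : ∀ i j, T (i, j, j) = 0 := fun i j => by linear_combination (1 / 2) * hs i j j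
  by_contra! h
  have key : ∀ i l k, i ≠ l → i ≠ k → l ≠ k → T (i, i, k) = T (l, l, k) := by
    intro i l k h1 h2 h3
    have h' := h _ (hU (Matrix.single l i 1) _ hT) i l k h1 h2 h3
    simp only [act1_single, if_true, h3.symm, if_false, add_zero] at h'
    linear_combination h'
  have zero : ∀ i k, i ≠ k → T (i, i, k) = 0 := by
    intro i k hik
    have h1 := congrFun ht k
    simp only [tr_apply, Pi.zero_apply] at h1
    rw [← Finset.sum_erase (f := fun i => T (i, i, k)) _ (hd k k), Finset.sum_congr rfl (g := fun _ => T (i, i, k)),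
      Finset.sum_const, Finset.card_erase_of_mem (Finset.mem_univ _), Finset.card_univ,
      Fintype.card_fin, nsmul_eq_mul] at h1
    · refine (mul_eq_zero.mp h1).resolve_left ?_
      exact_mod_cast (show m - 1 ≠ 0 by omega)
    · intro l hl
      have hl' := Finset.ne_of_mem_erase hl
      by_cases e : i = l
      · rw [e]
      · exact (key i l k e hik hl').symm
  apply h0
  by_cases e1 : i = j
  · subst e1
    by_cases e2 : i = k
    · subst e2
      exact hd _ _
    · exact zero _ _ e2
  · by_cases e2 : i = k
    · subst e2
      rw [hs, zero _ _ e1, neg_zero]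
    · by_cases e3 : j = k
      · subst e3
        exact hd _ _
      · exact h T hT i j k e1 e2 e3

theorem isSimple_noTrace (hm : 2 < m) : IsSimpleUnder act1 (noTrace (m := m)) := by
  have f01 : (⟨0, by omega⟩ : Fin m) ≠ ⟨1, by omega⟩ := by simp
  have f02 : (⟨0, by omega⟩ : Fin m) ≠ ⟨2, by omega⟩ := by simp
  have f12 : (⟨1, by omega⟩ : Fin m) ≠ ⟨2, by omega⟩ := by simp
  constructor
  · intro h
    have := mixed_mem f01 f02
    rw [h, Submodule.mem_bot] at this
    exact mixed_ne_zero _ f12 this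
  · intro U hU hs hne
    obtain ⟨T, hT, i, j, k, hij, hik, hjk, h0⟩ := exists_distinct_ne_zero hm hU hs hne
    have hsk : ∀ i j k, T (i, k, j) = -T (i, j, k) := (hU hT).1
    have hd : ∀ i j, T (i, j, j) = 0 := fun i j => by linear_combination (1 / 2) * hsk i j j
    have start : mixed j i k ∈ U := by
      -- The unit at (i, j) squares to zero on each index. Its second power therefore acts on two
      -- different indices, and the pair of upper ones contributes T(p, j, j) = 0. The unit at (k,
      -- k) then keeps only the terms whose remaining upper index is k.
      have h := hs (Matrix.single k k 1) _
        (hs (Matrix.single i j 1) _ (hs (Matrix.single i j 1) _ hT))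
      have e : act1 (Matrix.single k k 1) (act1 (Matrix.single i j 1)
          (act1 (Matrix.single i j 1) T)) = (-2 * T (i, j, k)) • mixed j i k := by
        ext ⟨p, q, r⟩
        simp only [act1_single, Pi.smul_apply, smul_eq_mul, mixed_apply, hij, hij.symm,
          hik.symm, hjk.symm, if_false]
        have s1 := hsk i j k
        have s2 := hd i j
        have s3 := hd k j
        clear hsk hd h hs hU hne hT h0
        by_cases p1 : p = j <;> by_cases q1 : q = i <;> by_cases r1 : r = i <;>
          by_cases q2 : q = k <;> by_cases r2 : r = k <;> by_cases p2 : p = k <;>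
          simp_all <;> ring
      rw [e] at h
      have h' := U.smul_mem (-2 * T (i, j, k))⁻¹ h
      rwa [inv_smul_smul₀ (mul_ne_zero (by norm_num) h0)] at h'
    have dist : ∀ {a b c : Fin m}, a ≠ b → a ≠ c → b ≠ c → mixed a b c ∈ U :=
      mixed_mem_of_stable hs hij.symm hjk hik start
    -- Arrays with distinct indices do not exhaust the trace-free ones. The others arise as
    -- differences of terms having the same trace.
    have diff : ∀ a d c : Fin m, a ≠ c → d ≠ c → mixed a a c - mixed d d c ∈ U := by
      intro a d c hac hdc
      by_cases had : a = d
      · rw [had, sub_self]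
        exact U.zero_mem
      · have h := hs (Matrix.single a d 1) _ (dist had hac hdc)
        simp only [act1_mixed, if_true, hdc, if_false, add_zero] at h
        rwa [neg_add_eq_sub] at h
    have hex : ∀ c : Fin m, ∃ d, d ≠ c := fun c => by
      by_cases hc : c = ⟨0, by omega⟩
      · exact ⟨⟨1, by omega⟩, by rw [hc]; exact f01.symm⟩
      · exact ⟨_, Ne.symm hc⟩
    choose d hdc using hex
    -- Each array `mixed a b c` is corrected by a reference term with the same trace, chosen through
    -- d. When these are summed against a trace-free X, the reference terms drop out, which is the
    -- content of `z1` and `z2`.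
    have mem : ∀ a b c, mixed a b c - (if a = b then mixed (d c) (d c) c else 0)
        + (if a = c then mixed (d b) (d b) b else 0) ∈ U := by
      intro a b c
      by_cases h1 : a = b
      · subst h1
        by_cases h2 : a = c
        · subst h2
          simp [mixed_self]
        · simpa [h2] using diff a (d c) c h2 (hdc c)
      · by_cases h2 : a = c
        · subst h2
          have := U.neg_mem (diff a (d b) b h1 (hdc b))
          rw [mixed_swap]
          simpa [h1, sub_eq_add_neg, add_comm] using this
        · by_cases h3 : b = c
          · simp [h2, h3, mixed_self, U.zero_mem]
          · simpa [h1, h2] using dist h1 h2 h3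
    refine le_antisymm hU fun X hX => ?_
    have hXs : ∀ i j k, X (i, k, j) = -X (i, j, k) := hX.1
    have hXt : ∀ k, ∑ i, X (i, i, k) = 0 := fun k => congrFun (show tr X = 0 from hX.2) k
    have hXt' : ∀ k, ∑ i, X (i, k, i) = 0 := fun k => by
      simp only [hXs _ _ k, Finset.sum_neg_distrib, hXt, neg_zero]
    have e : X = (1 / 2 : ℂ) • ∑ a, ∑ b, ∑ c, X (a, b, c) • (mixed a b c
        - (if a = b then mixed (d c) (d c) c else 0)
        + (if a = c then mixed (d b) (d b) b else 0)) := by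
      have z1 : ∑ a, ∑ b, ∑ c, X (a, b, c) • (if a = b then mixed (d c) (d c) c else 0) = 0 := by
        simp only [smul_ite, smul_zero]
        have : ∀ a : Fin m, ∑ b, ∑ c, (if a = b then X (a, b, c) • mixed (d c) (d c) c else 0) =
            ∑ c, X (a, a, c) • mixed (d c) (d c) c := fun a => by
          rw [Finset.sum_comm]
          simp
        simp only [this]
        rw [Finset.sum_comm]
        simp only [← Finset.sum_smul, hXt, zero_smul, Finset.sum_const_zero]
      have z2 : ∑ a, ∑ b, ∑ c, X (a, b, c) • (if a = c then mixed (d b) (d b) b else 0) = 0 := by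
        simp only [smul_ite, smul_zero, Finset.sum_ite_eq, Finset.mem_univ, if_true]
        rw [Finset.sum_comm]
        simp only [← Finset.sum_smul, hXt', zero_smul, Finset.sum_const_zero]
      simp only [smul_add, smul_sub, Finset.sum_add_distrib, Finset.sum_sub_distrib]
      rw [z1, z2]
      ext ⟨i, j, k⟩
      simp only [sub_zero, add_zero, smul_zero, Finset.sum_apply, Pi.smul_apply, smul_eq_mul,
        mixed_apply, mul_sub, Finset.sum_sub_distrib, sum_units, sum_units_perm, hXs i j k]
      ring
    rw [e]
    exact U.smul_mem _ (sum3_mem U X _ mem)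

end Arr

/-! ### Stable subspaces of a sum of two simple subspaces of different dimensions. -/

section Lattice

variable {ι E : Type*} [AddCommGroup E] [Module ℂ E] {ρ : ι → Module.End ℂ E}
  {Y Z K U : Submodule ℂ E}

theorem IsSimpleUnder.le_of_inf_ne_bot (hY : IsSimpleUnder ρ Y) (sY : ∀ i, ∀ x ∈ Y, ρ i x ∈ Y)
    (sU : ∀ i, ∀ x ∈ U, ρ i x ∈ U) (h : U ⊓ Y ≠ ⊥) : Y ≤ U := by
  have := hY.2 (U ⊓ Y) inf_le_right (fun i x hx => ⟨sU i x hx.1, sY i x hx.2⟩) h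
  exact this ▸ inf_le_left

variable [FiniteDimensional ℂ E]

/-- If U met Z only in zero, their sum would have dimension 2 dim Z, more than dim Y + dim Z = dim
K. So U meets Z and contains it by simplicity. -/
theorem eq_of_finrank_eq_large (h1 : Y ⊓ Z = ⊥) (h2 : Y ⊔ Z = K) (hZ : IsSimpleUnder ρ Z)
    (sZ : ∀ i, ∀ x ∈ Z, ρ i x ∈ Z) (hlt : Module.finrank ℂ Y < Module.finrank ℂ Z) (hU : U ≤ K)
    (sU : ∀ i, ∀ x ∈ U, ρ i x ∈ U) (hd : Module.finrank ℂ U = Module.finrank ℂ Z) : U = Z := by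
  by_cases h : U ⊓ Z = ⊥
  · exfalso
    have e1 := Submodule.finrank_sup_add_finrank_inf_eq U Z
    have e2 := Submodule.finrank_sup_add_finrank_inf_eq Y Z
    rw [h, finrank_bot] at e1
    rw [h1, h2, finrank_bot] at e2
    have e3 := Submodule.finrank_mono (sup_le hU (h2 ▸ le_sup_right : Z ≤ K))
    omega
  · exact (Submodule.eq_of_le_of_finrank_eq (hZ.le_of_inf_ne_bot sZ sU h) hd.symm).symm

/-- Suppose U ∩ Y = 0, so that U + Y has dimension 2 dim Y. It is too large together with Z to be
disjoint from Z, hence contains Z by simplicity and so is all of K. But 2 dim Y is less than dim Y +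
dim Z. -/
theorem eq_of_finrank_eq_small (h1 : Y ⊓ Z = ⊥) (h2 : Y ⊔ Z = K) (hY : IsSimpleUnder ρ Y)
    (hZ : IsSimpleUnder ρ Z) (sY : ∀ i, ∀ x ∈ Y, ρ i x ∈ Y) (sZ : ∀ i, ∀ x ∈ Z, ρ i x ∈ Z)
    (hlt : Module.finrank ℂ Y < Module.finrank ℂ Z) (hU : U ≤ K)
    (sU : ∀ i, ∀ x ∈ U, ρ i x ∈ U) (hd : Module.finrank ℂ U = Module.finrank ℂ Y) : U = Y := by
  by_cases h : U ⊓ Y = ⊥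
  · exfalso
    have sUY : ∀ i, ∀ x ∈ U ⊔ Y, ρ i x ∈ U ⊔ Y := by
      intro i x hx
      obtain ⟨u, hu, y, hy, rfl⟩ := Submodule.mem_sup.mp hx
      rw [map_add]
      exact Submodule.add_mem_sup (sU i u hu) (sY i y hy)
    have hK : Module.finrank ℂ ↥((U ⊔ Y) ⊔ Z) ≤ Module.finrank ℂ K :=
      Submodule.finrank_mono (sup_le (sup_le hU (h2 ▸ le_sup_left)) (h2 ▸ le_sup_right))
    have e1 := Submodule.finrank_sup_add_finrank_inf_eq U Y
    have e2 := Submodule.finrank_sup_add_finrank_inf_eq Y Z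
    have e3 := Submodule.finrank_sup_add_finrank_inf_eq (U ⊔ Y) Z
    rw [h, finrank_bot] at e1
    rw [h1, h2, finrank_bot] at e2
    have hpos : 0 < Module.finrank ℂ Y := by
      rw [Nat.pos_iff_ne_zero, Ne, Submodule.finrank_eq_zero]
      exact hY.1
    have hne : (U ⊔ Y) ⊓ Z ≠ ⊥ := by
      intro h0
      rw [h0, finrank_bot] at e3
      omega
    have hle := hZ.le_of_inf_ne_bot sZ sUY hne
    have e4 := Submodule.finrank_mono (sup_le le_sup_right hle : Y ⊔ Z ≤ U ⊔ Y)
    rw [h2] at e4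
    omega
  · exact (Submodule.eq_of_le_of_finrank_eq (hY.le_of_inf_ne_bot sY sU h) hd.symm).symm

end Lattice

namespace Arr

variable {m : ℕ}

/-! #### Stability -/

theorem act3_mem_skew (A : Matrix (Fin m) (Fin m) ℂ) {T : Arr m} (h : T ∈ skew) :
    act3 A T ∈ skew := by
  intro i j k
  simp only [act3_apply]
  simp only [h _ j k, h i _ k, h i j, mul_neg, Finset.sum_neg_distrib]
  ring

theorem act1_mem_skew (A : Matrix (Fin m) (Fin m) ℂ) {T : Arr m} (h : T ∈ skew) :
    act1 A T ∈ skew := by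
  intro i j k
  simp only [act1_apply]
  simp only [h _ j k, h i _ k, h i j, mul_neg, Finset.sum_neg_distrib]
  ring

theorem act3_mem_totSkew (A : Matrix (Fin m) (Fin m) ℂ) (T : Arr m) (h : T ∈ totSkew) :
    act3 A T ∈ totSkew := by
  refine ⟨act3_mem_skew A h.1, fun i j k => ?_⟩
  simp only [act3_apply]
  simp only [h.2 i _ k, h.2 _ j k, h.2 i j, mul_neg, Finset.sum_neg_distrib]
  ring

theorem act3_mem_hook (A : Matrix (Fin m) (Fin m) ℂ) (T : Arr m) (h : T ∈ hook) :
    act3 A T ∈ hook := by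
  refine ⟨act3_mem_skew A h.1, fun i j k => ?_⟩
  simp only [act3_apply]
  have e (x a b : Fin m) : ∑ l, A x l * T (l, a, b) + ∑ l, A x l * T (a, b, l)
      + ∑ l, A x l * T (b, l, a) = 0 := by
    simp only [← Finset.sum_add_distrib, ← mul_add]
    refine Finset.sum_eq_zero fun l _ => ?_
    rw [h.2 l a b, mul_zero]
  linear_combination e i j k + e j k i + e k i j

theorem act1_mem_traces (A : Matrix (Fin m) (Fin m) ℂ) (T : Arr m) (h : T ∈ traces) :
    act1 A T ∈ traces := by
  obtain ⟨t, rfl⟩ := h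
  exact ⟨_, (act1_pureTrace A t).symm⟩

theorem tr_act1 (A : Matrix (Fin m) (Fin m) ℂ) (T : Arr m) :
    tr (act1 A T) = A.mulVec (tr T) := by
  ext k
  simp only [tr_apply, act1_apply, Finset.sum_add_distrib, Finset.sum_neg_distrib, Matrix.mulVec,
    dotProduct, Finset.mul_sum]
  rw [Finset.sum_comm (f := fun i l => A l i * T (l, i, k)), neg_add_cancel, zero_add,
    Finset.sum_comm]

theorem act1_mem_noTrace (A : Matrix (Fin m) (Fin m) ℂ) (T : Arr m) (h : T ∈ noTrace) :
    act1 A T ∈ noTrace := by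
  refine ⟨act1_mem_skew A h.1, ?_⟩
  have h0 : tr T = 0 := h.2
  rw [SetLike.mem_coe, LinearMap.mem_ker, tr_act1, h0, Matrix.mulVec_zero]

theorem finrank_totSkew_lt (hm : 2 < m) :
    Module.finrank ℂ (totSkew (m := m)) < Module.finrank ℂ (hook (m := m)) := by
  have h1 := finrank_totSkew (m := m)
  have h2 := finrank_hook (m := m)
  -- The two dimensions are in the ratio (m - 2) : 2(m + 1), which compares them without division in
  -- ℕ.
  have h : ((2 * (m + 1) * Module.finrank ℂ (totSkew (m := m)) : ℕ) : ℂ) =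
      (((m - 2 : ℕ) * Module.finrank ℂ (hook (m := m)) : ℕ) : ℂ) := by
    rw [Nat.cast_mul, Nat.cast_mul (m - 2), h1, h2, Nat.cast_sub hm.le]
    push_cast
    ring
  have h' : 2 * (m + 1) * Module.finrank ℂ (totSkew (m := m)) =
      (m - 2) * Module.finrank ℂ (hook (m := m)) := by exact_mod_cast h
  have hpos : 0 < Module.finrank ℂ (totSkew (m := m)) := by
    rw [Nat.pos_iff_ne_zero, Ne, Submodule.finrank_eq_zero]
    exact (isSimple_totSkew hm).1
  by_contra! hle
  have : (m - 2) * Module.finrank ℂ (hook (m := m)) ≤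
      (m - 2) * Module.finrank ℂ (totSkew (m := m)) := Nat.mul_le_mul_left _ hle
  have h3 : (m - 2) * Module.finrank ℂ (totSkew (m := m)) <
      2 * (m + 1) * Module.finrank ℂ (totSkew (m := m)) :=
    Nat.mul_lt_mul_of_pos_right (by omega) hpos
  omega

theorem finrank_traces_lt (hm : 2 < m) :
    Module.finrank ℂ (traces (m := m)) < Module.finrank ℂ (noTrace (m := m)) := by
  rw [finrank_traces hm]
  have h2 := finrank_noTrace hm
  have h : ((2 * Module.finrank ℂ (noTrace (m := m)) : ℕ) : ℂ) =
      ((m * (m + 1) * (m - 2) : ℕ) : ℂ) := by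
    rw [Nat.cast_mul, h2, Nat.cast_mul, Nat.cast_sub hm.le]
    push_cast
    ring
  have h' : 2 * Module.finrank ℂ (noTrace (m := m)) = m * (m + 1) * (m - 2) := by exact_mod_cast h
  have : m * (m + 1) * 1 ≤ m * (m + 1) * (m - 2) := Nat.mul_le_mul_left _ (by omega)
  have : m * (3 + 1) ≤ m * (m + 1) := Nat.mul_le_mul_left _ (by omega)
  omega

/-! #### Highest weight vectors -/

theorem act3_unit (A : Matrix (Fin m) (Fin m) ℂ) (a b c : Fin m) : act3 A (unit a b c) =
    ∑ l, A l a • unit l b c + ∑ l, A l b • unit a l c + ∑ l, A l c • unit a b l := by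
  ext ⟨i, j, k⟩
  simp only [act3_apply, Pi.add_apply, Finset.sum_apply, Pi.smul_apply, smul_eq_mul, unit_apply,
    ite_and, mul_ite, mul_one, mul_zero]
  by_cases h1 : i = a <;> by_cases h2 : j = b <;> by_cases h3 : k = c <;> simp [h1, h2, h3]

theorem act1_unit_eq_sum (A : Matrix (Fin m) (Fin m) ℂ) (a b c : Fin m) : act1 A (unit a b c) =
    -∑ l, A a l • unit l b c + ∑ l, A l b • unit a l c + ∑ l, A l c • unit a b l := by
  ext ⟨i, j, k⟩
  simp only [act1_apply, Pi.add_apply, Pi.neg_apply, Finset.sum_apply, Pi.smul_apply, smul_eq_mul,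
    unit_apply, ite_and, mul_ite, mul_one, mul_zero]
  by_cases h1 : i = a <;> by_cases h2 : j = b <;> by_cases h3 : k = c <;> simp [h1, h2, h3]

theorem act3_skewUnit (A : Matrix (Fin m) (Fin m) ℂ) (a b c : Fin m) : act3 A (skewUnit a b c) =
    ∑ l, A l a • skewUnit l b c + ∑ l, A l b • skewUnit a l c + ∑ l, A l c • skewUnit a b l := by
  simp only [skewUnit, map_add, map_sub, act3_unit, smul_add, smul_sub, Finset.sum_add_distrib,
    Finset.sum_sub_distrib]
  abel

theorem act3_hookUnit (A : Matrix (Fin m) (Fin m) ℂ) (a b c : Fin m) : act3 A (hookUnit a b c) =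
    ∑ l, A l a • hookUnit l b c + ∑ l, A l b • hookUnit a l c + ∑ l, A l c • hookUnit a b l := by
  simp only [hookUnit, map_add, map_sub, act3_unit, smul_add, smul_sub, Finset.sum_add_distrib,
    Finset.sum_sub_distrib]
  abel

theorem act1_mixed_eq_sum (A : Matrix (Fin m) (Fin m) ℂ) (a b c : Fin m) :
    act1 A (mixed a b c) = -∑ l, A a l • mixed l b c + ∑ l, A l b • mixed a l c
      + ∑ l, A l c • mixed a b l := by
  simp only [mixed, map_sub, act1_unit_eq_sum, smul_sub, Finset.sum_sub_distrib]
  abel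

/-- For lower triangular A, an index can only be replaced by a larger one. The last three indices
are already as large as possible, so every off-diagonal replacement repeats an index and gives zero.
The same mechanism produces the other highest weight vectors; a covariant index moves the opposite
way and therefore starts at the first position. -/
theorem act3_skewUnit_of_triangular (hm : 2 < m) {A : Matrix (Fin m) (Fin m) ℂ}
    (hA : ∀ i j, i < j → A i j = 0) {a b c : Fin m} (ha : (a : ℕ) = m - 3) (hb : (b : ℕ) = m - 2)
    (hc : (c : ℕ) = m - 1) :
    act3 A (skewUnit a b c) = (A a a + A b b + A c c) • skewUnit a b c := by
  have hmax : ∀ l : Fin m, l ≠ c → l < c := fun l hl => by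
    rw [Fin.lt_def]; have := l.2; rw [Ne, Fin.ext_iff] at hl; omega
  have hmax' : ∀ l : Fin m, l ≠ b → l ≠ c → l < b := fun l hl hl' => by
    rw [Fin.lt_def]; have := l.2; rw [Ne, Fin.ext_iff] at hl hl'; omega
  have hmax'' : ∀ l : Fin m, l ≠ a → l ≠ b → l ≠ c → l < a := fun l h1 h2 h3 => by
    rw [Fin.lt_def]; have := l.2; rw [Ne, Fin.ext_iff] at h1 h2 h3; omega
  rw [act3_skewUnit, Finset.sum_eq_single a, Finset.sum_eq_single b, Finset.sum_eq_single c,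
    add_smul, add_smul]
  · intro l _ hl
    rw [hA _ _ (hmax l hl), zero_smul]
  · simp
  · intro l _ hl
    by_cases h : l = c
    · rw [h, show skewUnit a c c = 0 by simp only [skewUnit]; abel, smul_zero]
    · rw [hA _ _ (hmax' l hl h), zero_smul]
  · simp
  · intro l _ hl
    by_cases h : l = c
    · rw [h, show skewUnit c b c = 0 by simp only [skewUnit]; abel, smul_zero]
    by_cases h' : l = b
    · rw [h', show skewUnit b b c = 0 by simp only [skewUnit]; abel, smul_zero]
    · rw [hA _ _ (hmax'' l hl h' h), zero_smul]
  · simp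

theorem act3_hookUnit_of_triangular (hm : 2 < m) {A : Matrix (Fin m) (Fin m) ℂ}
    (hA : ∀ i j, i < j → A i j = 0) {b c : Fin m} (hb : (b : ℕ) = m - 2)
    (hc : (c : ℕ) = m - 1) :
    act3 A (hookUnit c c b) = (A b b + 2 * A c c) • hookUnit c c b := by
  have hmax : ∀ l : Fin m, l ≠ c → l < c := fun l hl => by
    rw [Fin.lt_def]; have := l.2; rw [Ne, Fin.ext_iff] at hl; omega
  have hmax' : ∀ l : Fin m, l ≠ b → l ≠ c → l < b := fun l hl hl' => by
    rw [Fin.lt_def]; have := l.2; rw [Ne, Fin.ext_iff] at hl hl'; omega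
  rw [act3_hookUnit, Finset.sum_eq_single c, Finset.sum_eq_single c, Finset.sum_eq_single b]
  · module
  · intro l _ hl
    by_cases h : l = c
    · rw [h, show hookUnit c c c = 0 by simp only [hookUnit]; abel, smul_zero]
    · rw [hA _ _ (hmax' l hl h), zero_smul]
  · simp
  · intro l _ hl
    rw [hA _ _ (hmax l hl), zero_smul]
  · simp
  · intro l _ hl
    rw [hA _ _ (hmax l hl), zero_smul]
  · simp

theorem act1_mixed_of_triangular (hm : 2 < m) {A : Matrix (Fin m) (Fin m) ℂ}
    (hA : ∀ i j, i < j → A i j = 0) {a b c : Fin m} (ha : (a : ℕ) = 0) (hb : (b : ℕ) = m - 2)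
    (hc : (c : ℕ) = m - 1) :
    act1 A (mixed a b c) = (-A a a + A b b + A c c) • mixed a b c := by
  have hmax : ∀ l : Fin m, l ≠ c → l < c := fun l hl => by
    rw [Fin.lt_def]; have := l.2; rw [Ne, Fin.ext_iff] at hl; omega
  have hmax' : ∀ l : Fin m, l ≠ b → l ≠ c → l < b := fun l hl hl' => by
    rw [Fin.lt_def]; have := l.2; rw [Ne, Fin.ext_iff] at hl hl'; omega
  have hmin : ∀ l : Fin m, l ≠ a → a < l := fun l hl => by
    rw [Fin.lt_def]; rw [Ne, Fin.ext_iff] at hl; omega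
  rw [act1_mixed_eq_sum, Finset.sum_eq_single a, Finset.sum_eq_single b, Finset.sum_eq_single c,
    add_smul, add_smul, neg_smul]
  · intro l _ hl
    rw [hA _ _ (hmax l hl), zero_smul]
  · simp
  · intro l _ hl
    by_cases h : l = c
    · rw [h, mixed_self, smul_zero]
    · rw [hA _ _ (hmax' l hl h), zero_smul]
  · simp
  · intro l _ hl
    rw [hA _ _ (hmin l hl), zero_smul]
  · simp

theorem act1_pureTrace_of_triangular {A : Matrix (Fin m) (Fin m) ℂ}
    (hA : ∀ i j, i < j → A i j = 0) {c : Fin m} (hc : (c : ℕ) = m - 1) :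
    act1 A (pureTrace (Pi.single c 1)) = A c c • pureTrace (Pi.single c 1) := by
  rw [act1_pureTrace, ← map_smul]
  congr 1
  ext i
  rw [Matrix.mulVec_single_one]
  simp only [Pi.smul_apply, Pi.single_apply, smul_eq_mul, Matrix.col_apply]
  by_cases h : i = c
  · rw [h]; simp
  · rw [hA i c, if_neg h, mul_zero]
    rw [Fin.lt_def]; have := i.2; rw [Fin.ext_iff] at h; omega

/-! #### Raising -/

/-- The span of the arrays `R_{il} T^{ljk}` with `R` skew and `T ∈ Y`. -/
def raised (Y : Submodule ℂ (Arr m)) : Submodule ℂ (Arr m) :=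
  Submodule.span ℂ {X | ∃ R : Matrix (Fin m) (Fin m) ℂ, R.transpose = -R ∧ ∃ T ∈ Y, X = slot1 R T}

theorem slot1_mem_raised {Y : Submodule ℂ (Arr m)} {R : Matrix (Fin m) (Fin m) ℂ}
    (hR : R.transpose = -R) {T : Arr m} (hT : T ∈ Y) : slot1 R T ∈ raised Y :=
  Submodule.subset_span ⟨R, hR, T, hT, rfl⟩

/-- Leibniz rule for contraction with R. When R is skew, so is the matrix in the second term, which
makes `raised` stable under 𝔤𝔩(m). -/
theorem act1_slot1 (A R : Matrix (Fin m) (Fin m) ℂ) (T : Arr m) : act1 A (slot1 R T) =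
    slot1 R (act3 A T) + slot1 (-(A.transpose * R) - R * A) T := by
  have h : act1 A * slot1 R = slot1 R * act3 A + slot1 (-(A.transpose * R) - R * A) := by
    have e : slot1 (-(A.transpose * R) - R * A) = -slot1 (A.transpose * R) - slot1 (R * A) := by
      refine LinearMap.ext fun T => funext fun ⟨i, j, k⟩ => ?_
      simp [slot1_apply, sub_mul, Finset.sum_sub_distrib]
    have e' : -slot1 A.transpose * slot1 R = -slot1 (A.transpose * R) := by
      rw [← slot1_mul]
      exact LinearMap.neg_comp _ _
    rw [e, act1, act3, add_mul, add_mul, e', mul_add, mul_add, slot1_mul,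
      slot2_slot1, slot3_slot1]
    abel
  exact congrArg (fun X : Module.End ℂ (Arr m) => X T) h

theorem act1_mem_raised {Y : Submodule ℂ (Arr m)} (sY : ∀ A, ∀ T ∈ Y, act3 A T ∈ Y)
    (A : Matrix (Fin m) (Fin m) ℂ) (X : Arr m) (hX : X ∈ raised Y) : act1 A X ∈ raised Y := by
  induction hX using Submodule.span_induction with
  | mem X hX =>
    obtain ⟨R, hR, T, hT, rfl⟩ := hX
    rw [act1_slot1]
    refine Submodule.add_mem _ (slot1_mem_raised hR (sY A T hT)) (slot1_mem_raised ?_ hT)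
    rw [Matrix.transpose_sub, Matrix.transpose_neg, Matrix.transpose_mul, Matrix.transpose_mul, hR,
      Matrix.transpose_transpose, neg_mul, mul_neg]
    abel
  | zero => simp
  | add a b _ _ ha hb => rw [map_add]; exact Submodule.add_mem _ ha hb
  | smul c a _ ha => rw [map_smul]; exact Submodule.smul_mem _ _ ha

theorem slot1_single_unit (p q a b c : Fin m) : slot1 (Matrix.single p q 1) (unit a b c) =
    if q = a then unit p b c else 0 := by
  have e (P : Prop) [Decidable P] (X : Arr m) (x : Fin m × Fin m × Fin m) :
      (if P then X else 0) x = if P then X x else 0 := by split_ifs <;> rfl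
  ext ⟨i, j, k⟩
  simp only [slot1_apply, Matrix.single_apply, unit_apply, e, ite_and, ite_mul, one_mul, zero_mul]
  by_cases h1 : p = i
  · subst h1; simp
  · simp [h1, Ne.symm h1]

/-- The skew matrix with entries `1` at `(p, q)` and `-1` at `(q, p)`. -/
def skewMatrix (p q : Fin m) : Matrix (Fin m) (Fin m) ℂ := Matrix.single p q 1 - Matrix.single q p 1

theorem transpose_skewMatrix (p q : Fin m) : (skewMatrix p q).transpose = -skewMatrix p q := by
  simp [skewMatrix]

theorem slot1_skewMatrix_unit (p q a b c : Fin m) : slot1 (skewMatrix p q) (unit a b c) =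
    (if q = a then unit p b c else 0) - (if p = a then unit q b c else 0) := by
  have e : slot1 (skewMatrix p q) = slot1 (Matrix.single p q 1) - slot1 (Matrix.single q p 1) := by
    refine LinearMap.ext fun T => funext fun ⟨i, j, k⟩ => ?_
    simp [skewMatrix, slot1_apply, sub_mul, Finset.sum_sub_distrib]
  rw [e, LinearMap.sub_apply, slot1_single_unit, slot1_single_unit]

/-- By simplicity one nonzero trace-free array in the stable space `raised Y` brings in all of them.
-/
theorem noTrace_le_raised_of_mixed (hm : 2 < m) {Y : Submodule ℂ (Arr m)}
    (sY : ∀ A, ∀ T ∈ Y, act3 A T ∈ Y) {a b c : Fin m} (h1 : a ≠ b) (h2 : a ≠ c) (h3 : b ≠ c)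
    (h : mixed a b c ∈ raised Y) : noTrace ≤ raised Y := by
  refine (isSimple_noTrace hm).le_of_inf_ne_bot act1_mem_noTrace (act1_mem_raised sY) fun h0 => ?_
  have : mixed a b c ∈ raised Y ⊓ noTrace := ⟨h, mixed_mem h1 h2⟩
  rw [h0, Submodule.mem_bot] at this
  exact mixed_ne_zero a h3 this

theorem noTrace_le_raised_hook (hm : 2 < m) : noTrace ≤ raised (hook (m := m)) := by
  have f01 : (⟨0, by omega⟩ : Fin m) ≠ ⟨1, by omega⟩ := by simp
  have f02 : (⟨0, by omega⟩ : Fin m) ≠ ⟨2, by omega⟩ := by simp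
  have f12 : (⟨1, by omega⟩ : Fin m) ≠ ⟨2, by omega⟩ := by simp
  generalize (⟨0, by omega⟩ : Fin m) = a at *
  generalize (⟨1, by omega⟩ : Fin m) = b at *
  generalize (⟨2, by omega⟩ : Fin m) = c at *
  have h := slot1_mem_raised (transpose_skewMatrix a b) (hookUnit_mem b b c)
  have e : slot1 (skewMatrix a b) (hookUnit b b c) = (2 : ℂ) • mixed a b c := by
    simp only [hookUnit, mixed, map_add, map_sub, slot1_skewMatrix_unit, f01, if_true, if_false]
    module
  rw [e, Submodule.smul_mem_iff _ two_ne_zero] at h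
  exact noTrace_le_raised_of_mixed hm act3_mem_hook f01 f02 f12 h

/-- It suffices to reach one array with nonzero trace: its trace-free part is already available from
`noTrace_le_raised_hook`, so subtracting that part leaves a nonzero pure trace. -/
theorem traces_le_raised_hook (hm : 2 < m) : traces ≤ raised (hook (m := m)) := by
  have f01 : (⟨0, by omega⟩ : Fin m) ≠ ⟨1, by omega⟩ := by simp
  generalize (⟨0, by omega⟩ : Fin m) = a at *
  generalize (⟨1, by omega⟩ : Fin m) = b at *
  have h := slot1_mem_raised (transpose_skewMatrix b a) (hookUnit_mem a a b)
  have e : slot1 (skewMatrix b a) (hookUnit a a b) = (2 : ℂ) • mixed b a b := by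
    simp only [hookUnit, mixed, map_add, map_sub, slot1_skewMatrix_unit, f01.symm, if_true,
      if_false]
    module
  rw [e, Submodule.smul_mem_iff _ two_ne_zero] at h
  have hs : mixed b a b ∈ traces ⊔ noTrace (m := m) := by
    rw [(isCompl_noTrace hm).2]
    exact mixed_mem_skew _ _ _
  obtain ⟨y, hy, z, hz, hyz⟩ := Submodule.mem_sup.mp hs
  refine (isSimple_traces hm).le_of_inf_ne_bot act1_mem_traces (act1_mem_raised act3_mem_hook)
    fun h0 => ?_
  have hy' : y ∈ raised hook ⊓ traces := by
    refine ⟨?_, hy⟩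
    rw [eq_sub_of_add_eq hyz]
    exact Submodule.sub_mem _ h (noTrace_le_raised_hook hm hz)
  rw [h0, Submodule.mem_bot] at hy'
  rw [hy', zero_add] at hyz
  have h1 : tr (mixed b a b) = 0 := hyz ▸ hz.2
  have := congrFun h1 a
  simp [tr_apply, mixed_apply, f01] at this

/-- A fourth index d gives room to contract e_d ∧ e_b ∧ e_c along d only, leaving a lower index a
different from b and c. This is where m > 3 enters. -/
theorem noTrace_le_raised_totSkew (hm : 3 < m) : noTrace ≤ raised (totSkew (m := m)) := by
  have f01 : (⟨0, by omega⟩ : Fin m) ≠ ⟨1, by omega⟩ := by simp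
  have f02 : (⟨0, by omega⟩ : Fin m) ≠ ⟨2, by omega⟩ := by simp
  have f12 : (⟨1, by omega⟩ : Fin m) ≠ ⟨2, by omega⟩ := by simp
  have f03 : (⟨0, by omega⟩ : Fin m) ≠ ⟨3, by omega⟩ := by simp
  have f13 : (⟨1, by omega⟩ : Fin m) ≠ ⟨3, by omega⟩ := by simp
  have f23 : (⟨2, by omega⟩ : Fin m) ≠ ⟨3, by omega⟩ := by simp
  generalize (⟨0, by omega⟩ : Fin m) = a at *
  generalize (⟨1, by omega⟩ : Fin m) = b at *
  generalize (⟨2, by omega⟩ : Fin m) = c at *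
  generalize (⟨3, by omega⟩ : Fin m) = d at *
  have h := slot1_mem_raised (transpose_skewMatrix a d) (skewUnit_mem d b c)
  have e : slot1 (skewMatrix a d) (skewUnit d b c) = mixed a b c := by
    simp only [skewUnit, mixed, map_add, map_sub, slot1_skewMatrix_unit, f01, f02, f03, f13.symm,
      f23.symm, if_true, if_false]
    abel
  rw [e] at h
  exact noTrace_le_raised_of_mixed (by omega) act3_mem_totSkew f01 f02 f12 h

/-- Contracting e_a ∧ e_b ∧ e_t in the directions a and b gives the sum of two of the m - 1 terms
that make up the pure trace in direction t. Averaging over pairs recovers the whole pure trace. -/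
theorem traces_le_raised_totSkew (hm : 2 < m) : traces ≤ raised (totSkew (m := m)) := by
  have pair : ∀ a b t : Fin m, a ≠ b → a ≠ t → b ≠ t →
      mixed a a t + mixed b b t ∈ raised (totSkew (m := m)) := by
    intro a b t h1 h2 h3
    have h := slot1_mem_raised (transpose_skewMatrix b a) (skewUnit_mem a b t)
    have e : slot1 (skewMatrix b a) (skewUnit a b t) = mixed a a t + mixed b b t := by
      simp only [skewUnit, mixed, map_add, map_sub, slot1_skewMatrix_unit, h1, h1.symm, h2, h3,
        if_true, if_false]
      abel
    rwa [e] at h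
  have key : ∀ t : Fin m, pureTrace (Pi.single t 1) ∈ raised (totSkew (m := m)) := by
    intro t
    have e1 : pureTrace (Pi.single t 1) = ∑ a ∈ Finset.univ.erase t, mixed a a t := by
      rw [Finset.sum_erase (f := fun a => mixed a a t) _ (mixed_self t t)]
      ext ⟨i, j, k⟩
      simp only [pureTrace_apply, Finset.sum_apply, mixed_apply, Finset.sum_sub_distrib, ite_and,
        Pi.single_apply, Finset.sum_ite_eq, Finset.mem_univ, if_true]
      simp only [eq_comm (a := j), eq_comm (a := k)]
      congr 1
      split_ifs <;> rfl
    -- Among ordered pairs of distinct indices different from t, each index occurs m - 2 times in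
    -- either place, which accounts for 2(m - 2).
    have e2 : ∑ a ∈ Finset.univ.erase t, ∑ b ∈ (Finset.univ.erase t).erase a,
        (mixed a a t + mixed b b t) = (2 * ((m : ℂ) - 2)) • pureTrace (Pi.single t 1) := by
      have : ∀ a ∈ Finset.univ.erase t, ∑ b ∈ (Finset.univ.erase t).erase a,
          (mixed a a t + mixed b b t) =
          ((m : ℂ) - 3) • mixed a a t + pureTrace (Pi.single t 1) := by
        intro a ha
        rw [Finset.sum_add_distrib, Finset.sum_const, Finset.sum_erase_eq_sub ha, ← e1,
          Finset.card_erase_of_mem ha, Finset.card_erase_of_mem (Finset.mem_univ t),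
          Finset.card_univ, Fintype.card_fin, ← Nat.cast_smul_eq_nsmul ℂ, Nat.sub_sub,
          Nat.cast_sub (by omega)]
        push_cast
        module
      rw [Finset.sum_congr rfl this, Finset.sum_add_distrib, ← Finset.smul_sum, ← e1,
        Finset.sum_const, Finset.card_erase_of_mem (Finset.mem_univ t),
        Finset.card_univ, Fintype.card_fin, ← Nat.cast_smul_eq_nsmul ℂ, Nat.cast_sub (by omega)]
      push_cast
      module
    have hne : (2 * ((m : ℂ) - 2)) ≠ 0 := by
      refine mul_ne_zero two_ne_zero ?_
      rw [sub_ne_zero]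
      exact_mod_cast (show m ≠ 2 by omega)
    rw [← Submodule.smul_mem_iff _ hne, ← e2]
    refine Submodule.sum_mem _ fun a ha => Submodule.sum_mem _ fun b hb => ?_
    rw [Finset.mem_erase] at ha
    rw [Finset.mem_erase, Finset.mem_erase] at hb
    exact pair a b t hb.1.symm ha.1 hb.2.1
  rintro _ ⟨t, rfl⟩
  have e : t = ∑ k, t k • (Pi.single k 1 : Fin m → ℂ) := by
    ext i
    simp [Finset.sum_apply, Pi.single_apply]
  rw [e, map_sum]
  refine Submodule.sum_mem _ fun k _ => ?_
  rw [map_smul]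
  exact Submodule.smul_mem _ _ (key k)

/-- In dimension three a totally skew array is a multiple of the volume element, and contracting
that with a skew matrix amounts to dualising the matrix to a vector and taking its pure trace. -/
theorem raised_totSkew_three : raised (totSkew (m := 3)) ≤ traces := by
  refine Submodule.span_le.mpr ?_
  rintro _ ⟨R, hR, T, hT, rfl⟩
  have hR' : ∀ i j, R j i = -R i j := fun i j => congrFun (congrFun hR i) j
  have hRd : ∀ i, R i i = 0 := fun i => by linear_combination (1 / 2) * hR' i i
  have hT' : T = T (0, 1, 2) • skewUnit 0 1 2 := by
    have z1 : ∀ i j, T (i, j, j) = 0 := fun i j => by linear_combination (1 / 2) * hT.1 i j j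
    have z2 : ∀ i j, T (i, i, j) = 0 := fun i j => by linear_combination (1 / 2) * hT.2 i i j
    have z3 : ∀ i j, T (i, j, i) = 0 := fun i j => by rw [hT.1, z2, neg_zero]
    have e1 := hT.1 0 1 2
    have e2 := hT.2 0 1 2
    have e3 := hT.1 1 0 2
    have e4 := hT.2 0 2 1
    have e5 := hT.1 2 0 1
    rw [e1] at e4
    rw [e2] at e3
    rw [e4] at e5
    ext ⟨i, j, k⟩
    fin_cases i <;> fin_cases j <;> fin_cases k <;>
      simp [skewUnit, unit_apply, z1, z2, z3, e1, e2, e3, e4, e5]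
  rw [hT', map_smul]
  -- The vector dual to R, with signs fixed by the convention in `pureTrace`.
  refine Submodule.smul_mem _ _ ⟨![-R 1 2, R 0 2, -R 0 1], ?_⟩
  ext ⟨i, j, k⟩
  have r1 := hR' 0 1
  have r2 := hR' 0 2
  have r3 := hR' 1 2
  fin_cases i <;> fin_cases j <;> fin_cases k <;>
    simp [pureTrace_apply, slot1_apply, skewUnit, unit_apply, hRd, r1, r2, r3]

end Arr

namespace PureSpinor

variable {m : ℕ} {V S : Type*} [AddCommGroup V] [Module ℂ V] [AddCommGroup S] [Module ℂ S]
  (D : PureSpinor m V S)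

/-! ### Frames adapted to a pure spinor -/

theorem g_comm (v w : V) : D.g v w = D.g w v := by simpa using D.symm.eq v w

theorem xi_apply (v : V) : D.xi v = D.cl v D.ξ := rfl

theorem cl_cl (v w : V) (s : S) :
    D.cl v (D.cl w s) = (-2 * D.g v w) • s - D.cl w (D.cl v s) := by
  have h := congrArg (fun T : Module.End ℂ S => T s) (D.cl_mul_cl_add v w)
  simp only [LinearMap.add_apply, Module.End.mul_apply, LinearMap.smul_apply,
    Module.End.one_apply] at h
  rw [← h, add_sub_cancel_right]

variable [FiniteDimensional ℂ V]

theorem mem_alphaPlane {v : V} : v ∈ D.alphaPlane ↔ D.xi v = 0 := Iff.rfl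

theorem g_eq_zero {v w : V} (hv : v ∈ D.alphaPlane) (hw : w ∈ D.alphaPlane) : D.g v w = 0 := by
  have hv' : D.cl v D.ξ = 0 := hv
  have hw' : D.cl w D.ξ = 0 := hw
  have h := D.cl_cl v w D.ξ
  rw [hv', hw', map_zero, map_zero, sub_zero] at h
  have := (smul_eq_zero.mp h.symm).resolve_right D.ξ_ne_zero
  exact (mul_eq_zero.mp this).resolve_left (by norm_num)

theorem finrank_alphaPlane : Module.finrank ℂ D.alphaPlane = m := D.ξ_pure

/-- A basis `e` of `V_{1/2}`, completed by vectors `f` to a basis of `V` such that the only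
nonzero scalar products are `g(e_i, f_i) = 1`. -/
structure Frame where
  e : Module.Basis (Fin m) ℂ D.alphaPlane
  f : Fin m → V
  e_f : ∀ i j, D.g (e i) (f j) = if i = j then 1 else 0
  f_f : ∀ i j, D.g (f i) (f j) = 0

theorem exists_dual (e : Module.Basis (Fin m) ℂ D.alphaPlane) :
    ∃ f : Fin m → V, ∀ i j, D.g (e i) (f j) = if i = j then 1 else 0 := by
  have h : ∀ j, ∃ v : V, ∀ i, D.g (e i) v = if i = j then 1 else 0 := by
    intro j
    obtain ⟨φ, hφ⟩ := LinearMap.exists_extend (p := (D.alphaPlane : Submodule ℂ V)) (e.coord j)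
    refine ⟨(D.g.toDual D.nondeg).symm φ, fun i => ?_⟩
    rw [g_comm, LinearMap.BilinForm.apply_toDual_symm_apply]
    have := congrArg (fun T => T (e i)) hφ
    simpa [Finsupp.single_apply] using this
  choose f hf using h
  exact ⟨f, fun i j => hf j i⟩

theorem exists_frame (e : Module.Basis (Fin m) ℂ D.alphaPlane) : ∃ F : D.Frame, F.e = e := by
  obtain ⟨f, hf⟩ := D.exists_dual e
  have he : ∀ i j, D.g (e i : V) (e j : V) = 0 := fun i j => D.g_eq_zero (e i).2 (e j).2
  have hf' : ∀ i j, D.g (f j) (e i : V) = if i = j then 1 else 0 := fun i j => by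
    rw [g_comm, hf]
  -- Adding vectors of the null plane keeps the pairings with `e` and changes g(f_i, f_j) by two
  -- equal contributions, so half of the Gram matrix has to be subtracted.
  refine ⟨⟨e, fun j => f j - (1 / 2 : ℂ) • ∑ k, D.g (f j) (f k) • (e k : V), ?_, ?_⟩, rfl⟩
  · intro i j
    simp [hf, he]
  · intro i j
    simp only [map_sub, map_smul, LinearMap.sub_apply, LinearMap.smul_apply, map_sum,
      LinearMap.sum_apply, hf, hf', he, smul_eq_mul, mul_ite, mul_one, mul_zero, sub_zero,
      Finset.sum_ite_eq', Finset.sum_const_zero, Finset.mem_univ, if_true]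
    rw [D.g_comm (f j) (f i)]
    ring

/-- The M-components of any dual vectors are again dual to `e`, since V_{1/2} is null. They are
mutually orthogonal because M is null, and they span M by dimension. -/
theorem exists_frame_of_isSplitting {M : Submodule ℂ V} (hM : D.IsSplitting M)
    (e : Module.Basis (Fin m) ℂ D.alphaPlane) :
    ∃ F : D.Frame, F.e = e ∧ Submodule.span ℂ (Set.range F.f) = M := by
  obtain ⟨f, hf⟩ := D.exists_dual e
  have h : ∀ j, ∃ v ∈ M, ∀ i, D.g (e i) v = if i = j then 1 else 0 := by
    intro j
    have hj : f j ∈ (D.alphaPlane : Submodule ℂ V) ⊔ M := by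
      rw [hM.1.sup_eq_top]
      trivial
    obtain ⟨n, hn, v, hv, hnv⟩ := Submodule.mem_sup.mp hj
    refine ⟨v, hv, fun i => ?_⟩
    rw [← hf i j, ← hnv, map_add, D.g_eq_zero (e i).2 hn, zero_add]
  choose f' hf' hef using h
  refine ⟨⟨e, f', fun i j => hef j i, fun i j => hM.2 _ (hf' i) _ (hf' j)⟩, rfl, ?_⟩
  have hle : Submodule.span ℂ (Set.range f') ≤ M := by
    rw [Submodule.span_le]
    rintro _ ⟨i, rfl⟩
    exact hf' i
  have li : LinearIndependent ℂ f' := by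
    rw [Fintype.linearIndependent_iff]
    intro c hc i
    have := congrArg (D.g (e i)) hc
    simpa [hef] using this
  refine Submodule.eq_of_le_of_finrank_eq hle ?_
  rw [finrank_span_eq_card li, Fintype.card_fin]
  have h1 := Submodule.finrank_add_eq_of_isCompl hM.1
  have h2 : Module.finrank ℂ (D.alphaPlane : Submodule ℂ V) = m := D.ξ_pure
  rw [D.finrank_V, h2] at h1
  omega

namespace Frame

variable {D} (F : D.Frame)

theorem e_mem (i : Fin m) : (F.e i : V) ∈ D.alphaPlane := (F.e i).2

theorem e_e (i j : Fin m) : D.g (F.e i) (F.e j) = 0 := D.g_eq_zero (F.e i).2 (F.e j).2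

theorem f_e (i j : Fin m) : D.g (F.f i) (F.e j) = if i = j then 1 else 0 := by
  rw [g_comm, e_f]
  simp only [eq_comm]

theorem linearIndependent : LinearIndependent ℂ (Sum.elim (fun i => (F.e i : V)) F.f) := by
  rw [Fintype.linearIndependent_iff]
  intro c hc
  rw [Fintype.sum_sum_type] at hc
  simp only [Sum.elim_inl, Sum.elim_inr] at hc
  rintro (i | i)
  · have := congrArg (D.g (F.f i)) hc
    simpa [F.f_e, F.f_f] using this
  · have := congrArg (D.g (F.e i)) hc
    simpa [F.e_f, F.e_e] using this

theorem expand (v : V) :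
    v = ∑ i, D.g v (F.f i) • (F.e i : V) + ∑ i, D.g v (F.e i) • F.f i := by
  let b := Module.Basis.mk F.linearIndependent
    (F.linearIndependent.span_eq_top_of_card_eq_finrank' (by
      rw [D.finrank_V, Fintype.card_sum, Fintype.card_fin]; ring)).ge
  obtain ⟨c, hc⟩ : ∃ c : Fin m ⊕ Fin m → ℂ, v = ∑ i, c (Sum.inl i) • (F.e i : V)
      + ∑ i, c (Sum.inr i) • F.f i := by
    refine ⟨fun i => b.repr v i, ?_⟩
    conv_lhs => rw [← b.sum_repr v]
    rw [Fintype.sum_sum_type]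
    simp [b]
  have h1 : ∀ i, D.g v (F.f i) = c (Sum.inl i) := fun i => by
    rw [hc]
    simp [F.e_f, F.f_f]
  have h2 : ∀ i, D.g v (F.e i) = c (Sum.inr i) := fun i => by
    rw [hc]
    simp [F.e_e, F.f_e]
  simp only [h1, h2]
  exact hc

theorem mem_alphaPlane_iff {v : V} : v ∈ D.alphaPlane ↔ ∀ i, D.g v (F.e i) = 0 := by
  constructor
  · exact fun hv i => D.g_eq_zero hv (F.e i).2
  · intro h
    rw [F.expand v]
    simp only [h, zero_smul, Finset.sum_const_zero, add_zero]
    exact Submodule.sum_mem _ fun i _ => Submodule.smul_mem _ _ (F.e i).2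

theorem mem_span_f_iff {v : V} :
    v ∈ Submodule.span ℂ (Set.range F.f) ↔ ∀ i, D.g v (F.f i) = 0 := by
  constructor
  · intro hv i
    induction hv using Submodule.span_induction with
    | mem x hx =>
      obtain ⟨j, rfl⟩ := hx
      exact F.f_f j i
    | zero => simp
    | add a b _ _ ha hb => rw [map_add, LinearMap.add_apply, ha, hb, add_zero]
    | smul c a _ ha => rw [map_smul, LinearMap.smul_apply, ha, smul_zero]
  · intro h
    rw [F.expand v]
    simp only [h, zero_smul, Finset.sum_const_zero, zero_add]
    exact Submodule.sum_mem _ fun i _ =>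
      Submodule.smul_mem _ _ (Submodule.subset_span ⟨i, rfl⟩)

theorem xi_eq (v : V) : D.xi v = ∑ i, D.g v (F.e i) • D.xi (F.f i) := by
  conv_lhs => rw [F.expand v]
  rw [map_add, map_sum, map_sum]
  simp only [map_smul]
  rw [Finset.sum_eq_zero, zero_add]
  intro i _
  rw [D.mem_alphaPlane.mp (F.e i).2, smul_zero]

/-- A relation puts a combination of the `f` into V_{1/2}, where pairing with `e` shows that its
coefficients vanish. This independence allows components to be read off from every projection map.
-/
theorem linearIndependent_xi : LinearIndependent ℂ (fun i => D.xi (F.f i)) := by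
  rw [Fintype.linearIndependent_iff]
  intro c hc i
  have h : ∑ j, c j • F.f j ∈ D.alphaPlane := by
    rw [D.mem_alphaPlane, map_sum]
    simpa only [map_smul] using hc
  have := (F.mem_alphaPlane_iff.mp h) i
  simpa [F.f_e] using this

end Frame

end PureSpinor

theorem exists_dual_functionals {n : ℕ} {U : Type*} [AddCommGroup U] [Module ℂ U] {b : Fin n → U}
    (hb : LinearIndependent ℂ b) :
    ∃ c : Fin n → U →ₗ[ℂ] ℂ, ∀ i j, c i (b j) = if i = j then 1 else 0 := by
  obtain ⟨c, hc⟩ := LinearMap.exists_leftInverse_of_injective (Fintype.linearCombination ℂ b)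
    (LinearMap.ker_eq_bot.mpr hb.fintypeLinearCombination_injective)
  refine ⟨fun i => LinearMap.proj i ∘ₗ c, fun i j => ?_⟩
  have := congrFun (congrArg (fun T => T (Pi.single j 1)) hc) i
  simpa [Fintype.linearCombination_apply_single, Pi.single_apply] using this

namespace PureSpinor

variable {m : ℕ} {V S : Type*} [AddCommGroup V] [Module ℂ V] [AddCommGroup S] [Module ℂ S]
  {D : PureSpinor m V S}

theorem mem_so_iff {φ : Module.End ℂ V} : φ ∈ D.so ↔ ∀ v w, D.g (φ v) w = -D.g v (φ w) := by
  constructor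
  · exact fun h => D.skew h
  · intro h
    change φ ∈ D.g.skewAdjointSubmodule
    rw [LinearMap.mem_skewAdjointSubmodule]
    intro v w
    simpa using h v w

variable [FiniteDimensional ℂ V]

theorem par_lie_apply (φ : D.par) (v : V) : ⁅φ, v⁆ = ((φ : D.so) : Module.End ℂ V) v := rfl

namespace Frame

variable (F : D.Frame)

/-! #### Coordinates on `𝔤` and `𝔤 / 𝔭` -/

/-- The components of `φ ∈ 𝔤` modulo `𝔭`. -/
def coord2 : D.so →ₗ[ℂ] (Fin m × Fin m → ℂ) where
  toFun φ p := D.g ((φ : Module.End ℂ V) (F.e p.1)) (F.e p.2)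
  map_add' φ ψ := by ext; simp
  map_smul' c φ := by ext; simp

theorem coord2_apply (φ : D.so) (j k : Fin m) :
    F.coord2 φ (j, k) = D.g ((φ : Module.End ℂ V) (F.e j)) (F.e k) := rfl

theorem coord2_skew (φ : D.so) (j k : Fin m) : F.coord2 φ (k, j) = -F.coord2 φ (j, k) := by
  rw [coord2_apply, coord2_apply, D.skew φ.2, g_comm]

/-- Only the components of t in the directions of the `f` produce new spinors from ξ; reordering
Clifford products turns the rest into a multiple of ξ. The scalar κ is left unspecified because it
drops out of all later formulas. -/
theorem cl2_xi (t : V ⊗[ℂ] V) : ∃ κ : ℂ, D.cl2 t D.ξ =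
    ∑ j, ∑ k, D.g (tensorEquivEnd D.g D.nondeg t (F.e j)) (F.e k) • D.cl (F.f k) (D.xi (F.f j))
      + κ • D.ξ := by
  induction t with
  | zero => exact ⟨0, by simp⟩
  | add a b ha hb =>
    obtain ⟨κ, hκ⟩ := ha
    obtain ⟨κ', hκ'⟩ := hb
    refine ⟨κ + κ', ?_⟩
    simp only [map_add, LinearMap.add_apply, add_smul, Finset.sum_add_distrib]
    rw [hκ, hκ']
    abel
  | tmul x y =>
    have h1 : D.cl2 (x ⊗ₜ y) D.ξ = D.cl y (D.xi x) + D.g x y • D.ξ := by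
      rw [D.cl2_tmul, xi_apply]
      simp only [LinearMap.smul_apply, LinearMap.sub_apply, Module.End.mul_apply]
      rw [D.cl_cl x y]
      module
    have h2 : ∀ j, D.cl y (D.xi (F.f j)) = (-2 * D.g y (F.f j)) • D.ξ
        + ∑ k, D.g y (F.e k) • D.cl (F.f k) (D.xi (F.f j)) := by
      intro j
      have h3 : D.cl (F.f j) (D.xi y) = -∑ k, D.g y (F.e k) • D.cl (F.f k) (D.xi (F.f j)) := by
        rw [F.xi_eq y, map_sum, ← Finset.sum_neg_distrib]
        refine Finset.sum_congr rfl fun k _ => ?_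
        rw [map_smul, D.xi_apply, D.cl_cl, F.f_f, ← D.xi_apply]
        simp
      rw [D.xi_apply (F.f j), D.cl_cl, ← D.xi_apply y, h3, sub_neg_eq_add, D.xi_apply]
    refine ⟨D.g x y + ∑ j, D.g x (F.e j) * (-2 * D.g y (F.f j)), ?_⟩
    rw [h1, F.xi_eq x, map_sum]
    simp only [map_smul, h2, tensorEquivEnd_tmul, LinearMap.smul_apply, smul_add, Finset.smul_sum,
      Finset.sum_add_distrib, smul_smul, add_smul, Finset.sum_smul, smul_eq_mul]
    abel

theorem xi2_eq (φ : D.so) : ∃ κ : ℂ, D.xi2 φ =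
    ∑ j, ∑ k, F.coord2 φ (j, k) • D.cl (F.f k) (D.xi (F.f j)) + κ • D.ξ := by
  obtain ⟨κ, hκ⟩ := F.cl2_xi (D.twoForm φ)
  refine ⟨κ, ?_⟩
  simp only [D.tensorEquivEnd_twoForm] at hκ
  exact hκ

/-- Elements of 𝔭 preserve V_{1/2}, which is null, so these components vanish. Conversely, without
them the formula for `xi2` leaves only a multiple of ξ. -/
theorem mem_par_iff {φ : D.so} : φ ∈ D.par ↔ F.coord2 φ = 0 := by
  constructor
  · intro h
    ext ⟨j, k⟩
    exact D.g_eq_zero (D.alphaPlane.lie_mem (x := ⟨φ, h⟩) (F.e_mem j)) (F.e_mem k)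
  · intro h
    obtain ⟨κ, hκ⟩ := F.xi2_eq φ
    refine ⟨κ, ?_⟩
    refine hκ.trans ?_
    simp [h]

/-- The components of an element of `𝔤 / 𝔭`. -/
def coordQuot : (D.so ⧸ D.par.toLieSubmodule) →ₗ[ℂ] (Fin m × Fin m → ℂ) :=
  (D.par.toLieSubmodule : Submodule ℂ D.so).liftQ F.coord2 fun _ h => F.mem_par_iff.mp h

theorem coordQuot_mk (φ : D.so) :
    F.coordQuot (LieSubmodule.Quotient.mk φ : D.so ⧸ D.par.toLieSubmodule) = F.coord2 φ := rfl

theorem coordQuot_injective : Function.Injective F.coordQuot := by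
  rw [injective_iff_map_eq_zero]
  intro q hq
  obtain ⟨φ, rfl⟩ := LieSubmodule.Quotient.surjective_mk' _ q
  exact (LieSubmodule.Quotient.mk_eq_zero' (N := D.par.toLieSubmodule)).mpr (F.mem_par_iff.mpr hq)

theorem coordQuot_skew (q : D.so ⧸ D.par.toLieSubmodule) (j k : Fin m) :
    F.coordQuot q (k, j) = -F.coordQuot q (j, k) := by
  obtain ⟨φ, rfl⟩ := LieSubmodule.Quotient.surjective_mk' _ q
  exact F.coord2_skew φ j k

theorem exists_coordQuot_eq {C : Fin m × Fin m → ℂ} (hC : ∀ j k, C (k, j) = -C (j, k)) :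
    ∃ q, F.coordQuot q = C := by
  -- This endomorphism sends e_j to ∑ C(j, k) f_k and kills every f_j. It is skew because C is.
  let φ : Module.End ℂ V := ∑ j, ∑ k, C (j, k) • (D.g (F.f j)).smulRight (F.f k)
  have hφ : ∀ v, φ v = ∑ j, ∑ k, C (j, k) • D.g (F.f j) v • F.f k := fun v => by
    simp [φ, LinearMap.sum_apply]
  have h : φ ∈ D.so := by
    rw [mem_so_iff]
    intro v w
    rw [hφ, hφ]
    simp only [map_sum, LinearMap.sum_apply, map_smul, LinearMap.smul_apply, smul_eq_mul]
    rw [Finset.sum_comm, ← Finset.sum_neg_distrib]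
    refine Finset.sum_congr rfl fun k _ => ?_
    rw [← Finset.sum_neg_distrib]
    refine Finset.sum_congr rfl fun j _ => ?_
    rw [hC k j, D.g_comm v]
    ring
  refine ⟨LieSubmodule.Quotient.mk ⟨φ, h⟩, ?_⟩
  ext ⟨j, k⟩
  rw [coordQuot_mk, coord2_apply]
  simp [hφ, F.f_e]

/-! #### Coordinates on `W` -/

/-- The components of an element of `W = V ⊗ 𝔤 / 𝔭`, obtained by contraction with `a`. -/
def coordW (a : Fin m → V) : D.W →ₗ[ℂ] Arr m :=
  TensorProduct.lift (LinearMap.mk₂ ℂ (fun (v : V) q p => D.g v (a p.1) * F.coordQuot q p.2)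
    (by intros; ext; simp [add_mul]) (by intros; ext; simp [mul_assoc])
    (by intros; ext; simp [mul_add]) (by intros; ext; simp [mul_left_comm]))

theorem coordW_tmul (a : Fin m → V) (v : V) (q : D.so ⧸ D.par.toLieSubmodule) (i j k : Fin m) :
    F.coordW a (v ⊗ₜ q) (i, j, k) = D.g v (a i) * F.coordQuot q (j, k) := rfl

/-- The components in `V_{-1/2} ⊗ Λ² V_{-1/2}` of an element of `W`. -/
def lo : D.W →ₗ[ℂ] Arr m := F.coordW fun i => F.e i

/-- The components in `V_{1/2} ⊗ Λ² V_{-1/2}` of an element of `W`. -/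
def hi : D.W →ₗ[ℂ] Arr m := F.coordW F.f

theorem coordW_mem_skew (a : Fin m → V) (w : D.W) : F.coordW a w ∈ Arr.skew := by
  induction w using TensorProduct.induction_on with
  | zero => rw [map_zero]; exact Submodule.zero_mem _
  | add x y hx hy => rw [map_add]; exact Submodule.add_mem _ hx hy
  | tmul v q =>
    intro i j k
    rw [coordW_tmul, coordW_tmul, F.coordQuot_skew q j k, mul_neg]

theorem lo_mem_skew (w : D.W) : F.lo w ∈ Arr.skew := F.coordW_mem_skew _ w

theorem hi_mem_skew (w : D.W) : F.hi w ∈ Arr.skew := F.coordW_mem_skew _ w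

/-- Contraction of an element of `W` with a vector. -/
def contractW (a : V) : D.W →ₗ[ℂ] (D.so ⧸ D.par.toLieSubmodule) :=
  TensorProduct.lift ((LinearMap.lsmul ℂ _).comp (D.g.flip a))

theorem contractW_tmul (a v : V) (q : D.so ⧸ D.par.toLieSubmodule) :
    contractW a (v ⊗ₜ q) = D.g v a • q := rfl

theorem coordQuot_contractW (a : Fin m → V) (w : D.W) (i j k : Fin m) :
    F.coordQuot (contractW (a i) w) (j, k) = F.coordW a w (i, j, k) := by
  induction w using TensorProduct.induction_on with
  | zero => simp
  | add x y hx hy => simp only [map_add, Pi.add_apply, hx, hy]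
  | tmul v q => rw [contractW_tmul, coordW_tmul, map_smul]; rfl

theorem expandW (w : D.W) : w = ∑ i, (F.e i : V) ⊗ₜ[ℂ] contractW (F.f i) w
    + ∑ i, F.f i ⊗ₜ[ℂ] contractW (F.e i : V) w := by
  induction w using TensorProduct.induction_on with
  | zero => simp
  | add x y hx hy =>
    conv_lhs => rw [hx, hy]
    simp only [map_add, TensorProduct.tmul_add, Finset.sum_add_distrib]
    abel
  | tmul v q =>
    conv_lhs => rw [F.expand v]
    simp only [contractW_tmul, TensorProduct.add_tmul, TensorProduct.sum_tmul,
      TensorProduct.smul_tmul]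

theorem contractW_eq_zero_of_lo {w : D.W} (h : F.lo w = 0) (i : Fin m) :
    contractW (F.e i : V) w = 0 := by
  apply F.coordQuot_injective
  ext ⟨j, k⟩
  have := F.coordQuot_contractW (fun i => (F.e i : V)) w i j k
  rw [this, map_zero]
  exact congrFun h (i, j, k)

theorem contractW_eq_zero_of_hi {w : D.W} (h : F.hi w = 0) (i : Fin m) :
    contractW (F.f i) w = 0 := by
  apply F.coordQuot_injective
  ext ⟨j, k⟩
  rw [F.coordQuot_contractW, map_zero]
  exact congrFun h (i, j, k)

theorem eq_zero_of_lo_hi {w : D.W} (h1 : F.lo w = 0) (h2 : F.hi w = 0) : w = 0 := by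
  rw [F.expandW w]
  simp [F.contractW_eq_zero_of_lo h1, F.contractW_eq_zero_of_hi h2]

theorem exists_lo_hi_eq {T T' : Arr m} (hT : T ∈ Arr.skew) (hT' : T' ∈ Arr.skew) :
    ∃ w : D.W, F.lo w = T ∧ F.hi w = T' := by
  have h (T : Arr m) (hT : T ∈ Arr.skew) :
      ∃ q : Fin m → D.so ⧸ D.par.toLieSubmodule, ∀ i j k, F.coordQuot (q i) (j, k) = T (i, j, k) := by
    choose q hq using fun i => F.exists_coordQuot_eq (C := fun p => T (i, p)) (hT i)
    exact ⟨q, fun i j k => congrFun (hq i) (j, k)⟩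
  obtain ⟨q, hq⟩ := h T hT
  obtain ⟨q', hq'⟩ := h T' hT'
  refine ⟨∑ i, F.f i ⊗ₜ q i + ∑ i, (F.e i : V) ⊗ₜ q' i, ?_, ?_⟩ <;> ext ⟨i, j, k⟩
  · simp [lo, coordW_tmul, F.f_e, F.e_e, hq]
  · simp [hi, coordW_tmul, F.f_f, F.e_f, hq']

theorem mem_Whalf_iff {w : D.W} : w ∈ D.Whalf ↔ F.lo w = 0 := by
  constructor
  · rintro ⟨t, rfl⟩
    induction t with
    | zero => simp
    | add x y hx hy => rw [map_add, map_add, hx, hy, add_zero]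
    | tmul v q =>
      ext ⟨i, j, k⟩
      change D.g (v : V) (F.e i) * F.coordQuot q (j, k) = 0
      rw [D.g_eq_zero v.2 (F.e i).2, zero_mul]
  · intro h
    rw [F.expandW w]
    simp only [F.contractW_eq_zero_of_lo h, TensorProduct.tmul_zero, Finset.sum_const_zero,
      add_zero]
    exact ⟨∑ i, F.e i ⊗ₜ contractW (F.f i) w, by simp⟩

/-! #### The action of `𝔭` -/

/-- The matrix of `φ ∈ 𝔭` acting on `V / V_{1/2}`. -/
def matA (φ : D.par) : Matrix (Fin m) (Fin m) ℂ :=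
  Matrix.of fun i j => -D.g ⁅φ, (F.e i : V)⁆ (F.f j)

/-- The component of `φ ∈ 𝔭` mapping `V_{-1/2}` to `V_{1/2}`. -/
def matR (φ : D.par) : Matrix (Fin m) (Fin m) ℂ :=
  Matrix.of fun i j => -D.g ⁅φ, F.f i⁆ (F.f j)

theorem skew_par (φ : D.par) (v w : V) : D.g ⁅φ, v⁆ w = -D.g v ⁅φ, w⁆ := D.skew φ.1.2 v w

theorem transpose_matR (φ : D.par) : (F.matR φ).transpose = -F.matR φ := by
  ext i j
  simp only [Matrix.transpose_apply, Matrix.neg_apply, matR, Matrix.of_apply]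
  rw [skew_par, g_comm]

theorem lie_e (φ : D.par) (i : Fin m) : ⁅φ, (F.e i : V)⁆ = ∑ j, (-F.matA φ i j) • (F.e j : V) := by
  conv_lhs => rw [F.expand ⁅φ, (F.e i : V)⁆]
  have : ∀ k, D.g ⁅φ, (F.e i : V)⁆ (F.e k) = 0 := fun k =>
    D.g_eq_zero (D.alphaPlane.lie_mem (F.e_mem i)) (F.e_mem k)
  simp [this, matA, -LieSubalgebra.coe_bracket_of_module]

theorem lie_f (φ : D.par) (i : Fin m) : ⁅φ, F.f i⁆ = ∑ j, (-F.matR φ i j) • (F.e j : V)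
    + ∑ j, F.matA φ j i • F.f j := by
  conv_lhs => rw [F.expand ⁅φ, F.f i⁆]
  congr 1
  · simp [matR]
  · refine Finset.sum_congr rfl fun j _ => ?_
    rw [skew_par, g_comm]
    rfl

theorem coordQuot_lie (φ : D.par) (q : D.so ⧸ D.par.toLieSubmodule) (j k : Fin m) :
    F.coordQuot ⁅φ, q⁆ (j, k) = ∑ l, F.matA φ j l * F.coordQuot q (l, k)
      + ∑ l, F.matA φ k l * F.coordQuot q (j, l) := by
  obtain ⟨ψ, rfl⟩ := LieSubmodule.Quotient.surjective_mk' _ q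
  change D.g (⁅((φ : D.so) : Module.End ℂ V), (ψ : Module.End ℂ V)⁆ (F.e j)) (F.e k) =
    ∑ l, F.matA φ j l * F.coord2 ψ (l, k) + ∑ l, F.matA φ k l * F.coord2 ψ (j, l)
  rw [LieRing.of_associative_ring_bracket, LinearMap.sub_apply, Module.End.mul_apply,
    Module.End.mul_apply, ← par_lie_apply, ← par_lie_apply, map_sub, LinearMap.sub_apply,
    skew_par, F.lie_e, F.lie_e]
  simp only [map_sum, map_smul, LinearMap.sum_apply, LinearMap.smul_apply, smul_eq_mul, coord2_apply,
    Finset.sum_neg_distrib, neg_smul, map_neg, LinearMap.neg_apply]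
  ring

theorem lo_lie (φ : D.par) (w : D.W) : F.lo ⁅φ, w⁆ = Arr.act3 (F.matA φ) (F.lo w) := by
  induction w using TensorProduct.induction_on with
  | zero => simp
  | add x y hx hy => simp only [lie_add, map_add, hx, hy]
  | tmul v q =>
    ext ⟨i, j, k⟩
    rw [TensorProduct.LieModule.lie_tmul_right, map_add, Pi.add_apply, lo, coordW_tmul, coordW_tmul,
      Arr.act3_apply, coordQuot_lie, skew_par, F.lie_e]
    simp only [coordW_tmul, map_sum, map_smul, smul_eq_mul, Finset.sum_mul, Finset.mul_sum, mul_add,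
      ← Finset.sum_neg_distrib, neg_neg, neg_smul, map_neg]
    rw [add_assoc]
    congr 1
    · exact Finset.sum_congr rfl fun l _ => by ring
    · congr 1 <;> exact Finset.sum_congr rfl fun l _ => by ring

/-- The contraction with f_i picks up a second term because φ moves f_i partly into V_{1/2}. This
term is the only interaction between the two levels of the filtration, and it carries the whole
action of 𝔤₁. -/
theorem hi_lie (φ : D.par) (w : D.W) :
    F.hi ⁅φ, w⁆ = Arr.act1 (F.matA φ) (F.hi w) + Arr.slot1 (F.matR φ) (F.lo w) := by
  induction w using TensorProduct.induction_on with
  | zero => simp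
  | add x y hx hy =>
    simp only [lie_add, map_add, hx, hy]
    abel
  | tmul v q =>
    ext ⟨i, j, k⟩
    rw [TensorProduct.LieModule.lie_tmul_right, map_add, Pi.add_apply, Pi.add_apply, hi, lo,
      coordW_tmul, coordW_tmul, Arr.act1_apply, Arr.slot1_apply, coordQuot_lie, skew_par, F.lie_f]
    have e1 : ∀ x y z w : ℂ, -x + y + z + w = (w + -x) + (y + z) := fun x y z w => by ring
    rw [e1]
    simp only [coordW_tmul, map_add, map_sum, map_smul, smul_eq_mul, Finset.sum_mul, Finset.mul_sum,
      mul_add, add_mul, ← Finset.sum_neg_distrib, neg_mul, neg_neg, neg_smul, map_neg, neg_add]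
    congr 1
    · congr 1 <;> exact Finset.sum_congr rfl fun l _ => by ring
    · congr 1 <;> exact Finset.sum_congr rfl fun l _ => by ring

theorem exists_par (A R : Matrix (Fin m) (Fin m) ℂ) (hR : R.transpose = -R) :
    ∃ φ : D.par, F.matA φ = A ∧ F.matR φ = R := by
  -- The A-terms are combinations of the elements f_i ∧ e_j of 𝔰𝔬(V, g). The R-terms map the `f`
  -- into V_{1/2} and are skew because R is.
  let φ : Module.End ℂ V := ∑ i, ∑ j, (A i j • ((D.g (F.e j)).smulRight (F.f i)
    - (D.g (F.f i)).smulRight (F.e j : V)) - R i j • (D.g (F.e i)).smulRight (F.e j : V))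
  have hφ : ∀ v, φ v = ∑ i, ∑ j, (A i j • (D.g (F.e j) v • F.f i - D.g (F.f i) v • (F.e j : V))
      - R i j • D.g (F.e i) v • (F.e j : V)) := fun v => by
    simp only [φ, LinearMap.sum_apply, LinearMap.sub_apply, LinearMap.smul_apply,
      LinearMap.smulRight_apply]
  have hR' : ∀ i j, R j i = -R i j := fun i j => congrFun (congrFun hR i) j
  have hs : ∀ v w, ∑ i, ∑ j, R i j * (D.g (F.e i) v * D.g (F.e j) w) =
      -∑ i, ∑ j, R i j * (D.g (F.e i) w * D.g (F.e j) v) := by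
    intro v w
    rw [Finset.sum_comm, ← Finset.sum_neg_distrib]
    refine Finset.sum_congr rfl fun i _ => ?_
    rw [← Finset.sum_neg_distrib]
    refine Finset.sum_congr rfl fun j _ => ?_
    rw [hR' i j]
    ring
  have hg : ∀ v w, D.g (φ v) w = ∑ i, ∑ j, A i j * (D.g (F.e j) v * D.g (F.f i) w
      - D.g (F.f i) v * D.g (F.e j) w) - ∑ i, ∑ j, R i j * (D.g (F.e i) v * D.g (F.e j) w) := by
    intro v w
    rw [hφ]
    simp only [map_sum, LinearMap.sum_apply, map_sub, LinearMap.sub_apply, map_smul,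
      LinearMap.smul_apply, smul_eq_mul, Finset.sum_sub_distrib]
  have h : φ ∈ D.so := by
    rw [mem_so_iff]
    intro v w
    rw [D.g_comm v, hg, hg, hs v w, neg_sub, sub_neg_eq_add, sub_eq_add_neg, add_comm]
    congr 1
    rw [← Finset.sum_neg_distrib]
    refine Finset.sum_congr rfl fun i _ => ?_
    rw [← Finset.sum_neg_distrib]
    exact Finset.sum_congr rfl fun j _ => by ring
  have hpar : (⟨φ, h⟩ : D.so) ∈ D.par := by
    rw [F.mem_par_iff]
    ext ⟨j, k⟩
    rw [coord2_apply]
    simp [hφ, F.e_e, F.f_e]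
  refine ⟨⟨⟨φ, h⟩, hpar⟩, ?_, ?_⟩
  · ext i j
    change -D.g (φ (F.e i)) (F.f j) = _
    simp [hφ, F.e_e, F.f_e, F.e_f]
  · ext i j
    change -D.g (φ (F.f i)) (F.f j) = _
    simp [hφ, F.e_f, F.f_f]

theorem mem_g0_iff {φ : D.par} : φ ∈ D.g0 (Submodule.span ℂ (Set.range F.f)) ↔ F.matR φ = 0 := by
  constructor
  · intro h
    ext i j
    have := F.mem_span_f_iff.mp (h (F.f i) (Submodule.subset_span ⟨i, rfl⟩)) j
    simp [matR, this, -LieSubalgebra.coe_bracket_of_module]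
  · intro h v hv
    have h' : ∀ i j, D.g ⁅φ, F.f i⁆ (F.f j) = 0 := fun i j => by
      have := congrFun (congrFun h i) j
      simpa [matR] using this
    induction hv using Submodule.span_induction with
    | mem x hx =>
      obtain ⟨i, rfl⟩ := hx
      exact F.mem_span_f_iff.mpr (h' i)
    | zero => simp
    | add a b _ _ ha hb => rw [lie_add]; exact Submodule.add_mem _ ha hb
    | smul c a _ ha => rw [lie_smul]; exact Submodule.smul_mem _ _ ha

/-- The defining tensor is ∑ ξ(f_i) ⊗ φ e_i. As the spinors ξ(f_i) are independent, it vanishes only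
if φ kills V_{1/2}. -/
theorem mem_g1_iff {φ : D.par} : φ ∈ D.g1 ↔ F.matA φ = 0 := by
  have key : TensorProduct.map D.xi LinearMap.id (D.twoForm φ) =
      ∑ i, D.xi (F.f i) ⊗ₜ[ℂ] ⁅φ, (F.e i : V)⁆ := by
    have : ∀ t : V ⊗[ℂ] V, TensorProduct.map D.xi LinearMap.id t =
        ∑ i, D.xi (F.f i) ⊗ₜ[ℂ] tensorEquivEnd D.g D.nondeg t (F.e i) := by
      intro t
      induction t with
      | zero => simp
      | add a b ha hb =>
        simp only [map_add, ha, hb, LinearMap.add_apply, TensorProduct.tmul_add,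
          Finset.sum_add_distrib]
      | tmul x y =>
        rw [TensorProduct.map_tmul, F.xi_eq x]
        simp only [tensorEquivEnd_tmul, TensorProduct.sum_tmul, TensorProduct.smul_tmul,
          LinearMap.id_apply]
    rw [this]
    simp only [D.tensorEquivEnd_twoForm, par_lie_apply]
  change TensorProduct.map D.xi LinearMap.id (D.twoForm φ) = 0 ↔ _
  rw [key]
  constructor
  · intro h
    obtain ⟨c, hc⟩ := exists_dual_functionals F.linearIndependent_xi
    have h0 : ∀ i, ⁅φ, (F.e i : V)⁆ = 0 := by
      intro i
      have := congrArg (TensorProduct.lid ℂ V ∘ TensorProduct.map (c i) LinearMap.id) h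
      simpa [hc, -LieSubalgebra.coe_bracket_of_module] using this
    ext i j
    simp [matA, h0, -LieSubalgebra.coe_bracket_of_module]
  · intro h
    have h0 : ∀ i, ⁅φ, (F.e i : V)⁆ = 0 := fun i => by
      rw [F.lie_e, h]; simp
    simp [h0]

end Frame

end PureSpinor

/-! ### Tensors with given components, and the symmetrisers acting on them. -/

section ArrayTensors

variable {m : ℕ} {U : Type*} [AddCommGroup U] [Module ℂ U]

/-- The linear combination of the vectors `v i j k` with coefficients given by an array. -/
def Arr.comb (v : Fin m → Fin m → Fin m → U) : Arr m →ₗ[ℂ] U where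
  toFun T := ∑ i, ∑ j, ∑ k, T (i, j, k) • v i j k
  map_add' T T' := by simp only [Pi.add_apply, add_smul, Finset.sum_add_distrib]
  map_smul' c T := by
    simp only [Pi.smul_apply, smul_eq_mul, mul_smul, ← Finset.smul_sum, RingHom.id_apply]

theorem Arr.comb_apply (v : Fin m → Fin m → Fin m → U) (T : Arr m) :
    Arr.comb v T = ∑ i, ∑ j, ∑ k, T (i, j, k) • v i j k := rfl

theorem Arr.comb_bilinear {X Y : Type*} [AddCommGroup X] [Module ℂ X] [AddCommGroup Y] [Module ℂ Y]
    (B : X →ₗ[ℂ] Y →ₗ[ℂ] U) (a : Fin m → ℂ) (c : Fin m × Fin m → ℂ) (x : Fin m → X)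
    (y : Fin m → Fin m → Y) : B (∑ i, a i • x i) (∑ j, ∑ k, c (j, k) • y j k) =
      Arr.comb (fun i j k => B (x i) (y j k)) fun p => a p.1 * c p.2 := by
  have e : B (∑ i, a i • x i) = ∑ i, a i • B (x i) := by simp only [map_sum, map_smul]
  rw [e, LinearMap.sum_apply, Arr.comb_apply]
  refine Finset.sum_congr rfl fun i _ => ?_
  rw [LinearMap.smul_apply, map_sum, Finset.smul_sum]
  refine Finset.sum_congr rfl fun j _ => ?_
  rw [map_sum, Finset.smul_sum]
  refine Finset.sum_congr rfl fun k _ => ?_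
  rw [map_smul, smul_smul]

/-- The two contractions agree up to the sign that skewness supplies, so each contributes twice the
trace. -/
theorem Arr.comb_trace {T : Arr m} (hT : T ∈ Arr.skew) (x : Fin m → U) :
    Arr.comb (fun i j k => (if i = j then (2 : ℂ) else 0) • x k
      - (if i = k then (2 : ℂ) else 0) • x j) T = (4 : ℂ) • ∑ k, Arr.tr T k • x k := by
  have e1 : ∀ i, ∑ j, ∑ k, T (i, j, k) • (if i = j then (2 : ℂ) else 0) • x k =
      ∑ k, (2 : ℂ) • T (i, i, k) • x k := fun i => by
    rw [Finset.sum_comm]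
    simp [smul_smul, mul_comm]
  have e2 : ∀ i, ∑ j, ∑ k, T (i, j, k) • (if i = k then (2 : ℂ) else 0) • x j =
      -∑ k, (2 : ℂ) • T (i, i, k) • x k := fun i => by
    simp [hT i i, smul_smul, mul_comm]
  simp only [comb_apply, smul_sub, Finset.sum_sub_distrib, e1, e2, Finset.sum_neg_distrib,
    tr_apply, Finset.sum_smul]
  rw [Finset.sum_comm]
  simp only [← Finset.smul_sum]
  module

theorem Arr.comb_add (v w : Fin m → Fin m → Fin m → U) (T : Arr m) :
    Arr.comb (fun i j k => v i j k + w i j k) T = Arr.comb v T + Arr.comb w T := by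
  simp only [comb_apply, smul_add, Finset.sum_add_distrib]

theorem Arr.comb_sub (v w : Fin m → Fin m → Fin m → U) (T : Arr m) :
    Arr.comb (fun i j k => v i j k - w i j k) T = Arr.comb v T - Arr.comb w T := by
  simp only [comb_apply, smul_sub, Finset.sum_sub_distrib]

theorem Arr.map_comb {X : Type*} [AddCommGroup X] [Module ℂ X] (f : U →ₗ[ℂ] X)
    (v : Fin m → Fin m → Fin m → U) (T : Arr m) :
    f (Arr.comb v T) = Arr.comb (fun i j k => f (v i j k)) T := by
  simp only [comb_apply, map_sum, map_smul]

/-- The three-fold tensor with given components. -/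
def Arr.tens (a b c : Fin m → U) : Arr m →ₗ[ℂ] (U ⊗[ℂ] (U ⊗[ℂ] U)) :=
  Arr.comb fun i j k => a i ⊗ₜ (b j ⊗ₜ c k)

theorem Arr.tens_injective {a b c : Fin m → U} (ha : LinearIndependent ℂ a)
    (hb : LinearIndependent ℂ b) (hc : LinearIndependent ℂ c) :
    Function.Injective (Arr.tens a b c) := by
  obtain ⟨α, hα⟩ := exists_dual_functionals ha
  obtain ⟨β, hβ⟩ := exists_dual_functionals hb
  obtain ⟨γ, hγ⟩ := exists_dual_functionals hc
  rw [injective_iff_map_eq_zero]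
  intro T hT
  ext ⟨i, j, k⟩
  have := congrArg (LinearMap.mul' ℂ ℂ ∘ₗ TensorProduct.map (α i)
    (LinearMap.mul' ℂ ℂ ∘ₗ TensorProduct.map (β j) (γ k))) hT
  simpa [tens, comb_apply, hα, hβ, hγ] using this

theorem eq_zero_of_sum_tmul {b c : Fin m → U} (hb : LinearIndependent ℂ b)
    (hc : LinearIndependent ℂ c) {X : Fin m → Fin m → ℂ}
    (h : ∑ j, ∑ k, X j k • (b j ⊗ₜ[ℂ] c k) = 0) (j k : Fin m) : X j k = 0 := by
  obtain ⟨β, hβ⟩ := exists_dual_functionals hb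
  obtain ⟨γ, hγ⟩ := exists_dual_functionals hc
  have := congrArg (LinearMap.mul' ℂ ℂ ∘ₗ TensorProduct.map (β j) (γ k)) h
  simpa [hβ, hγ] using this

theorem swap12_tmul (x y z : U) : swap12 (x ⊗ₜ[ℂ] (y ⊗ₜ[ℂ] z)) = y ⊗ₜ (x ⊗ₜ z) := rfl

theorem swap23_tmul (x y z : U) : swap23 (x ⊗ₜ[ℂ] (y ⊗ₜ[ℂ] z)) = x ⊗ₜ (z ⊗ₜ y) := rfl

theorem swap12_tens (a b c : Fin m → U) (T : Arr m) :
    swap12 (Arr.tens a b c T) = Arr.tens b a c fun p => T (p.2.1, p.1, p.2.2) := by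
  simp only [Arr.tens, Arr.comb_apply, map_sum, map_smul, swap12_tmul]
  rw [Finset.sum_comm]

theorem swap23_tens (a b c : Fin m → U) (T : Arr m) :
    swap23 (Arr.tens a b c T) = Arr.tens a c b fun p => T (p.1, p.2.2, p.2.1) := by
  simp only [Arr.tens, Arr.comb_apply, map_sum, map_smul, swap23_tmul]
  exact Finset.sum_congr rfl fun i _ => Finset.sum_comm

theorem symm12_tens_eq_zero_iff {x : Fin m → U} (hx : LinearIndependent ℂ x) {T : Arr m}
    (hT : T ∈ Arr.skew) : symm12 (Arr.tens x x x T) = 0 ↔ T ∈ Arr.totSkew := by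
  have e : symm12 (Arr.tens x x x T) =
      Arr.tens x x x ((1 / 2 : ℂ) • (T + fun p => T (p.2.1, p.1, p.2.2))) := by
    simp [symm12, swap12_tens]
  rw [e, map_eq_zero_iff _ (Arr.tens_injective hx hx hx)]
  constructor
  · intro h
    refine ⟨hT, fun i j k => ?_⟩
    have := congrFun h (i, j, k)
    simp only [Pi.smul_apply, Pi.add_apply, Pi.zero_apply, smul_eq_mul] at this
    linear_combination 2 * this
  · intro h
    ext ⟨i, j, k⟩
    simp [h.2 i j k]

theorem alt3_tens_eq_zero_iff {x : Fin m → U} (hx : LinearIndependent ℂ x) {T : Arr m}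
    (hT : T ∈ Arr.skew) : alt3 (Arr.tens x x x T) = 0 ↔ T ∈ Arr.hook := by
  have e : alt3 (Arr.tens x x x T) = Arr.tens x x x ((1 / 3 : ℂ) • (T
      + (fun p => T (p.2.1, p.2.2, p.1)) + fun p => T (p.2.2, p.1, p.2.1))) := by
    have e1 : (fun p : Fin m × Fin m × Fin m => T (p.1, p.2.2, p.2.1)) = -T := by
      ext ⟨i, j, k⟩; exact hT i j k
    have e2 : (fun p : Fin m × Fin m × Fin m => T (p.2.1, p.1, p.2.2)) =
        -fun p => T (p.2.1, p.2.2, p.1) := by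
      ext ⟨i, j, k⟩; exact hT j k i
    have e3 : (fun p : Fin m × Fin m × Fin m => T (p.2.2, p.2.1, p.1)) =
        -fun p => T (p.2.2, p.1, p.2.1) := by
      ext ⟨i, j, k⟩; exact hT k i j
    simp only [alt3, LinearMap.smul_apply, LinearMap.add_apply, LinearMap.sub_apply,
      LinearMap.comp_apply, LinearMap.id_apply, swap12_tens, swap23_tens]
    simp only [e1, e2, e3, map_neg, map_smul, map_add]
    module
  rw [e, map_eq_zero_iff _ (Arr.tens_injective hx hx hx)]
  constructor
  · intro h
    refine ⟨hT, fun i j k => ?_⟩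
    have := congrFun h (i, j, k)
    simp only [Pi.smul_apply, Pi.add_apply, Pi.zero_apply, smul_eq_mul] at this
    linear_combination 3 * this
  · intro h
    ext ⟨i, j, k⟩
    simp [h.2 i j k]

theorem alt_apply (x y : U) : alt x y = (1 / 2 : ℂ) • (x ⊗ₜ[ℂ] y - y ⊗ₜ x) := rfl

end ArrayTensors

namespace PureSpinor

variable {m : ℕ} {V S : Type*} [AddCommGroup V] [Module ℂ V] [AddCommGroup S] [Module ℂ S]
  [FiniteDimensional ℂ V] {D : PureSpinor m V S}

theorem toW_surjective : Function.Surjective D.toW := by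
  intro w
  induction w using TensorProduct.induction_on with
  | zero => exact ⟨0, map_zero _⟩
  | add x y hx hy =>
    obtain ⟨a, rfl⟩ := hx
    obtain ⟨b, rfl⟩ := hy
    exact ⟨a + b, map_add _ _ _⟩
  | tmul v q =>
    obtain ⟨φ, rfl⟩ := LieSubmodule.Quotient.surjective_mk' _ q
    exact ⟨v ⊗ₜ φ, rfl⟩

namespace Frame

variable (F : D.Frame)

theorem lo_toW_tmul (u : V) (φ : D.so) :
    F.lo (D.toW (u ⊗ₜ φ)) = fun p => D.g u (F.e p.1) * F.coord2 φ p.2 := rfl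

theorem hi_toW_tmul (u : V) (φ : D.so) :
    F.hi (D.toW (u ⊗ₜ φ)) = fun p => D.g u (F.f p.1) * F.coord2 φ p.2 := rfl

/-! #### The projection maps in coordinates -/

theorem xiXi_eq (φ : D.so) : D.xiXi φ =
    ∑ j, ∑ k, F.coord2 φ (j, k) • (D.xi (F.f j) ⊗ₜ[ℂ] D.xi (F.f k)) := by
  have : ∀ t : V ⊗[ℂ] V, TensorProduct.map D.xi D.xi t =
      ∑ j, ∑ k, D.g (tensorEquivEnd D.g D.nondeg t (F.e j)) (F.e k) •
        (D.xi (F.f j) ⊗ₜ[ℂ] D.xi (F.f k)) := by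
    intro t
    induction t with
    | zero => simp
    | add a b ha hb =>
      simp only [map_add, ha, hb, LinearMap.add_apply, add_smul, Finset.sum_add_distrib]
    | tmul x y =>
      rw [TensorProduct.map_tmul, F.xi_eq x, F.xi_eq y, TensorProduct.sum_tmul]
      refine Finset.sum_congr rfl fun i _ => ?_
      rw [TensorProduct.tmul_sum]
      refine Finset.sum_congr rfl fun j _ => ?_
      rw [TensorProduct.smul_tmul_smul, tensorEquivEnd_tmul]
      simp
  have h := this (D.twoForm φ)
  simp only [D.tensorEquivEnd_twoForm] at h
  exact h

theorem map_xi_xiXi (Γ : V ⊗[ℂ] D.so) : TensorProduct.map D.xi D.xiXi Γ =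
    Arr.tens (fun i => D.xi (F.f i)) (fun i => D.xi (F.f i)) (fun i => D.xi (F.f i))
      (F.lo (D.toW Γ)) := by
  induction Γ with
  | zero => simp
  | add a b ha hb => simp only [map_add, ha, hb]
  | tmul u φ =>
    rw [TensorProduct.map_tmul, F.xi_eq u, F.xiXi_eq, lo_toW_tmul]
    exact Arr.comb_bilinear (TensorProduct.mk ℂ S (S ⊗[ℂ] S)) _ _ _ _

theorem Pi30_eq_zero_iff (Γ : V ⊗[ℂ] D.so) : D.Pi30 Γ = 0 ↔ F.lo (D.toW Γ) ∈ Arr.hook := by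
  rw [← alt3_tens_eq_zero_iff F.linearIndependent_xi (F.lo_mem_skew _), ← F.map_xi_xiXi]
  rfl

theorem Pi31_eq_zero_iff (Γ : V ⊗[ℂ] D.so) : D.Pi31 Γ = 0 ↔ F.lo (D.toW Γ) ∈ Arr.totSkew := by
  rw [← symm12_tens_eq_zero_iff F.linearIndependent_xi (F.lo_mem_skew _), ← F.map_xi_xiXi]
  rfl

theorem cl_e_cl_f_xi (i j k : Fin m) : D.cl (F.e i) (D.cl (F.f k) (D.xi (F.f j))) =
    (if i = j then (2 : ℂ) else 0) • D.xi (F.f k) - (if i = k then (2 : ℂ) else 0) • D.xi (F.f j) := by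
  have h0 : D.cl (F.e i) D.ξ = 0 := F.e_mem i
  rw [D.cl_cl, D.xi_apply, D.xi_apply, D.cl_cl (F.e i) (F.f j), h0, map_zero, sub_zero, F.e_f,
    F.e_f, map_smul]
  split_ifs <;> simp
  abel

/-- The V_{1/2}-part of u annihilates ξ, so moving it through two Clifford factors leaves only
contractions, which add up to the trace of `hi`. The same κ occurs in both formulas, and this is
what lets it cancel later. -/
theorem cl_xi2_eq (u : V) (φ : D.so) : ∃ κ : ℂ,
    D.xi2 φ = ∑ j, ∑ k, F.coord2 φ (j, k) • D.cl (F.f k) (D.xi (F.f j)) + κ • D.ξ ∧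
    D.cl u (D.xi2 φ) = (4 : ℂ) • ∑ k, Arr.tr (F.hi (D.toW (u ⊗ₜ φ))) k • D.xi (F.f k)
      + Arr.comb (fun i j k => D.cl (F.f i) (D.cl (F.f k) (D.xi (F.f j)))) (F.lo (D.toW (u ⊗ₜ φ)))
      + κ • D.xi u := by
  obtain ⟨κ, hκ⟩ := F.xi2_eq φ
  refine ⟨κ, hκ, ?_⟩
  rw [hκ, map_add, map_smul, ← D.xi_apply]
  congr 1
  conv_lhs => rw [F.expand u]
  rw [map_add, LinearMap.add_apply, Arr.comb_bilinear D.cl, Arr.comb_bilinear D.cl,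
    ← lo_toW_tmul, ← hi_toW_tmul]
  simp only [cl_e_cl_f_xi]
  rw [Arr.comb_trace (F.hi_mem_skew _)]

theorem Pi10_tmul (u : V) (φ : D.so) :
    D.Pi10 (u ⊗ₜ φ) = D.ξ ⊗ₜ[ℂ] (D.cl u (D.xi2 φ)) - (D.xi2 φ) ⊗ₜ[ℂ] (D.xi u) := rfl

/-- The two terms of the projection are balanced so that the κ-contributions ξ ⊗ uξ cancel. The part
depending on `lo` needs no explicit form, since it is only evaluated at `lo` = 0. -/
theorem exists_Pi10_eq : ∃ E : Arr m →ₗ[ℂ] (S ⊗[ℂ] S), ∀ Γ, D.Pi10 Γ =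
    D.ξ ⊗ₜ[ℂ] ((4 : ℂ) • ∑ k, Arr.tr (F.hi (D.toW Γ)) k • D.xi (F.f k))
      + E (F.lo (D.toW Γ)) := by
  refine ⟨Arr.comb fun i j k => D.ξ ⊗ₜ D.cl (F.f i) (D.cl (F.f k) (D.xi (F.f j)))
    - D.cl (F.f k) (D.xi (F.f j)) ⊗ₜ D.xi (F.f i), fun Γ => ?_⟩
  induction Γ with
  | zero => simp
  | add a b ha hb =>
    rw [map_add, ha, hb]
    simp only [map_add, Pi.add_apply, add_smul, Finset.sum_add_distrib, smul_add,
      TensorProduct.tmul_add]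
    abel
  | tmul u φ =>
    obtain ⟨κ, h1, h2⟩ := F.cl_xi2_eq u φ
    rw [Pi10_tmul, h2, h1, TensorProduct.tmul_add, TensorProduct.tmul_add, add_assoc, add_sub_assoc]
    congr 1
    have e : (∑ j, ∑ k, F.coord2 φ (j, k) • D.cl (F.f k) (D.xi (F.f j))) ⊗ₜ[ℂ] D.xi u =
        Arr.comb (fun i j k => D.cl (F.f k) (D.xi (F.f j)) ⊗ₜ[ℂ] D.xi (F.f i))
          (F.lo (D.toW (u ⊗ₜ φ))) := by
      rw [F.xi_eq u, lo_toW_tmul]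
      exact Arr.comb_bilinear (TensorProduct.mk ℂ S S).flip _ _ _ _
    have e' : D.ξ ⊗ₜ[ℂ] Arr.comb (fun i j k => D.cl (F.f i) (D.cl (F.f k) (D.xi (F.f j))))
        (F.lo (D.toW (u ⊗ₜ φ))) = Arr.comb (fun i j k =>
          D.ξ ⊗ₜ[ℂ] D.cl (F.f i) (D.cl (F.f k) (D.xi (F.f j)))) (F.lo (D.toW (u ⊗ₜ φ))) :=
      Arr.map_comb (TensorProduct.mk ℂ S S D.ξ) _ _
    rw [TensorProduct.add_tmul, e, e', Arr.comb_sub, TensorProduct.tmul_smul,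
      TensorProduct.smul_tmul']
    abel

theorem Pi10_eq_zero_iff {Γ : V ⊗[ℂ] D.so} (h : F.lo (D.toW Γ) = 0) :
    D.Pi10 Γ = 0 ↔ F.hi (D.toW Γ) ∈ Arr.noTrace := by
  obtain ⟨E, hE⟩ := F.exists_Pi10_eq
  rw [hE, h, map_zero, add_zero]
  constructor
  · intro h0
    refine ⟨F.hi_mem_skew _, ?_⟩
    have hξ : LinearIndependent ℂ fun _ : Fin 1 => D.ξ :=
      LinearIndependent.of_subsingleton 0 D.ξ_ne_zero
    obtain ⟨c, hc⟩ := exists_dual_functionals hξ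
    have hc' : c 0 D.ξ = 1 := by simpa using hc 0 0
    have h1 := congrArg (TensorProduct.lid ℂ S ∘ TensorProduct.map (c 0) LinearMap.id) h0
    simp only [Function.comp_apply, TensorProduct.map_tmul, hc', TensorProduct.lid_tmul,
      one_smul, LinearMap.id_apply, map_zero] at h1
    have h2 := (smul_eq_zero.mp h1).resolve_left (by norm_num)
    exact funext (Fintype.linearIndependent_iff.mp F.linearIndependent_xi _ h2)
  · intro h0
    have h1 : Arr.tr (F.hi (D.toW Γ)) = 0 := h0.2
    simp [h1]

/-- Invariance is applied to the product e_j f_j with j ≠ i. On ξ it acts by the scalar -2, whereas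
in reversed order it kills f_i · ξ. -/
theorem spinForm_ξ_xi (F : D.Frame) (hm : 2 < m)
    {ε : LinearMap.BilinForm ℂ S} (hε : D.IsSpinForm ε) (u : V) :
    ε D.ξ (D.xi u) = 0 := by
  have h : ∀ i, ε D.ξ (D.xi (F.f i)) = 0 := by
    intro i
    obtain ⟨j, hj⟩ : ∃ j, j ≠ i := by
      by_cases hi : i = ⟨0, by omega⟩
      · exact ⟨⟨1, by omega⟩, by rw [hi]; simp⟩
      · exact ⟨_, Ne.symm hi⟩
    have h0 : D.cl (F.e j) D.ξ = 0 := F.e_mem j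
    have h1 := hε.2 (F.e j) (F.f j) D.ξ (D.xi (F.f i))
    rw [D.cl_cl, h0, map_zero, sub_zero, F.e_f, if_pos rfl, D.xi_apply,
      D.cl_cl (F.e j) (F.f i), h0, F.e_f, if_neg hj] at h1
    simpa [D.xi_apply] using h1
  rw [F.xi_eq u, map_sum]
  simp [h]

theorem mainTerm_apply (a : V) (Γ : V ⊗[ℂ] D.so) : D.mainTerm Γ a =
    Arr.comb (fun i j k => D.g (F.e i) a • (D.xi (F.f j) ⊗ₜ[ℂ] D.xi (F.f k))) (F.hi (D.toW Γ))
    + Arr.comb (fun i j k => D.g (F.f i) a • (D.xi (F.f j) ⊗ₜ[ℂ] D.xi (F.f k)))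
      (F.lo (D.toW Γ)) := by
  induction Γ with
  | zero => simp
  | add x y hx hy =>
    simp only [map_add, LinearMap.add_apply, hx, hy]
    abel
  | tmul u φ =>
    have e : D.mainTerm (u ⊗ₜ φ) a = D.g u a • D.xiXi φ := rfl
    have e' : D.g u a = ∑ i, D.g u (F.f i) * D.g (F.e i) a
        + ∑ i, D.g u (F.e i) * D.g (F.f i) a := by
      conv_lhs => rw [F.expand u]
      simp
    rw [e, e', F.xiXi_eq, add_smul, lo_toW_tmul, hi_toW_tmul]
    congr 1 <;> exact Arr.comb_bilinear (LinearMap.lsmul ℂ (S ⊗[ℂ] S)) _ _ _ _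

/-- The two summands contribute κ with opposite signs by skewness in the spinor indices, which is
the reason for the second summand. -/
theorem exists_traceTerm_eq (a : V) :
    ∃ E : Arr m →ₗ[ℂ] (S ⊗[ℂ] S), ∀ Γ, D.traceTerm Γ a = alt (D.xi a)
    ((4 : ℂ) • ∑ k, Arr.tr (F.hi (D.toW Γ)) k • D.xi (F.f k)) + E (F.lo (D.toW Γ)) := by
  refine ⟨Arr.comb fun i j k => alt (D.xi a) (D.cl (F.f i) (D.cl (F.f k) (D.xi (F.f j))))
    + alt (D.xi (F.f i)) (D.cl a (D.cl (F.f k) (D.xi (F.f j)))), fun Γ => ?_⟩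
  induction Γ with
  | zero => simp
  | add x y hx hy =>
    rw [map_add, LinearMap.add_apply, hx, hy]
    simp only [map_add, Pi.add_apply, add_smul, Finset.sum_add_distrib, smul_add]
    abel
  | tmul u φ =>
    obtain ⟨κ, h1, h2⟩ := F.cl_xi2_eq u φ
    have e : D.traceTerm (u ⊗ₜ φ) a = alt (D.xi a) (D.cl u (D.xi2 φ))
      + alt (D.xi u) (D.cl a (D.xi2 φ)) := rfl
    have e1 : alt (D.xi u) (D.cl a (D.xi2 φ)) =
        Arr.comb (fun i j k => alt (D.xi (F.f i)) (D.cl a (D.cl (F.f k) (D.xi (F.f j)))))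
          (F.lo (D.toW (u ⊗ₜ φ))) - κ • alt (D.xi a) (D.xi u) := by
      have e2 : alt (D.xi a) (D.xi u) = -alt (D.xi u) (D.xi a) := by
        rw [alt_apply, alt_apply]
        module
      rw [e2, h1, map_add, map_add, map_smul, map_smul, ← D.xi_apply, smul_neg, sub_neg_eq_add]
      congr 1
      rw [F.xi_eq u, lo_toW_tmul]
      exact Arr.comb_bilinear (alt.compl₂ (D.cl a)) _ _ _ _
    rw [e, e1, h2, map_add, map_add, map_smul (alt (D.xi a)) κ, Arr.comb_add, Arr.map_comb]
    abel

/-- By `spinForm_ξ_xi` the multiple of ξ in `xi2` pairs to zero. The scalar therefore depends on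
`lo` alone, and the correction for m = 3 vanishes on W^{-1/2}. -/
theorem exists_scalarTerm_eq (hm : 2 < m) {ε : LinearMap.BilinForm ℂ S}
    (hε : D.IsSpinForm ε) : ∃ E : Arr m →ₗ[ℂ] ℂ, ∀ Γ, D.scalarTerm ε Γ = E (F.lo (D.toW Γ)) := by
  refine ⟨Arr.comb fun i j k => ε (D.cl (F.f k) (D.xi (F.f j))) (D.xi (F.f i)), fun Γ => ?_⟩
  induction Γ with
  | zero => simp
  | add x y hx hy => simp only [map_add, hx, hy]
  | tmul u φ =>
    obtain ⟨κ, h1, h2⟩ := F.cl_xi2_eq u φ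
    have e : D.scalarTerm ε (u ⊗ₜ φ) = ε (D.xi2 φ) (D.xi u) := rfl
    rw [e, h1, map_add, LinearMap.add_apply, map_smul, LinearMap.smul_apply,
      F.spinForm_ξ_xi hm hε, smul_zero, add_zero, F.xi_eq u, lo_toW_tmul]
    exact Arr.comb_bilinear ε.flip _ _ _ _

variable [FiniteDimensional ℂ S]

theorem exists_Pi11_eq (hm : 2 < m) {ε : LinearMap.BilinForm ℂ S} (hε : D.IsSpinForm ε) (a : V) :
    ∃ E : Arr m →ₗ[ℂ] (S ⊗[ℂ] S), ∀ Γ, D.Pi11 ε hε Γ a =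
      Arr.comb (fun i j k => D.g (F.e i) a • (D.xi (F.f j) ⊗ₜ[ℂ] D.xi (F.f k))) (F.hi (D.toW Γ))
      - (1 / (2 * ((m : ℂ) - 1))) • alt (D.xi a)
        ((4 : ℂ) • ∑ k, Arr.tr (F.hi (D.toW Γ)) k • D.xi (F.f k))
      + E (F.lo (D.toW Γ)) := by
  obtain ⟨E1, hE1⟩ := F.exists_traceTerm_eq a
  obtain ⟨E2, hE2⟩ := F.exists_scalarTerm_eq hm hε
  refine ⟨Arr.comb (fun i j k => D.g (F.f i) a • (D.xi (F.f j) ⊗ₜ[ℂ] D.xi (F.f k)))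
    - (1 / (2 * ((m : ℂ) - 1))) • E1
    + (if m = 3 then (1 / 6 : ℂ) • E2.smulRight (D.gammaUp ε hε a) else 0), fun Γ => ?_⟩
  have e : D.Pi11 ε hε Γ a = D.mainTerm Γ a - (1 / (2 * ((m : ℂ) - 1))) • D.traceTerm Γ a
      + (if m = 3 then (1 / 6 : ℂ) • D.scalarTerm ε Γ • D.gammaUp ε hε a else 0) := by
    rw [Pi11]
    split_ifs <;> rfl
  have e' : (if m = 3 then (1 / 6 : ℂ) • E2.smulRight (D.gammaUp ε hε a) else 0)
      (F.lo (D.toW Γ)) = if m = 3 then (1 / 6 : ℂ) • E2 (F.lo (D.toW Γ)) • D.gammaUp ε hε a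
        else 0 := by
    split_ifs <;> rfl
  rw [e, F.mainTerm_apply, hE1, hE2, LinearMap.add_apply, e', LinearMap.sub_apply, LinearMap.smul_apply,
    smul_add]
  abel

/-- The factor 4 of the trace formula and the 1/2 in `alt` leave a 2 that cancels against 1/(2(m -
1)). What is subtracted from `hi` is therefore exactly its pure trace part. -/
theorem Pi11_apply_of_lo (hm : 2 < m) {ε : LinearMap.BilinForm ℂ S} (hε : D.IsSpinForm ε)
    {Γ : V ⊗[ℂ] D.so} (h : F.lo (D.toW Γ) = 0) (a : V) : D.Pi11 ε hε Γ a =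
      ∑ i, D.g (F.e i) a • ∑ j, ∑ k, (F.hi (D.toW Γ)
        - (1 / ((m : ℂ) - 1)) • Arr.pureTrace (Arr.tr (F.hi (D.toW Γ)))) (i, j, k) •
          (D.xi (F.f j) ⊗ₜ[ℂ] D.xi (F.f k)) := by
  obtain ⟨E, hE⟩ := F.exists_Pi11_eq hm hε a
  rw [hE, h, map_zero, add_zero]
  generalize F.hi (D.toW Γ) = T
  have hc : (1 / (2 * ((m : ℂ) - 1))) = (1 / 2) * (1 / ((m : ℂ) - 1)) := by
    rw [one_div_mul_one_div]
  rw [hc]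
  generalize 1 / ((m : ℂ) - 1) = c
  have e : alt (D.xi a) ((4 : ℂ) • ∑ k, Arr.tr T k • D.xi (F.f k)) = (2 : ℂ) •
      ∑ i, D.g (F.e i) a • ∑ j, ∑ k, Arr.pureTrace (Arr.tr T) (i, j, k) •
        (D.xi (F.f j) ⊗ₜ[ℂ] D.xi (F.f k)) := by
    have e1 : ∀ i, ∑ j, ∑ k, Arr.pureTrace (Arr.tr T) (i, j, k) •
        (D.xi (F.f j) ⊗ₜ[ℂ] D.xi (F.f k)) = D.xi (F.f i) ⊗ₜ (∑ k, Arr.tr T k • D.xi (F.f k))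
          - (∑ k, Arr.tr T k • D.xi (F.f k)) ⊗ₜ D.xi (F.f i) := by
      intro i
      simp only [Arr.pureTrace_apply, sub_smul, ite_smul, zero_smul, Finset.sum_sub_distrib,
        Finset.sum_ite_eq, Finset.mem_univ, if_true, TensorProduct.tmul_sum, TensorProduct.sum_tmul,
        TensorProduct.tmul_smul, TensorProduct.smul_tmul']
      rw [Finset.sum_comm]
      simp
    simp only [e1]
    generalize ∑ k, Arr.tr T k • D.xi (F.f k) = X
    rw [map_smul, alt_apply, F.xi_eq a, TensorProduct.sum_tmul, TensorProduct.tmul_sum]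
    simp only [smul_sub, Finset.sum_sub_distrib, D.g_comm a, TensorProduct.tmul_smul,
      ← TensorProduct.smul_tmul']
    module
  rw [e, smul_smul, Arr.comb_apply]
  simp only [Pi.sub_apply, Pi.smul_apply, smul_eq_mul, sub_smul, Finset.sum_sub_distrib, smul_sub,
    mul_smul, ← Finset.smul_sum]
  congr 1
  · simp only [Finset.smul_sum, smul_smul, mul_comm]
  · simp only [Finset.smul_sum, smul_smul]
    refine Finset.sum_congr rfl fun i _ => Finset.sum_congr rfl fun j _ =>
      Finset.sum_congr rfl fun k _ => ?_
    congr 1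
    ring

theorem Pi11_eq_zero_iff (hm : 2 < m) {ε : LinearMap.BilinForm ℂ S} (hε : D.IsSpinForm ε)
    {Γ : V ⊗[ℂ] D.so} (h : F.lo (D.toW Γ) = 0) :
    D.Pi11 ε hε Γ = 0 ↔ F.hi (D.toW Γ) ∈ Arr.traces := by
  rw [Arr.mem_traces_iff hm, ← sub_eq_zero (a := F.hi (D.toW Γ))]
  constructor
  · intro h0
    ext ⟨i, j, k⟩
    have h1 := F.Pi11_apply_of_lo hm hε h (F.f i)
    rw [h0] at h1
    simp only [F.e_f, ite_smul, one_smul, zero_smul, Finset.sum_ite_eq', Finset.mem_univ, if_true,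
      LinearMap.zero_apply] at h1
    exact eq_zero_of_sum_tmul F.linearIndependent_xi F.linearIndependent_xi h1.symm j k
  · intro h0
    ext a
    rw [F.Pi11_apply_of_lo hm hε h a, h0]
    simp

end Frame

end PureSpinor

/-! ### Modules described by arrays -/

/-- The linear map `c` identifies the `L`-module `X` with the space `Y` of arrays, on which `l ∈ L`
acts by `ρ (μ l)`. -/
structure IsCoord {m : ℕ} {L X : Type*} [LieRing L] [LieAlgebra ℂ L] [AddCommGroup X] [Module ℂ X]
    [LieRingModule L X] (μ : L → Matrix (Fin m) (Fin m) ℂ)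
    (ρ : Matrix (Fin m) (Fin m) ℂ → Module.End ℂ (Arr m)) (Y : Submodule ℂ (Arr m))
    (c : X →ₗ[ℂ] Arr m) : Prop where
  injective : Function.Injective c
  range : LinearMap.range c = Y
  lie : ∀ l x, c ⁅l, x⁆ = ρ (μ l) (c x)

namespace IsCoord

variable {m : ℕ} {L X X' : Type*} [LieRing L] [LieAlgebra ℂ L] [AddCommGroup X] [Module ℂ X]
  [LieRingModule L X] [AddCommGroup X'] [Module ℂ X'] [LieRingModule L X'] {μ : L → Matrix (Fin m) (Fin m) ℂ}
  {ρ : Matrix (Fin m) (Fin m) ℂ → Module.End ℂ (Arr m)} {Y : Submodule ℂ (Arr m)}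
  {c : X →ₗ[ℂ] Arr m} {c' : X' →ₗ[ℂ] Arr m}

theorem isIrreducible [LieModule ℂ L X] (h : IsCoord μ ρ Y c) (hY : IsSimpleUnder ρ Y)
    (hμ : Function.Surjective μ) : LieModule.IsIrreducible ℂ L X := by
  have : Nontrivial X := by
    by_contra hX
    rw [not_nontrivial_iff_subsingleton] at hX
    apply hY.1
    rw [← h.range, LinearMap.range_eq_bot]
    exact LinearMap.ext fun x => by rw [Subsingleton.elim x 0, map_zero, map_zero]
  refine LieModule.IsIrreducible.mk fun N hN => ?_
  have hU := hY.2 (Submodule.map c N) (by rw [← h.range]; exact LinearMap.map_le_range) ?_ ?_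
  · rw [eq_top_iff]
    intro x _
    have hx : c x ∈ Submodule.map c (N : Submodule ℂ X) := by
      rw [hU, ← h.range]
      exact ⟨x, rfl⟩
    obtain ⟨y, hy, hyx⟩ := hx
    exact h.injective hyx ▸ hy
  · rintro A _ ⟨x, hx, rfl⟩
    obtain ⟨l, rfl⟩ := hμ A
    exact ⟨⁅l, x⁆, N.lie_mem hx, h.lie l x⟩
  · intro h0
    apply hN
    rw [Submodule.eq_bot_iff] at h0
    rw [LieSubmodule.eq_bot_iff]
    intro x hx
    exact h.injective (by rw [map_zero]; exact h0 _ ⟨x, hx, rfl⟩)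

theorem finrank_eq (h : IsCoord μ ρ Y c) : Module.finrank ℂ X = Module.finrank ℂ Y := by
  rw [← h.range, LinearMap.finrank_range_of_inj h.injective]

theorem nonempty_equiv (h : IsCoord μ ρ Y c) (h' : IsCoord μ ρ Y c') :
    Nonempty (X ≃ₗ⁅ℂ, L⁆ X') := by
  have hex : ∀ x, ∃ x', c' x' = c x := fun x => by
    have : c x ∈ LinearMap.range c' := by
      rw [h'.range, ← h.range]
      exact ⟨x, rfl⟩
    exact this
  have hex' : ∀ x', ∃ x, c x = c' x' := fun x' => by
    have : c' x' ∈ LinearMap.range c := by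
      rw [h.range, ← h'.range]
      exact ⟨x', rfl⟩
    exact this
  choose f hf using hex
  choose g hg using hex'
  exact ⟨{ toFun := f
           map_add' := fun x y => h'.injective (by simp [hf])
           map_smul' := fun r x => h'.injective (by simp [hf])
           map_lie' := fun {l x} => h'.injective (by
             rw [hf, h.lie, h'.lie, hf])
           invFun := g
           left_inv := fun x => h.injective (by rw [hg]; exact hf x)
           right_inv := fun x => h'.injective (by rw [hf, hg]) }⟩

theorem comp_equiv (h : IsCoord μ ρ Y c) (e : X' ≃ₗ⁅ℂ, L⁆ X) :
    IsCoord μ ρ Y (c ∘ₗ (e : X' →ₗ[ℂ] X)) where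
  injective := h.injective.comp e.injective
  range := by
    rw [← h.range]
    refine LinearMap.range_comp_of_range_eq_top _ ?_
    exact LinearMap.range_eq_top.mpr e.surjective
  lie l x := by
    change c (e ⁅l, x⁆) = ρ (μ l) (c (e x))
    rw [← h.lie]
    congr 1
    exact LieModuleHom.map_lie e.toLieModuleHom l x

end IsCoord

namespace PureSpinor

variable {m : ℕ} {V S : Type*} [AddCommGroup V] [Module ℂ V] [AddCommGroup S] [Module ℂ S]
  [FiniteDimensional ℂ V] {D : PureSpinor m V S}

namespace Frame

variable (F : D.Frame)

/-- The complement of `V_{1/2}` spanned by the vectors `f`. -/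
abbrev compl : Submodule ℂ V := Submodule.span ℂ (Set.range F.f)

theorem matA_surjective : Function.Surjective F.matA := fun A => by
  obtain ⟨φ, h, -⟩ := F.exists_par A 0 (by simp)
  exact ⟨φ, h⟩

theorem matA_g0_surjective :
    Function.Surjective fun φ : D.g0 F.compl => F.matA (φ : D.par) := fun A => by
  obtain ⟨φ, h, h'⟩ := F.exists_par A 0 (by simp)
  exact ⟨⟨φ, F.mem_g0_iff.mpr h'⟩, h⟩

theorem isCoord_g0 {X : Type*} [AddCommGroup X] [Module ℂ X] [LieRingModule D.par X]
    {ρ : Matrix (Fin m) (Fin m) ℂ → Module.End ℂ (Arr m)} {Y : Submodule ℂ (Arr m)}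
    {c : X →ₗ[ℂ] Arr m} (h : IsCoord F.matA ρ Y c) :
    IsCoord (fun φ : D.g0 F.compl => F.matA (φ : D.par)) ρ Y c :=
  ⟨h.injective, h.range, fun φ x => h.lie φ x⟩

theorem isIrreducible_g0 {X : Type*} [AddCommGroup X] [Module ℂ X] [LieRingModule D.par X]
    [LieModule ℂ D.par X] {ρ : Matrix (Fin m) (Fin m) ℂ → Module.End ℂ (Arr m)}
    {Y : Submodule ℂ (Arr m)} {c : X →ₗ[ℂ] Arr m} (h : IsCoord F.matA ρ Y c)
    (hY : IsSimpleUnder ρ Y) : LieModule.IsIrreducible ℂ (D.g0 F.compl) X :=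
  (F.isCoord_g0 h).isIrreducible hY F.matA_g0_surjective

/-! #### The graded pieces -/

/-- The components of an element of `gr_{-1/2}(W)`. -/
def hiHalf : D.grHalf →ₗ[ℂ] Arr m := F.hi ∘ₗ (D.Whalf : Submodule ℂ D.W).subtype

theorem hiHalf_apply (x : D.grHalf) : F.hiHalf x = F.hi (x : D.W) := rfl

theorem lo_grHalf (x : D.grHalf) : F.lo (x : D.W) = 0 := F.mem_Whalf_iff.mp x.2

theorem isCoord_hiHalf : IsCoord F.matA Arr.act1 Arr.skew F.hiHalf where
  injective := by
    rw [injective_iff_map_eq_zero]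
    exact fun x hx => Subtype.ext (F.eq_zero_of_lo_hi (F.lo_grHalf x) hx)
  range := by
    apply le_antisymm
    · rintro _ ⟨x, rfl⟩
      exact F.hi_mem_skew _
    · intro T hT
      obtain ⟨w, h1, h2⟩ := F.exists_lo_hi_eq (Submodule.zero_mem Arr.skew) hT
      exact ⟨⟨w, F.mem_Whalf_iff.mpr h1⟩, h2⟩
  lie φ x := by
    change F.hi ⁅φ, (x : D.W)⁆ = _
    rw [F.hi_lie, F.lo_grHalf, map_zero, add_zero, hiHalf_apply]

/-- The components of an element of `gr_{-3/2}(W)`. -/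
def loQuot : D.grThreeHalf →ₗ[ℂ] Arr m :=
  (D.Whalf : Submodule ℂ D.W).liftQ F.lo fun _ h => F.mem_Whalf_iff.mp h

theorem isCoord_loQuot : IsCoord F.matA Arr.act3 Arr.skew F.loQuot where
  injective := by
    rw [injective_iff_map_eq_zero]
    intro x hx
    obtain ⟨w, rfl⟩ := LieSubmodule.Quotient.surjective_mk' _ x
    exact (LieSubmodule.Quotient.mk_eq_zero' (N := D.Whalf)).mpr (F.mem_Whalf_iff.mpr hx)
  range := by
    apply le_antisymm
    · rintro _ ⟨x, rfl⟩
      obtain ⟨w, rfl⟩ := LieSubmodule.Quotient.surjective_mk' _ x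
      exact F.lo_mem_skew w
    · intro T hT
      obtain ⟨w, h1, h2⟩ := F.exists_lo_hi_eq hT (Submodule.zero_mem Arr.skew)
      exact ⟨LieSubmodule.Quotient.mk w, h1⟩
  lie φ x := by
    obtain ⟨w, rfl⟩ := LieSubmodule.Quotient.surjective_mk' _ x
    exact F.lo_lie φ w

section Sub

/-- The restriction of a linear map to a submodule. -/
def restr {L X : Type*} [LieRing L] [AddCommGroup X] [Module ℂ X] [LieRingModule L X]
    (c : X →ₗ[ℂ] Arr m) (N : LieSubmodule ℂ L X) : N →ₗ[ℂ] Arr m :=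
  c ∘ₗ (N : Submodule ℂ X).subtype

variable {X : Type*} [AddCommGroup X] [Module ℂ X] [LieRingModule D.par X]
  {ρ : Matrix (Fin m) (Fin m) ℂ → Module.End ℂ (Arr m)} {K Y Z : Submodule ℂ (Arr m)}
  {c : X →ₗ[ℂ] Arr m}

variable {F} in
/-- The submodule of `X` corresponding to a stable space of arrays. -/
def sub (h : IsCoord F.matA ρ K c) (sY : ∀ A, ∀ T ∈ Y, ρ A T ∈ Y) : LieSubmodule ℂ D.par X where
  __ := Y.comap c
  lie_mem := by
    intro φ x hx
    change c ⁅φ, x⁆ ∈ Y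
    rw [h.lie]
    exact sY _ _ hx

variable {F} in
theorem isCompl_sub (h : IsCoord F.matA ρ K c) (sY : ∀ A, ∀ T ∈ Y, ρ A T ∈ Y)
    (sZ : ∀ A, ∀ T ∈ Z, ρ A T ∈ Z) (h1 : Y ⊓ Z = ⊥) (h2 : Y ⊔ Z = K) :
    IsCompl (sub h sY) (sub h sZ) := by
  constructor
  · rw [disjoint_iff, LieSubmodule.eq_bot_iff]
    intro x hx
    rw [LieSubmodule.mem_inf] at hx
    have : c x ∈ Y ⊓ Z := ⟨hx.1, hx.2⟩
    rw [h1, Submodule.mem_bot] at this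
    exact h.injective (by rw [this, map_zero])
  · rw [codisjoint_iff, eq_top_iff]
    intro x _
    have hx : c x ∈ Y ⊔ Z := by rw [h2, ← h.range]; exact ⟨x, rfl⟩
    obtain ⟨y, hy, z, hz, hyz⟩ := Submodule.mem_sup.mp hx
    have hy' : y ∈ LinearMap.range c := by rw [h.range, ← h2]; exact Submodule.mem_sup_left hy
    have hz' : z ∈ LinearMap.range c := by rw [h.range, ← h2]; exact Submodule.mem_sup_right hz
    obtain ⟨y, rfl⟩ := hy'
    obtain ⟨z, rfl⟩ := hz'
    rw [← map_add] at hyz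
    rw [← h.injective hyz, LieSubmodule.mem_sup]
    exact ⟨y, hy, z, hz, rfl⟩

variable {F} in
theorem isCoord_sub (h : IsCoord F.matA ρ K c) (sY : ∀ A, ∀ T ∈ Y, ρ A T ∈ Y) (hY : Y ≤ K) :
    IsCoord F.matA ρ Y (restr c (sub h sY)) where
  injective := h.injective.comp Subtype.val_injective
  range := by
    apply le_antisymm
    · rintro _ ⟨x, rfl⟩
      exact x.2
    · intro T hT
      have hT' : T ∈ LinearMap.range c := by rw [h.range]; exact hY hT
      obtain ⟨x, rfl⟩ := hT'
      exact ⟨⟨x, hT⟩, rfl⟩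
  lie φ x := h.lie φ (x : X)

end Sub

/-- `W_{-1/2}^0`. -/
def W10 : LieSubmodule ℂ D.par D.grHalf := sub F.isCoord_hiHalf Arr.act1_mem_traces

/-- `W_{-1/2}^1`. -/
def W11 : LieSubmodule ℂ D.par D.grHalf := sub F.isCoord_hiHalf Arr.act1_mem_noTrace

/-- `W_{-3/2}^0`. -/
def W30 : LieSubmodule ℂ D.par D.grThreeHalf := sub F.isCoord_loQuot Arr.act3_mem_totSkew

/-- `W_{-3/2}^1`. -/
def W31 : LieSubmodule ℂ D.par D.grThreeHalf := sub F.isCoord_loQuot Arr.act3_mem_hook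

theorem isCoord_W10 :
    IsCoord F.matA Arr.act1 Arr.traces (restr F.hiHalf F.W10) :=
  isCoord_sub F.isCoord_hiHalf Arr.act1_mem_traces Arr.traces_le

theorem isCoord_W11 :
    IsCoord F.matA Arr.act1 Arr.noTrace (restr F.hiHalf F.W11) :=
  isCoord_sub F.isCoord_hiHalf Arr.act1_mem_noTrace inf_le_left

theorem isCoord_W30 :
    IsCoord F.matA Arr.act3 Arr.totSkew
      (restr F.loQuot F.W30) :=
  isCoord_sub F.isCoord_loQuot Arr.act3_mem_totSkew fun _ h => h.1

theorem isCoord_W31 :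
    IsCoord F.matA Arr.act3 Arr.hook (restr F.loQuot F.W31) :=
  isCoord_sub F.isCoord_loQuot Arr.act3_mem_hook fun _ h => h.1

theorem isCompl_W1 (hm : 2 < m) : IsCompl F.W10 F.W11 :=
  isCompl_sub F.isCoord_hiHalf _ _ (Arr.isCompl_noTrace hm).1 (Arr.isCompl_noTrace hm).2

theorem isCompl_W3 : IsCompl F.W30 F.W31 :=
  isCompl_sub F.isCoord_loQuot _ _ Arr.isCompl_hook.1 Arr.isCompl_hook.2

/-! #### The description by projection maps -/

theorem mk_mem_W30_iff (Γ : V ⊗[ℂ] D.so) :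
    (LieSubmodule.Quotient.mk (D.toW Γ) : D.grThreeHalf) ∈ F.W30 ↔ D.Pi31 Γ = 0 :=
  (F.Pi31_eq_zero_iff Γ).symm

theorem mk_mem_W31_iff (Γ : V ⊗[ℂ] D.so) :
    (LieSubmodule.Quotient.mk (D.toW Γ) : D.grThreeHalf) ∈ F.W31 ↔ D.Pi30 Γ = 0 :=
  (F.Pi30_eq_zero_iff Γ).symm

theorem mem_W11_iff (Γ : V ⊗[ℂ] D.so) (h : D.toW Γ ∈ D.Whalf) :
    (⟨D.toW Γ, h⟩ : D.grHalf) ∈ F.W11 ↔ D.Pi10 Γ = 0 :=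
  (F.Pi10_eq_zero_iff (F.mem_Whalf_iff.mp h)).symm

/-- Every class comes from some Γ, and membership is equivalent to the vanishing of a map defined
without a frame. The analogous lemmas for the other three submodules hold for the same reason. -/
theorem W30_eq (F F' : D.Frame) : F.W30 = F'.W30 := by
  ext x
  obtain ⟨w, rfl⟩ := LieSubmodule.Quotient.surjective_mk' _ x
  obtain ⟨Γ, rfl⟩ := D.toW_surjective w
  exact (F.mk_mem_W30_iff Γ).trans (F'.mk_mem_W30_iff Γ).symm

theorem W31_eq (F F' : D.Frame) : F.W31 = F'.W31 := by
  ext x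
  obtain ⟨w, rfl⟩ := LieSubmodule.Quotient.surjective_mk' _ x
  obtain ⟨Γ, rfl⟩ := D.toW_surjective w
  exact (F.mk_mem_W31_iff Γ).trans (F'.mk_mem_W31_iff Γ).symm

theorem W11_eq (F F' : D.Frame) : F.W11 = F'.W11 := by
  ext x
  obtain ⟨w, hw⟩ := x
  obtain ⟨Γ, rfl⟩ := D.toW_surjective w
  exact (F.mem_W11_iff Γ hw).trans (F'.mem_W11_iff Γ hw).symm

section SpinForm

variable [FiniteDimensional ℂ S] {ε : LinearMap.BilinForm ℂ S}

theorem mem_W10_iff (hm : 2 < m) (hε : D.IsSpinForm ε) (Γ : V ⊗[ℂ] D.so) (h : D.toW Γ ∈ D.Whalf) :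
    (⟨D.toW Γ, h⟩ : D.grHalf) ∈ F.W10 ↔ D.Pi11 ε hε Γ = 0 :=
  (F.Pi11_eq_zero_iff hm hε (F.mem_Whalf_iff.mp h)).symm

theorem W10_eq (F F' : D.Frame) (hm : 2 < m) (hε : D.IsSpinForm ε) : F.W10 = F'.W10 := by
  ext x
  obtain ⟨w, hw⟩ := x
  obtain ⟨Γ, rfl⟩ := D.toW_surjective w
  exact (F.mem_W10_iff hm hε Γ hw).trans (F'.mem_W10_iff hm hε Γ hw).symm

end SpinForm

/-! #### Highest weights -/

/-- U is dual to V_{1/2}, so the action on it is the negative transpose. Upper triangular matrices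
on V_{1/2} become lower triangular ones, and the weights change sign. -/
theorem matA_of_matrix {φ : D.par} {A : Matrix (Fin m) (Fin m) ℂ}
    (h : ∀ j, ⁅φ, (F.e j : V)⁆ = ∑ i, A i j • (F.e i : V)) (i j : Fin m) :
    F.matA φ i j = -A j i := by
  rw [matA, Matrix.of_apply, h]
  simp [F.e_f]

theorem hasDynkinLabels_of_isCoord {X : Type*} [AddCommGroup X] [Module ℂ X]
    [LieRingModule D.par X] {ρ : Matrix (Fin m) (Fin m) ℂ → Module.End ℂ (Arr m)}
    {Y : Submodule ℂ (Arr m)} {c : X →ₗ[ℂ] Arr m} (h : IsCoord F.matA ρ Y c) {a : ℕ → ℤ}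
    (l : ℕ → ℤ) (h1 : ∀ k, 1 ≤ k → k < m → l k - l (k + 1) = a k) (h2 : l (m - 1) + l m = a m)
    {T : Arr m} (hT : T ∈ Y) (h0 : T ≠ 0)
    (hρ : ∀ A : Matrix (Fin m) (Fin m) ℂ, (∀ i j, i < j → A i j = 0) →
      ρ A T = (-∑ k : Fin m, (l (k + 1) : ℂ) * A k k) • T) : D.HasDynkinLabels X F.e a := by
  have hT' : T ∈ LinearMap.range c := by rw [h.range]; exact hT
  obtain ⟨x, rfl⟩ := hT'
  refine ⟨l, h1, h2, x, fun hx => h0 (by rw [hx, map_zero]), fun φ A hA ht => ?_⟩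
  apply h.injective
  rw [h.lie, hρ, map_smul]
  · simp only [F.matA_of_matrix hA, mul_neg, Finset.sum_neg_distrib, neg_neg]
  · intro i j hij
    rw [F.matA_of_matrix hA, ht j i hij, neg_zero]

end Frame

end PureSpinor

/-! ### Model tensor spaces as modules over the reductive part. -/

section TensorLie

variable {m : ℕ} {U : Type*} [AddCommGroup U] [Module ℂ U]

theorem Arr.comb_slot1 (v : Fin m → Fin m → Fin m → U) (A : Matrix (Fin m) (Fin m) ℂ)
    (T : Arr m) : Arr.comb v (Arr.slot1 A T) = Arr.comb (fun i j k => ∑ l, A l i • v l j k) T := by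
  simp only [comb_apply, slot1_apply, Finset.sum_smul, Finset.smul_sum, smul_smul]
  have h : ∀ (G : Fin m → Fin m → Fin m → Fin m → U) (i : Fin m), ∑ j, ∑ k, ∑ l, G i j k l =
      ∑ l, ∑ j, ∑ k, G i j k l := fun G i => by
    rw [Finset.sum_comm (γ := Fin m) (f := fun l j => ∑ k, G i j k l)]
    exact Finset.sum_congr rfl fun j _ => Finset.sum_comm
  simp only [h fun i j k l => (A i l * T (l, j, k)) • v i j k,
    h fun i j k l => (T (i, j, k) * A l i) • v l j k]
  rw [Finset.sum_comm]
  simp only [mul_comm]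

theorem Arr.comb_slot2 (v : Fin m → Fin m → Fin m → U) (A : Matrix (Fin m) (Fin m) ℂ)
    (T : Arr m) : Arr.comb v (Arr.slot2 A T) = Arr.comb (fun i j k => ∑ l, A l j • v i l k) T := by
  simp only [comb_apply, slot2_apply, Finset.sum_smul, Finset.smul_sum, smul_smul]
  refine Finset.sum_congr rfl fun i _ => ?_
  have h : ∀ (G : Fin m → Fin m → Fin m → U) (j : Fin m), ∑ k, ∑ l, G j k l =
      ∑ l, ∑ k, G j k l := fun G j => Finset.sum_comm
  simp only [h fun j k l => (A j l * T (i, l, k)) • v i j k,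
    h fun j k l => (T (i, j, k) * A l j) • v i l k]
  rw [Finset.sum_comm]
  simp only [mul_comm]

theorem Arr.comb_slot3 (v : Fin m → Fin m → Fin m → U) (A : Matrix (Fin m) (Fin m) ℂ)
    (T : Arr m) : Arr.comb v (Arr.slot3 A T) = Arr.comb (fun i j k => ∑ l, A l k • v i j l) T := by
  simp only [comb_apply, slot3_apply, Finset.sum_smul, Finset.smul_sum, smul_smul]
  refine Finset.sum_congr rfl fun i _ => Finset.sum_congr rfl fun j _ => ?_
  rw [Finset.sum_comm]
  simp only [mul_comm]

theorem Arr.lie_tens {L : Type*} [LieRing L] [LieAlgebra ℂ L] [LieRingModule L U]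
    [LieModule ℂ L U] {l : L} {a b c : Fin m → U} {α β γ : Matrix (Fin m) (Fin m) ℂ}
    (ha : ∀ i, ⁅l, a i⁆ = ∑ j, α j i • a j) (hb : ∀ i, ⁅l, b i⁆ = ∑ j, β j i • b j)
    (hc : ∀ i, ⁅l, c i⁆ = ∑ j, γ j i • c j) (T : Arr m) :
    ⁅l, Arr.tens a b c T⁆ =
      Arr.tens a b c (Arr.slot1 α T + Arr.slot2 β T + Arr.slot3 γ T) := by
  rw [map_add, map_add]
  simp only [Arr.tens, Arr.comb_slot1, Arr.comb_slot2, Arr.comb_slot3, ← Arr.comb_add]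
  rw [← LieModule.toEnd_apply_apply ℂ L, Arr.map_comb]
  congr 2
  funext i j k
  rw [LieModule.toEnd_apply_apply, TensorProduct.LieModule.lie_tmul_right,
    TensorProduct.LieModule.lie_tmul_right, ha, hb, hc]
  simp only [TensorProduct.sum_tmul, TensorProduct.tmul_sum, TensorProduct.tmul_add,
    ← TensorProduct.smul_tmul', TensorProduct.tmul_smul, add_assoc]

theorem Arr.tens_mem_ker_swap23 {a b : Fin m → U} (ha : LinearIndependent ℂ a) (hb : LinearIndependent ℂ b)
    (T : Arr m) : Arr.tens a b b T ∈ LinearMap.ker (swap23 + LinearMap.id) ↔ T ∈ Arr.skew := by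
  rw [LinearMap.mem_ker, LinearMap.add_apply, swap23_tens, LinearMap.id_apply, ← map_add,
    map_eq_zero_iff _ (Arr.tens_injective ha hb hb)]
  constructor
  · intro h i j k
    have := congrFun h (i, j, k)
    simp only [Pi.add_apply, Pi.zero_apply] at this
    linear_combination this
  · intro h
    ext ⟨i, j, k⟩
    simp [h i j k]

theorem contract12_tens (B : LinearMap.BilinForm ℂ U) {a b : Fin m → U}
    (h : ∀ i j, B (a i) (b j) = if i = j then 1 else 0) (c : Fin m → U) (T : Arr m) :
    contract12 B (Arr.tens a b c T) = ∑ k, Arr.tr T k • c k := by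
  have e : ∀ i j k, contract12 B (a i ⊗ₜ (b j ⊗ₜ c k)) = (if i = j then (1 : ℂ) else 0) • c k :=
    fun i j k => by rw [← h]; simp [contract12]
  rw [Arr.tens, Arr.map_comb, Arr.comb_apply]
  simp only [e, ite_smul, one_smul, smul_ite, smul_zero, zero_smul, Arr.tr_apply,
    Finset.sum_smul]
  rw [Finset.sum_comm (γ := Fin m) (f := fun k i => T (i, i, k) • c k)]
  refine Finset.sum_congr rfl fun i _ => ?_
  rw [Finset.sum_comm]
  simp

theorem PureSpinor.tensor3_span (a b c : Fin m → U) :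
    PureSpinor.tensor3 (Submodule.span ℂ (Set.range a)) (Submodule.span ℂ (Set.range b))
      (Submodule.span ℂ (Set.range c)) = LinearMap.range (Arr.tens a b c) := by
  apply le_antisymm
  · rintro _ ⟨t, rfl⟩
    induction t using TensorProduct.induction_on with
    | zero => simp
    | add s t hs ht => rw [map_add]; exact Submodule.add_mem _ hs ht
    | tmul x t =>
      induction t using TensorProduct.induction_on with
      | zero => simp
      | add s t hs ht => rw [TensorProduct.tmul_add, map_add]; exact Submodule.add_mem _ hs ht
      | tmul y z =>
        obtain ⟨x, hx⟩ := x
        obtain ⟨y, hy⟩ := y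
        obtain ⟨z, hz⟩ := z
        obtain ⟨p, rfl⟩ := (Submodule.mem_span_range_iff_exists_fun ℂ).mp hx
        obtain ⟨q, rfl⟩ := (Submodule.mem_span_range_iff_exists_fun ℂ).mp hy
        obtain ⟨r, rfl⟩ := (Submodule.mem_span_range_iff_exists_fun ℂ).mp hz
        refine ⟨fun t => p t.1 * (q t.2.1 * r t.2.2), ?_⟩
        change _ = (∑ i, p i • a i) ⊗ₜ[ℂ] ((∑ j, q j • b j) ⊗ₜ[ℂ] ∑ k, r k • c k)
        rw [Arr.tens, Arr.comb_apply, TensorProduct.sum_tmul]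
        refine Finset.sum_congr rfl fun i _ => ?_
        rw [TensorProduct.sum_tmul, TensorProduct.tmul_sum]
        refine Finset.sum_congr rfl fun j _ => ?_
        rw [TensorProduct.tmul_sum, TensorProduct.tmul_sum]
        refine Finset.sum_congr rfl fun k _ => ?_
        rw [TensorProduct.smul_tmul_smul, TensorProduct.smul_tmul_smul]
  · rintro _ ⟨T, rfl⟩
    rw [Arr.tens, Arr.comb_apply]
    refine Submodule.sum_mem _ fun i _ => Submodule.sum_mem _ fun j _ =>
      Submodule.sum_mem _ fun k _ => Submodule.smul_mem _ _ ?_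
    exact ⟨⟨a i, Submodule.subset_span ⟨i, rfl⟩⟩ ⊗ₜ (⟨b j, Submodule.subset_span ⟨j, rfl⟩⟩ ⊗ₜ
      ⟨c k, Submodule.subset_span ⟨k, rfl⟩⟩), rfl⟩

end TensorLie

namespace PureSpinor

variable {m : ℕ} {V S : Type*} [AddCommGroup V] [Module ℂ V] [AddCommGroup S] [Module ℂ S]
  [FiniteDimensional ℂ V] {D : PureSpinor m V S}

namespace Frame

variable (F : D.Frame)

theorem span_e : Submodule.span ℂ (Set.range fun i => (F.e i : V)) = D.alphaPlane := by
  have := congrArg (Submodule.map (D.alphaPlane : Submodule ℂ V).subtype) F.e.span_eq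
  rw [Submodule.map_span, ← Set.range_comp, Submodule.map_top, Submodule.range_subtype] at this
  exact this

theorem linearIndependent_e : LinearIndependent ℂ fun i => (F.e i : V) :=
  F.linearIndependent.comp Sum.inl Sum.inl_injective

theorem linearIndependent_f : LinearIndependent ℂ F.f :=
  F.linearIndependent.comp Sum.inr Sum.inr_injective

theorem lie_e' (φ : D.par) (i : Fin m) :
    ⁅φ, (F.e i : V)⁆ = ∑ j, (-F.matA φ).transpose j i • (F.e j : V) := F.lie_e φ i

theorem lie_f_of_matR {φ : D.par} (h : F.matR φ = 0) (i : Fin m) :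
    ⁅φ, F.f i⁆ = ∑ j, F.matA φ j i • F.f j := by
  rw [F.lie_f, h]
  simp

theorem tensor3_f : tensor3 F.compl F.compl F.compl = LinearMap.range (Arr.tens F.f F.f F.f) :=
  tensor3_span _ _ _

theorem tensor3_e_f : tensor3 (D.alphaPlane : Submodule ℂ V) F.compl F.compl =
    LinearMap.range (Arr.tens (fun i => (F.e i : V)) F.f F.f) := by
  rw [← tensor3_span, F.span_e]

theorem lie_tens_f {φ : D.par} (h : F.matR φ = 0) (T : Arr m) :
    ⁅φ, Arr.tens F.f F.f F.f T⁆ = Arr.tens F.f F.f F.f (Arr.act3 (F.matA φ) T) :=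
  Arr.lie_tens (F.lie_f_of_matR h) (F.lie_f_of_matR h) (F.lie_f_of_matR h) T

theorem lie_tens_e_f {φ : D.par} (h : F.matR φ = 0) (T : Arr m) :
    ⁅φ, Arr.tens (fun i => (F.e i : V)) F.f F.f T⁆ =
      Arr.tens (fun i => (F.e i : V)) F.f F.f (Arr.act1 (F.matA φ) T) := by
  refine (Arr.lie_tens (F.lie_e' φ) (F.lie_f_of_matR h) (F.lie_f_of_matR h) T).trans ?_
  congr 1
  ext ⟨i, j, k⟩
  simp [Arr.act1, Arr.slot1_apply]

theorem wedge3_eq : wedge3 F.compl = Submodule.map (Arr.tens F.f F.f F.f) Arr.totSkew := by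
  have key : ∀ T, Arr.tens F.f F.f F.f T ∈ LinearMap.ker (swap12 + LinearMap.id) ↔
      ∀ i j k, T (j, i, k) = -T (i, j, k) := fun T => by
    rw [LinearMap.mem_ker, LinearMap.add_apply, swap12_tens, LinearMap.id_apply, ← map_add,
      map_eq_zero_iff _ (Arr.tens_injective F.linearIndependent_f F.linearIndependent_f
        F.linearIndependent_f)]
    constructor
    · intro h i j k
      have := congrFun h (i, j, k)
      simp only [Pi.add_apply, Pi.zero_apply] at this
      linear_combination this
    · intro h
      ext ⟨i, j, k⟩
      simp [h i j k]
  rw [wedge3, F.tensor3_f]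
  ext t
  constructor
  · rintro ⟨⟨⟨T, rfl⟩, h1⟩, h2⟩
    exact ⟨T, ⟨(Arr.tens_mem_ker_swap23 F.linearIndependent_f F.linearIndependent_f T).mp h2,
      (key T).mp h1⟩, rfl⟩
  · rintro ⟨T, hT, rfl⟩
    exact ⟨⟨⟨T, rfl⟩, (key T).mpr hT.2⟩,
      (Arr.tens_mem_ker_swap23 F.linearIndependent_f F.linearIndependent_f T).mpr hT.1⟩

theorem cartan_eq : cartan F.compl = Submodule.map (Arr.tens F.f F.f F.f) Arr.hook := by
  rw [cartan, F.tensor3_f]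
  ext t
  constructor
  · rintro ⟨⟨⟨T, rfl⟩, h1⟩, h2⟩
    exact ⟨T, (alt3_tens_eq_zero_iff F.linearIndependent_f
      ((Arr.tens_mem_ker_swap23 F.linearIndependent_f F.linearIndependent_f T).mp h1)).mp h2, rfl⟩
  · rintro ⟨T, hT, rfl⟩
    exact ⟨⟨⟨T, rfl⟩, (Arr.tens_mem_ker_swap23 F.linearIndependent_f F.linearIndependent_f T).mpr hT.1⟩,
      (alt3_tens_eq_zero_iff F.linearIndependent_f hT.1).mpr hT⟩

theorem traceFree_eq : D.traceFree F.compl =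
    Submodule.map (Arr.tens (fun i => (F.e i : V)) F.f F.f) Arr.noTrace := by
  have key : ∀ T, Arr.tens (fun i => (F.e i : V)) F.f F.f T ∈ LinearMap.ker (contract12 D.g) ↔
      Arr.tr T = 0 := fun T => by
    rw [LinearMap.mem_ker, contract12_tens D.g F.e_f]
    constructor
    · exact fun h => funext (Fintype.linearIndependent_iff.mp F.linearIndependent_f _ h)
    · intro h
      simp [h]
  rw [traceFree, F.tensor3_e_f]
  ext t
  constructor
  · rintro ⟨⟨⟨T, rfl⟩, h1⟩, h2⟩
    exact ⟨T, ⟨(Arr.tens_mem_ker_swap23 F.linearIndependent_e F.linearIndependent_f T).mp h1,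
      (key T).mp h2⟩, rfl⟩
  · rintro ⟨T, hT, rfl⟩
    exact ⟨⟨⟨T, rfl⟩, (Arr.tens_mem_ker_swap23 F.linearIndependent_e F.linearIndependent_f T).mpr hT.1⟩,
      (key T).mpr hT.2⟩

section Model

variable {X : Type*} [AddCommGroup X] [Module ℂ X] [LieRingModule D.par X]
  {U : Type*} [AddCommGroup U] [Module ℂ U] [LieRingModule D.par U]

theorem isModel_of_isCoord {ρ : Matrix (Fin m) (Fin m) ℂ → Module.End ℂ (Arr m)}
    {Y : Submodule ℂ (Arr m)} {c : X →ₗ[ℂ] Arr m} (h : IsCoord F.matA ρ Y c) (t : Arr m →ₗ[ℂ] U)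
    (hinj : ∀ T ∈ Y, t T = 0 → T = 0)
    (hlie : ∀ φ, F.matR φ = 0 → ∀ T, ⁅φ, t T⁆ = t (ρ (F.matA φ) T)) :
    D.IsModel X F.compl (Submodule.map t Y) := by
  refine ⟨t ∘ₗ c, ?_, ?_, fun φ hφ x => ?_⟩
  · rw [injective_iff_map_eq_zero]
    intro x hx
    have hc : c x ∈ Y := h.range ▸ ⟨x, rfl⟩
    exact h.injective (by rw [map_zero]; exact hinj _ hc hx)
  · rw [LinearMap.range_comp, h.range]
  · rw [LinearMap.comp_apply, LinearMap.comp_apply, h.lie, hlie φ (F.mem_g0_iff.mp hφ)]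

end Model

theorem isModel_W30 : D.IsModel F.W30 F.compl (wedge3 F.compl) := by
  rw [F.wedge3_eq]
  exact F.isModel_of_isCoord F.isCoord_W30 _ (fun T _ h => (map_eq_zero_iff _ (Arr.tens_injective
    F.linearIndependent_f F.linearIndependent_f F.linearIndependent_f)).mp h)
    fun φ h T => F.lie_tens_f h T

theorem isModel_W31 : D.IsModel F.W31 F.compl (cartan F.compl) := by
  rw [F.cartan_eq]
  exact F.isModel_of_isCoord F.isCoord_W31 _ (fun T _ h => (map_eq_zero_iff _ (Arr.tens_injective
    F.linearIndependent_f F.linearIndependent_f F.linearIndependent_f)).mp h)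
    fun φ h T => F.lie_tens_f h T

theorem isModel_W11 : D.IsModel F.W11 F.compl (D.traceFree F.compl) := by
  rw [F.traceFree_eq]
  exact F.isModel_of_isCoord F.isCoord_W11 _ (fun T _ h => (map_eq_zero_iff _ (Arr.tens_injective
    F.linearIndependent_e F.linearIndependent_f F.linearIndependent_f)).mp h)
    fun φ h T => F.lie_tens_e_f h T

/-- A pure trace array is determined by its trace, a vector of ℂ^m on which A acts as it does on
V_{-1/2}. -/
theorem isModel_W10 (hm : 2 < m) : D.IsModel F.W10 F.compl F.compl := by
  have key : F.compl = Submodule.map (Fintype.linearCombination ℂ F.f ∘ₗ Arr.tr) Arr.traces := by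
    have hne : (m : ℂ) - 1 ≠ 0 := by
      rw [sub_ne_zero]
      exact_mod_cast (by omega : m ≠ 1)
    have : Submodule.map Arr.tr Arr.traces = (⊤ : Submodule ℂ (Fin m → ℂ)) := by
      rw [eq_top_iff]
      intro t _
      refine ⟨_, ⟨((m : ℂ) - 1)⁻¹ • t, rfl⟩, ?_⟩
      rw [Arr.tr_pureTrace, smul_smul, mul_inv_cancel₀ hne, one_smul]
    rw [Submodule.map_comp, this, Submodule.map_top, Fintype.range_linearCombination]
  have := F.isModel_of_isCoord F.isCoord_W10 (Fintype.linearCombination ℂ F.f ∘ₗ Arr.tr)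
    (fun T hT h => ?_) fun φ h T => ?_
  · rw [← key] at this
    exact this
  · have h0 : Arr.tr T = 0 :=
      funext (Fintype.linearIndependent_iff.mp F.linearIndependent_f _ h)
    rw [(Arr.mem_traces_iff hm).mp hT, h0, map_zero, smul_zero]
  · simp only [LinearMap.comp_apply, Fintype.linearCombination_apply, Arr.tr_act1, lie_sum,
      lie_smul, F.lie_f_of_matR h, Matrix.mulVec, dotProduct, Finset.smul_sum, smul_smul,
      Finset.sum_smul]
    rw [Finset.sum_comm]
    simp only [mul_comm]

/-! #### Highest weights -/

/-- Weights are numbered from 1 and basis vectors from 0, so label j picks out the entry with index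
j - 1. -/
theorem sum_node {a : Fin m} {j : ℕ} (h : (a : ℕ) + 1 = j) (v : Fin m → ℂ) :
    ∑ k : Fin m, (node j (k + 1) : ℂ) * v k = v a := by
  rw [Finset.sum_eq_single a]
  · simp [node, h]
  · intro k _ hk
    have : (k : ℕ) + 1 ≠ j := fun h' => hk (Fin.ext (by omega))
    simp [node, this]
  · simp

theorem hasDynkinLabels_W30 (hm : 2 < m) :
    D.HasDynkinLabels F.W30 F.e fun k => node (m - 3) k - 2 * node m k := by
  let a : Fin m := ⟨m - 3, by omega⟩
  let b : Fin m := ⟨m - 2, by omega⟩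
  let c : Fin m := ⟨m - 1, by omega⟩
  have hab : a ≠ b := Fin.ne_of_val_ne (by simp only [a, b]; omega)
  have hac : a ≠ c := Fin.ne_of_val_ne (by simp only [a, c]; omega)
  have hbc : b ≠ c := Fin.ne_of_val_ne (by simp only [b, c]; omega)
  -- The weight -ε_{m-2} - ε_{m-1} - ε_m of the product of the last three basis vectors. For m = 3
  -- the label m - 3 = 0 lies outside the range of nodes, in accordance with ϖ₀ = 0.
  refine F.hasDynkinLabels_of_isCoord F.isCoord_W30
    (fun k => -node (m - 2) k - node (m - 1) k - node m k) ?_ ?_ (Arr.skewUnit_mem a b c)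
    (Arr.skewUnit_ne_zero hab hac hbc) fun A hA => ?_
  · intro k h1 h2
    simp only [node]
    split_ifs <;> omega
  · simp only [node]
    split_ifs <;> omega
  · rw [Arr.act3_skewUnit_of_triangular hm hA rfl rfl rfl]
    congr 1
    simp only [Int.cast_sub, Int.cast_neg, sub_mul, neg_mul, Finset.sum_sub_distrib,
      Finset.sum_neg_distrib]
    rw [sum_node (a := a) (by simp only [a]; omega), sum_node (a := b) (by simp only [b]; omega),
      sum_node (a := c) (by simp only [c]; omega)]
    ring

theorem hasDynkinLabels_W31 (hm : 2 < m) :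
    D.HasDynkinLabels F.W31 F.e fun k => node (m - 2) k + node (m - 1) k - 3 * node m k := by
  let b : Fin m := ⟨m - 2, by omega⟩
  let c : Fin m := ⟨m - 1, by omega⟩
  have hbc : b ≠ c := Fin.ne_of_val_ne (by simp only [b, c]; omega)
  -- With a repeated first index, `hookUnit c c b` is twice e_c ⊗ (e_c ∧ e_b), of weight -ε_{m-1} -
  -- 2ε_m.
  refine F.hasDynkinLabels_of_isCoord F.isCoord_W31
    (fun k => -node (m - 1) k - 2 * node m k) ?_ ?_ (Arr.hookUnit_mem c c b) ?_ fun A hA => ?_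
  · intro k h1 h2
    simp only [node]
    split_ifs <;> omega
  · simp only [node]
    split_ifs <;> omega
  · intro h
    have := congrFun h (c, c, b)
    simp [Arr.hookUnit, Arr.unit_apply, hbc] at this
  · rw [Arr.act3_hookUnit_of_triangular hm hA rfl rfl]
    congr 1
    simp only [Int.cast_sub, Int.cast_neg, Int.cast_mul, Int.cast_ofNat, sub_mul, neg_mul,
      mul_assoc, Finset.sum_sub_distrib, Finset.sum_neg_distrib, ← Finset.mul_sum]
    rw [sum_node (a := b) (by simp only [b]; omega), sum_node (a := c) (by simp only [c]; omega)]
    ring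

theorem hasDynkinLabels_W10 (hm : 2 < m) :
    D.HasDynkinLabels F.W10 F.e fun k => node (m - 1) k - node m k := by
  let c : Fin m := ⟨m - 1, by omega⟩
  refine F.hasDynkinLabels_of_isCoord F.isCoord_W10 (fun k => -node m k) ?_ ?_
    (T := Arr.pureTrace (Pi.single c 1)) ⟨_, rfl⟩ ?_ fun A hA => ?_
  · intro k h1 h2
    simp only [node]
    split_ifs <;> omega
  · simp only [node]
    split_ifs <;> omega
  · rw [Ne, map_eq_zero_iff _ (Arr.pureTrace_injective hm)]
    simp
  · rw [Arr.act1_pureTrace_of_triangular hA rfl]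
    congr 1
    simp only [Int.cast_neg, neg_mul, Finset.sum_neg_distrib, neg_neg]
    rw [sum_node (a := c) (by simp only [c]; omega)]

theorem hasDynkinLabels_W11 (hm : 2 < m) :
    D.HasDynkinLabels F.W11 F.e fun k => node 1 k + node (m - 2) k - 2 * node m k := by
  let a : Fin m := ⟨0, by omega⟩
  let b : Fin m := ⟨m - 2, by omega⟩
  let c : Fin m := ⟨m - 1, by omega⟩
  have hab : a ≠ b := Fin.ne_of_val_ne (by simp only [a, b]; omega)
  have hac : a ≠ c := Fin.ne_of_val_ne (by simp only [a, c]; omega)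
  have hbc : b ≠ c := Fin.ne_of_val_ne (by simp only [b, c]; omega)
  refine F.hasDynkinLabels_of_isCoord F.isCoord_W11
    (fun k => node 1 k - node (m - 1) k - node m k) ?_ ?_ (Arr.mixed_mem hab hac)
    (Arr.mixed_ne_zero a hbc) fun A hA => ?_
  · intro k h1 h2
    simp only [node]
    split_ifs <;> omega
  · simp only [node]
    split_ifs <;> omega
  · rw [Arr.act1_mixed_of_triangular hm hA rfl rfl rfl]
    congr 1
    simp only [Int.cast_sub, sub_mul, Finset.sum_sub_distrib]
    rw [sum_node (a := a) (by simp only [a]), sum_node (a := b) (by simp only [b]; omega),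
      sum_node (a := c) (by simp only [c]; omega)]
    ring

end Frame

end PureSpinor

/-! ### Uniqueness of the copies of each piece inside W. -/

theorem Arr.act3_one {m : ℕ} (T : Arr m) : Arr.act3 1 T = (3 : ℂ) • T := by
  ext ⟨i, j, k⟩
  simp [Arr.act3_apply, Matrix.one_apply]
  ring

theorem Arr.act1_one {m : ℕ} (T : Arr m) : Arr.act1 1 T = (1 : ℂ) • T := by
  ext ⟨i, j, k⟩
  simp [Arr.act1_apply, Matrix.one_apply]

/-- The identity matrix plays the role of a grading element: it acts by r on B and by s ≠ r on the
target of q, so q vanishes on B. Then p embeds B as a stable subspace with the dimension of Y, and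
the hypothesis on such subspaces identifies it. -/
theorem IsCoord.eq_inf_of_equiv {m : ℕ} {L W X : Type*} [LieRing L] [LieAlgebra ℂ L]
    [AddCommGroup W] [Module ℂ W] [LieRingModule L W] [AddCommGroup X] [Module ℂ X]
    [LieRingModule L X] {μ : L → Matrix (Fin m) (Fin m) ℂ} {p q : W →ₗ[ℂ] Arr m}
    {ρ σ : Matrix (Fin m) (Fin m) ℂ → Module.End ℂ (Arr m)} {K Y : Submodule ℂ (Arr m)}
    {c : X →ₗ[ℂ] Arr m} (h : IsCoord μ ρ Y c) (hμ : Function.Surjective μ)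
    (hp : ∀ φ w, p ⁅φ, w⁆ = ρ (μ φ) (p w)) (hq : ∀ φ w, q ⁅φ, w⁆ = σ (μ φ) (q w))
    (hpq : ∀ w, p w = 0 → q w = 0 → w = 0) (hsk : ∀ w, p w ∈ K) {r s : ℂ} (hrs : r ≠ s)
    (hρ : ∀ T, ρ 1 T = r • T) (hσ : ∀ T, σ 1 T = s • T)
    (hY : ∀ U ≤ K, (∀ A, ∀ T ∈ U, ρ A T ∈ U) →
      Module.finrank ℂ U = Module.finrank ℂ Y → U = Y)
    (B : LieSubmodule ℂ L W) (e : B ≃ₗ⁅ℂ, L⁆ X) :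
    (B : Submodule ℂ W) = LinearMap.ker q ⊓ Y.comap p := by
  have hc := h.comp_equiv e
  obtain ⟨φ, hφ⟩ := hμ 1
  have hq0 : ∀ b ∈ B, q b = 0 := fun b hb => by
    have h1 : ⁅φ, (⟨b, hb⟩ : B)⁆ = r • (⟨b, hb⟩ : B) := by
      apply hc.injective
      rw [hc.lie, hφ, hρ, map_smul]
    have h2 : ⁅φ, b⁆ = r • b := congrArg Subtype.val h1
    have h3 := hq φ b
    rw [h2, hφ, hσ, map_smul, ← sub_eq_zero, ← sub_smul] at h3
    exact (smul_eq_zero.mp h3).resolve_left (sub_ne_zero.mpr hrs)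
  have hinj : Function.Injective (PureSpinor.Frame.restr p B) := by
    rw [injective_iff_map_eq_zero]
    exact fun x hx => Subtype.ext (hpq x hx (hq0 x x.2))
  have hU : Submodule.map p B = Y := by
    have hr : Submodule.map p (B : Submodule ℂ W) = LinearMap.range (PureSpinor.Frame.restr p B) := by
      rw [PureSpinor.Frame.restr, LinearMap.range_comp, Submodule.range_subtype]
    apply hY
    · rintro _ ⟨w, -, rfl⟩
      exact hsk w
    · rintro A _ ⟨w, hw, rfl⟩
      obtain ⟨ψ, rfl⟩ := hμ A
      exact ⟨⁅ψ, w⁆, B.lie_mem hw, hp ψ w⟩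
    · rw [hr, LinearMap.finrank_range_of_inj hinj, ← hc.finrank_eq]
  apply le_antisymm
  · intro b hb
    refine ⟨hq0 b hb, ?_⟩
    rw [SetLike.mem_coe, Submodule.mem_comap, ← hU]
    exact ⟨b, hb, rfl⟩
  · rintro w ⟨h1, h2⟩
    rw [SetLike.mem_coe, Submodule.mem_comap, ← hU] at h2
    obtain ⟨b, hb, hbw⟩ := h2
    have : w - b = 0 := by
      apply hpq
      · rw [map_sub, hbw, sub_self]
      · have h1' : q w = 0 := h1
        rw [map_sub, h1', hq0 b hb, sub_self]
    rw [sub_eq_zero.mp this]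
    exact hb

namespace PureSpinor

variable {m : ℕ} {V S : Type*} [AddCommGroup V] [Module ℂ V] [AddCommGroup S] [Module ℂ S]
  [FiniteDimensional ℂ V] {D : PureSpinor m V S}

namespace Frame

variable (F : D.Frame)

/-! #### Submodules for the reductive part -/

theorem matR_g0 (φ : D.g0 F.compl) : F.matR (φ : D.par) = 0 := F.mem_g0_iff.mp φ.2

theorem lo_lie_g0 (φ : D.g0 F.compl) (w : D.W) :
    F.lo ⁅φ, w⁆ = Arr.act3 (F.matA (φ : D.par)) (F.lo w) := F.lo_lie φ w

theorem hi_lie_g0 (φ : D.g0 F.compl) (w : D.W) :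
    F.hi ⁅φ, w⁆ = Arr.act1 (F.matA (φ : D.par)) (F.hi w) := by
  refine (F.hi_lie φ w).trans ?_
  rw [F.matR_g0]
  ext ⟨i, j, k⟩
  simp [Arr.slot1_apply]

section Cell

variable {p q : D.W →ₗ[ℂ] Arr m} {ρ σ : Matrix (Fin m) (Fin m) ℂ → Module.End ℂ (Arr m)}
  {Y : Submodule ℂ (Arr m)}

/-- The `𝔤₀`-submodule of all `w` with `q w = 0` and `p w ∈ Y`. -/
def cell (hp : ∀ (φ : D.g0 F.compl) w, p ⁅φ, w⁆ = ρ (F.matA (φ : D.par)) (p w))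
    (hq : ∀ (φ : D.g0 F.compl) w, q ⁅φ, w⁆ = σ (F.matA (φ : D.par)) (q w))
    (sY : ∀ A, ∀ T ∈ Y, ρ A T ∈ Y) : LieSubmodule ℂ (D.g0 F.compl) D.W where
  __ := LinearMap.ker q ⊓ Y.comap p
  lie_mem := by
    rintro φ w ⟨h1, h2⟩
    refine ⟨?_, ?_⟩
    · have h1' : q w = 0 := h1
      change q ⁅φ, w⁆ = 0
      rw [hq, h1', map_zero]
    · change p ⁅φ, w⁆ ∈ Y
      rw [hp]
      exact sY _ _ h2

theorem isCoord_cell (hp : ∀ (φ : D.g0 F.compl) w, p ⁅φ, w⁆ = ρ (F.matA (φ : D.par)) (p w))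
    (hq : ∀ (φ : D.g0 F.compl) w, q ⁅φ, w⁆ = σ (F.matA (φ : D.par)) (q w))
    (sY : ∀ A, ∀ T ∈ Y, ρ A T ∈ Y) (hpq : ∀ w, p w = 0 → q w = 0 → w = 0)
    (hs : ∀ T ∈ Y, ∃ w, p w = T ∧ q w = 0) :
    IsCoord (fun φ : D.g0 F.compl => F.matA (φ : D.par)) ρ Y (restr p (F.cell hp hq sY)) where
  injective := by
    rw [injective_iff_map_eq_zero]
    exact fun x hx => Subtype.ext (hpq x hx x.2.1)
  range := by
    apply le_antisymm
    · rintro _ ⟨x, rfl⟩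
      exact x.2.2
    · intro T hT
      obtain ⟨w, rfl, hw⟩ := hs T hT
      exact ⟨⟨w, hw, hT⟩, rfl⟩
  lie φ x := hp φ x

end Cell

theorem exists_copy_hi {X : Type*} [AddCommGroup X] [Module ℂ X] [LieRingModule D.par X]
    {Y : Submodule ℂ (Arr m)} {c : X →ₗ[ℂ] Arr m} (h : IsCoord F.matA Arr.act1 Y c)
    (sY : ∀ A, ∀ T ∈ Y, Arr.act1 A T ∈ Y) (hY : Y ≤ Arr.skew) :
    ∃ B : LieSubmodule ℂ (D.g0 F.compl) D.W, D.IsCopy B X :=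
  ⟨_, (F.isCoord_cell F.hi_lie_g0 F.lo_lie_g0 sY (fun _ h1 h2 => F.eq_zero_of_lo_hi h2 h1)
    fun _ hT => (F.exists_lo_hi_eq (Submodule.zero_mem _) (hY hT)).imp fun _ h =>
      h.symm).nonempty_equiv (F.isCoord_g0 h)⟩

theorem exists_copy_lo {X : Type*} [AddCommGroup X] [Module ℂ X] [LieRingModule D.par X]
    {Y : Submodule ℂ (Arr m)} {c : X →ₗ[ℂ] Arr m} (h : IsCoord F.matA Arr.act3 Y c)
    (sY : ∀ A, ∀ T ∈ Y, Arr.act3 A T ∈ Y) (hY : Y ≤ Arr.skew) :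
    ∃ B : LieSubmodule ℂ (D.g0 F.compl) D.W, D.IsCopy B X :=
  ⟨_, (F.isCoord_cell F.lo_lie_g0 F.hi_lie_g0 sY (fun _ => F.eq_zero_of_lo_hi)
    fun _ hT => F.exists_lo_hi_eq (hY hT) (Submodule.zero_mem _)).nonempty_equiv (F.isCoord_g0 h)⟩

theorem eq_of_isCopy_hi {X : Type*} [AddCommGroup X] [Module ℂ X] [LieRingModule D.par X]
    {Y : Submodule ℂ (Arr m)} {c : X →ₗ[ℂ] Arr m} (h : IsCoord F.matA Arr.act1 Y c)
    (hY : ∀ U ≤ Arr.skew, (∀ A, ∀ T ∈ U, Arr.act1 A T ∈ U) →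
      Module.finrank ℂ U = Module.finrank ℂ Y → U = Y)
    {B : LieSubmodule ℂ (D.g0 F.compl) D.W} (hB : D.IsCopy B X) :
    (B : Submodule ℂ D.W) = LinearMap.ker F.lo ⊓ Y.comap F.hi :=
  hB.elim <| (F.isCoord_g0 h).eq_inf_of_equiv F.matA_g0_surjective F.hi_lie_g0
    F.lo_lie_g0 (fun _ h1 h2 => F.eq_zero_of_lo_hi h2 h1) F.hi_mem_skew
    (by norm_num : (1 : ℂ) ≠ 3) Arr.act1_one Arr.act3_one hY B

theorem eq_of_isCopy_lo {X : Type*} [AddCommGroup X] [Module ℂ X] [LieRingModule D.par X]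
    {Y : Submodule ℂ (Arr m)} {c : X →ₗ[ℂ] Arr m} (h : IsCoord F.matA Arr.act3 Y c)
    (hY : ∀ U ≤ Arr.skew, (∀ A, ∀ T ∈ U, Arr.act3 A T ∈ U) →
      Module.finrank ℂ U = Module.finrank ℂ Y → U = Y)
    {B : LieSubmodule ℂ (D.g0 F.compl) D.W} (hB : D.IsCopy B X) :
    (B : Submodule ℂ D.W) = LinearMap.ker F.hi ⊓ Y.comap F.lo :=
  hB.elim <| (F.isCoord_g0 h).eq_inf_of_equiv F.matA_g0_surjective F.lo_lie_g0
    F.hi_lie_g0 (fun _ => F.eq_zero_of_lo_hi) F.lo_mem_skew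
    (by norm_num : (3 : ℂ) ≠ 1) Arr.act3_one Arr.act1_one hY B

theorem eq_of_isCopy_W10 (hm : 2 < m) {B : LieSubmodule ℂ (D.g0 F.compl) D.W}
    (hB : D.IsCopy B F.W10) :
    (B : Submodule ℂ D.W) = LinearMap.ker F.lo ⊓ Arr.traces.comap F.hi :=
  F.eq_of_isCopy_hi F.isCoord_W10 (fun _ hU sU => eq_of_finrank_eq_small
    (Arr.isCompl_noTrace hm).1 (Arr.isCompl_noTrace hm).2 (Arr.isSimple_traces hm)
    (Arr.isSimple_noTrace hm) Arr.act1_mem_traces Arr.act1_mem_noTrace (Arr.finrank_traces_lt hm)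
    hU sU) hB

theorem eq_of_isCopy_W11 (hm : 2 < m) {B : LieSubmodule ℂ (D.g0 F.compl) D.W}
    (hB : D.IsCopy B F.W11) :
    (B : Submodule ℂ D.W) = LinearMap.ker F.lo ⊓ Arr.noTrace.comap F.hi :=
  F.eq_of_isCopy_hi F.isCoord_W11 (fun _ hU sU => eq_of_finrank_eq_large
    (Arr.isCompl_noTrace hm).1 (Arr.isCompl_noTrace hm).2
    (Arr.isSimple_noTrace hm) Arr.act1_mem_noTrace (Arr.finrank_traces_lt hm) hU sU) hB

theorem eq_of_isCopy_W30 (hm : 2 < m) {B : LieSubmodule ℂ (D.g0 F.compl) D.W}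
    (hB : D.IsCopy B F.W30) :
    (B : Submodule ℂ D.W) = LinearMap.ker F.hi ⊓ Arr.totSkew.comap F.lo :=
  F.eq_of_isCopy_lo F.isCoord_W30 (fun _ hU sU => eq_of_finrank_eq_small
    Arr.isCompl_hook.1 Arr.isCompl_hook.2 (Arr.isSimple_totSkew hm)
    (Arr.isSimple_hook hm) Arr.act3_mem_totSkew Arr.act3_mem_hook (Arr.finrank_totSkew_lt hm)
    hU sU) hB

theorem eq_of_isCopy_W31 (hm : 2 < m) {B : LieSubmodule ℂ (D.g0 F.compl) D.W}
    (hB : D.IsCopy B F.W31) :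
    (B : Submodule ℂ D.W) = LinearMap.ker F.hi ⊓ Arr.hook.comap F.lo :=
  F.eq_of_isCopy_lo F.isCoord_W31 (fun _ hU sU => eq_of_finrank_eq_large
    Arr.isCompl_hook.1 Arr.isCompl_hook.2
    (Arr.isSimple_hook hm) Arr.act3_mem_hook (Arr.finrank_totSkew_lt hm) hU sU) hB

/-! #### The action of `𝔤₁` -/

theorem hi_lie_g1 {φ : D.par} (hφ : φ ∈ D.g1) (w : D.W) :
    F.hi ⁅φ, w⁆ = Arr.slot1 (F.matR φ) (F.lo w) := by
  rw [F.hi_lie, F.mem_g1_iff.mp hφ]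
  ext ⟨i, j, k⟩
  simp [Arr.act1_apply]

theorem lo_lie_g1 {φ : D.par} (hφ : φ ∈ D.g1) (w : D.W) : F.lo ⁅φ, w⁆ = 0 := by
  rw [F.lo_lie, F.mem_g1_iff.mp hφ]
  ext ⟨i, j, k⟩
  simp [Arr.act3_apply]

/-- On elements with `hi` = 0, an element of 𝔤₁ contracts `lo` with its skew matrix and places the
result in `hi`. Every skew matrix occurs, so the inclusion of array spaces lifts to W. -/
theorem le_g1Span {Y Y' : Submodule ℂ (Arr m)} (hY : Y ≤ Arr.skew) (h : Y' ≤ Arr.raised Y) :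
    LinearMap.ker F.lo ⊓ Y'.comap F.hi ≤ D.g1Span (LinearMap.ker F.hi ⊓ Y.comap F.lo) := by
  rintro w ⟨h1, h2⟩
  suffices H : ∀ T ∈ Arr.raised Y,
      ∃ x ∈ D.g1Span (LinearMap.ker F.hi ⊓ Y.comap F.lo), F.lo x = 0 ∧ F.hi x = T by
    obtain ⟨x, hx, hx1, hx2⟩ := H _ (h h2)
    have h1' : F.lo w = 0 := h1
    have : w - x = 0 := by
      apply F.eq_zero_of_lo_hi
      · rw [map_sub, h1', hx1, sub_zero]
      · rw [map_sub, hx2, sub_self]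
    rwa [sub_eq_zero.mp this]
  intro T hT
  induction hT using Submodule.span_induction with
  | mem T hT =>
    obtain ⟨R, hR, T, hT, rfl⟩ := hT
    obtain ⟨φ, h0, rfl⟩ := F.exists_par 0 R hR
    obtain ⟨b, rfl, hb⟩ := F.exists_lo_hi_eq (hY hT) (Submodule.zero_mem _)
    have hφ : φ ∈ D.g1 := F.mem_g1_iff.mpr h0
    exact ⟨⁅φ, b⁆, Submodule.subset_span ⟨φ, hφ, b, ⟨hb, hT⟩, rfl⟩, F.lo_lie_g1 hφ b,
      F.hi_lie_g1 hφ b⟩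
  | zero => exact ⟨0, Submodule.zero_mem _, map_zero _, map_zero _⟩
  | add T T' _ _ ih ih' =>
    obtain ⟨x, hx, hx1, hx2⟩ := ih
    obtain ⟨y, hy, hy1, hy2⟩ := ih'
    exact ⟨x + y, Submodule.add_mem _ hx hy, by rw [map_add, hx1, hy1, add_zero],
      by rw [map_add, hx2, hy2]⟩
  | smul c T _ ih =>
    obtain ⟨x, hx, hx1, hx2⟩ := ih
    exact ⟨c • x, Submodule.smul_mem _ c hx, by rw [map_smul, hx1, smul_zero],
      by rw [map_smul, hx2]⟩

theorem le_raised_of_le_g1Span {Y Y' : Submodule ℂ (Arr m)} (hY' : Y' ≤ Arr.skew)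
    (h : LinearMap.ker F.lo ⊓ Y'.comap F.hi ≤ D.g1Span (LinearMap.ker F.hi ⊓ Y.comap F.lo)) :
    Y' ≤ Arr.raised Y := by
  have H : D.g1Span (LinearMap.ker F.hi ⊓ Y.comap F.lo) ≤ (Arr.raised Y).comap F.hi := by
    refine Submodule.span_le.mpr ?_
    rintro _ ⟨φ, hφ, b, ⟨-, hb⟩, rfl⟩
    rw [SetLike.mem_coe, Submodule.mem_comap, F.hi_lie_g1 hφ]
    exact Arr.slot1_mem_raised (F.transpose_matR φ) hb
  intro T hT
  obtain ⟨w, h1, rfl⟩ := F.exists_lo_hi_eq (Submodule.zero_mem _) (hY' hT)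
  exact H (h ⟨h1, hT⟩)

/-- For m = 3 an inclusion would put the trace-free arrays among the pure traces, which they meet
only in zero. -/
theorem noTrace_le_raised_totSkew_iff (hm : 2 < m) :
    Arr.noTrace ≤ Arr.raised (Arr.totSkew (m := m)) ↔ 3 < m := by
  refine ⟨fun h => ?_, Arr.noTrace_le_raised_totSkew⟩
  by_contra hm'
  obtain rfl : m = 3 := by omega
  have h1 := le_inf (h.trans Arr.raised_totSkew_three) le_rfl
  rw [(Arr.isCompl_noTrace hm).1] at h1
  exact (Arr.isSimple_noTrace hm).1 (le_bot_iff.mp h1)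

/-! #### The graph -/

theorem graph (hm : 2 < m) {N₁₀ N₁₁ : LieSubmodule ℂ D.par D.grHalf}
    {N₃₀ N₃₁ : LieSubmodule ℂ D.par D.grThreeHalf} (h₁₀ : N₁₀ = F.W10) (h₁₁ : N₁₁ = F.W11)
    (h₃₀ : N₃₀ = F.W30) (h₃₁ : N₃₁ = F.W31) :
    ((∃ B : LieSubmodule ℂ (D.g0 F.compl) D.W, D.IsCopy B N₁₀) ∧
      (∃ B : LieSubmodule ℂ (D.g0 F.compl) D.W, D.IsCopy B N₁₁) ∧
      (∃ B : LieSubmodule ℂ (D.g0 F.compl) D.W, D.IsCopy B N₃₀) ∧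
      (∃ B : LieSubmodule ℂ (D.g0 F.compl) D.W, D.IsCopy B N₃₁)) ∧
    ∀ B₁₀ B₁₁ B₃₀ B₃₁ : LieSubmodule ℂ (D.g0 F.compl) D.W,
      D.IsCopy B₁₀ N₁₀ → D.IsCopy B₁₁ N₁₁ → D.IsCopy B₃₀ N₃₀ → D.IsCopy B₃₁ N₃₁ →
      (B₁₁ : Submodule ℂ D.W) ≤ D.g1Span B₃₁ ∧ (B₁₀ : Submodule ℂ D.W) ≤ D.g1Span B₃₁ ∧
      (B₁₀ : Submodule ℂ D.W) ≤ D.g1Span B₃₀ ∧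
      ((B₁₁ : Submodule ℂ D.W) ≤ D.g1Span B₃₀ ↔ 3 < m) := by
  subst h₁₀ h₁₁ h₃₀ h₃₁
  have hs : Arr.totSkew (m := m) ≤ Arr.skew := fun _ h => h.1
  have hh : Arr.hook (m := m) ≤ Arr.skew := fun _ h => h.1
  refine ⟨⟨F.exists_copy_hi F.isCoord_W10 Arr.act1_mem_traces Arr.traces_le,
    F.exists_copy_hi F.isCoord_W11 Arr.act1_mem_noTrace inf_le_left,
    F.exists_copy_lo F.isCoord_W30 Arr.act3_mem_totSkew hs,
    F.exists_copy_lo F.isCoord_W31 Arr.act3_mem_hook hh⟩,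
    fun B₁₀ B₁₁ B₃₀ B₃₁ h₁₀ h₁₁ h₃₀ h₃₁ => ?_⟩
  rw [F.eq_of_isCopy_W10 hm h₁₀, F.eq_of_isCopy_W11 hm h₁₁, F.eq_of_isCopy_W30 hm h₃₀,
    F.eq_of_isCopy_W31 hm h₃₁]
  refine ⟨F.le_g1Span hh (Arr.noTrace_le_raised_hook hm),
    F.le_g1Span hh (Arr.traces_le_raised_hook hm),
    F.le_g1Span hs (Arr.traces_le_raised_totSkew hm), fun h => ?_, fun h => ?_⟩
  · exact (noTrace_le_raised_totSkew_iff hm).mp (F.le_raised_of_le_g1Span inf_le_left h)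
  · exact F.le_g1Span hs (Arr.noTrace_le_raised_totSkew h)

/-! #### The table of modules -/

/-- Coordinates from one frame settle irreducibility under 𝔭 and the dimension. A given splitting or
a given basis of V_{1/2} calls for an adapted frame, so coordinates on the same X are required for
every frame. -/
theorem isIrreducibleOfType_of_isCoord (F : D.Frame) {X : Type*} [AddCommGroup X] [Module ℂ X]
    [LieRingModule D.par X] [LieModule ℂ D.par X] {U : Type*} [AddCommGroup U] [Module ℂ U]
    [LieRingModule D.par U] {T : Submodule ℂ V → Submodule ℂ U} {a : ℕ → ℤ} {d : ℚ}
    {ρ : Matrix (Fin m) (Fin m) ℂ → Module.End ℂ (Arr m)} {Y : Submodule ℂ (Arr m)}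
    (hY : IsSimpleUnder ρ Y) (hd : (Module.finrank ℂ Y : ℂ) = d)
    (h : ∀ F : D.Frame, (∃ c : X →ₗ[ℂ] Arr m, IsCoord F.matA ρ Y c) ∧
      D.IsModel X F.compl (T F.compl) ∧ D.HasDynkinLabels X F.e a) :
    D.IsIrreducibleOfType X T a d := by
  obtain ⟨⟨c, hc⟩, -⟩ := h F
  refine ⟨hc.isIrreducible hY F.matA_surjective, ?_, fun M hM => ?_, fun e => ?_⟩
  · rw [hc.finrank_eq]
    apply Rat.cast_injective (α := ℂ)
    rw [Rat.cast_natCast, hd]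
  · obtain ⟨F', -, rfl⟩ := D.exists_frame_of_isSplitting hM F.e
    obtain ⟨⟨c', hc'⟩, h', -⟩ := h F'
    exact ⟨F'.isIrreducible_g0 hc' hY, h'⟩
  · obtain ⟨F', rfl⟩ := D.exists_frame e
    exact (h F').2.2

theorem isIrreducibleOfType_W30 (hm : 2 < m) :
    D.IsIrreducibleOfType F.W30 wedge3 (fun k => node (m - 3) k - 2 * node m k)
      (m * (m - 1) * (m - 2) / 6) := by
  -- Keeping N variable allows its equality with the submodule of another frame to be substituted in
  -- all the types that mention it.
  have h : ∀ (N : LieSubmodule ℂ D.par D.grThreeHalf) (F : D.Frame), N = F.W30 →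
      (∃ c : N →ₗ[ℂ] Arr m, IsCoord F.matA Arr.act3 Arr.totSkew c) ∧
      D.IsModel N F.compl (wedge3 F.compl) ∧
      D.HasDynkinLabels N F.e fun k => node (m - 3) k - 2 * node m k := by
    rintro _ F rfl
    exact ⟨⟨_, F.isCoord_W30⟩, F.isModel_W30, F.hasDynkinLabels_W30 hm⟩
  refine F.isIrreducibleOfType_of_isCoord (Arr.isSimple_totSkew hm) ?_
    fun F' => h _ F' (W30_eq F F')
  push_cast
  exact Arr.finrank_totSkew

theorem isIrreducibleOfType_W31 (hm : 2 < m) :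
    D.IsIrreducibleOfType F.W31 cartan (fun k => node (m - 2) k + node (m - 1) k - 3 * node m k)
      (m * (m ^ 2 - 1) / 3) := by
  have h : ∀ (N : LieSubmodule ℂ D.par D.grThreeHalf) (F : D.Frame), N = F.W31 →
      (∃ c : N →ₗ[ℂ] Arr m, IsCoord F.matA Arr.act3 Arr.hook c) ∧
      D.IsModel N F.compl (cartan F.compl) ∧
      D.HasDynkinLabels N F.e fun k => node (m - 2) k + node (m - 1) k - 3 * node m k := by
    rintro _ F rfl
    exact ⟨⟨_, F.isCoord_W31⟩, F.isModel_W31, F.hasDynkinLabels_W31 hm⟩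
  refine F.isIrreducibleOfType_of_isCoord (Arr.isSimple_hook hm) ?_
    fun F' => h _ F' (W31_eq F F')
  push_cast
  exact Arr.finrank_hook

theorem isIrreducibleOfType_W10 [FiniteDimensional ℂ S] (hm : 2 < m)
    {ε : LinearMap.BilinForm ℂ S} (hε : D.IsSpinForm ε) :
    D.IsIrreducibleOfType F.W10 (fun M : Submodule ℂ V => M) (fun k => node (m - 1) k - node m k)
      m := by
  have h : ∀ (N : LieSubmodule ℂ D.par D.grHalf) (F : D.Frame), N = F.W10 →
      (∃ c : N →ₗ[ℂ] Arr m, IsCoord F.matA Arr.act1 Arr.traces c) ∧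
      D.IsModel N F.compl F.compl ∧
      D.HasDynkinLabels N F.e fun k => node (m - 1) k - node m k := by
    rintro _ F rfl
    exact ⟨⟨_, F.isCoord_W10⟩, F.isModel_W10 hm, F.hasDynkinLabels_W10 hm⟩
  refine F.isIrreducibleOfType_of_isCoord (Arr.isSimple_traces hm) ?_
    fun F' => h _ F' (W10_eq F F' hm hε)
  push_cast
  exact congrArg _ (Arr.finrank_traces hm)

theorem isIrreducibleOfType_W11 (hm : 2 < m) :
    D.IsIrreducibleOfType F.W11 D.traceFree (fun k => node 1 k + node (m - 2) k - 2 * node m k)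
      (m * (m + 1) * (m - 2) / 2) := by
  have h : ∀ (N : LieSubmodule ℂ D.par D.grHalf) (F : D.Frame), N = F.W11 →
      (∃ c : N →ₗ[ℂ] Arr m, IsCoord F.matA Arr.act1 Arr.noTrace c) ∧
      D.IsModel N F.compl (D.traceFree F.compl) ∧
      D.HasDynkinLabels N F.e fun k => node 1 k + node (m - 2) k - 2 * node m k := by
    rintro _ F rfl
    exact ⟨⟨_, F.isCoord_W11⟩, F.isModel_W11, F.hasDynkinLabels_W11 hm⟩
  refine F.isIrreducibleOfType_of_isCoord (Arr.isSimple_noTrace hm) ?_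
    fun F' => h _ F' (W11_eq F F')
  push_cast
  exact Arr.finrank_noTrace hm

end Frame

variable (D) in
theorem exists_basis : Nonempty (Module.Basis (Fin m) ℂ D.alphaPlane) :=
  ⟨Module.finBasisOfFinrankEq ℂ D.alphaPlane D.finrank_alphaPlane⟩

end PureSpinor

end IntrinsicTorsion

end

theorem mainTheorem4 {m : ℕ} (hm : 2 < m)
    {V S : Type*} [AddCommGroup V] [Module ℂ V] [FiniteDimensional ℂ V]
    [AddCommGroup S] [Module ℂ S] [FiniteDimensional ℂ S]
    (D : IntrinsicTorsion.PureSpinor m V S)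
    (ε : LinearMap.BilinForm ℂ S) (hε : D.IsSpinForm ε) :
    ∃ (W₁₀ W₁₁ : LieSubmodule ℂ D.par D.grHalf) (W₃₀ W₃₁ : LieSubmodule ℂ D.par D.grThreeHalf),
      -- the decompositions of `gr_{-1/2}(W)` and `gr_{-3/2}(W)`
      IsCompl W₁₀ W₁₁ ∧ IsCompl W₃₀ W₃₁ ∧
      -- the table of irreducible modules
      D.IsIrreducibleOfType W₃₀ IntrinsicTorsion.PureSpinor.wedge3
        (fun k => IntrinsicTorsion.PureSpinor.node (m - 3) k
          - 2 * IntrinsicTorsion.PureSpinor.node m k)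
        (m * (m - 1) * (m - 2) / 6) ∧
      D.IsIrreducibleOfType W₃₁ IntrinsicTorsion.PureSpinor.cartan
        (fun k => IntrinsicTorsion.PureSpinor.node (m - 2) k
          + IntrinsicTorsion.PureSpinor.node (m - 1) k
          - 3 * IntrinsicTorsion.PureSpinor.node m k)
        (m * (m ^ 2 - 1) / 3) ∧
      D.IsIrreducibleOfType W₁₀ (fun M : Submodule ℂ V => M)
        (fun k => IntrinsicTorsion.PureSpinor.node (m - 1) k
          - IntrinsicTorsion.PureSpinor.node m k)
        m ∧
      D.IsIrreducibleOfType W₁₁ D.traceFree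
        (fun k => IntrinsicTorsion.PureSpinor.node 1 k
          + IntrinsicTorsion.PureSpinor.node (m - 2) k
          - 2 * IntrinsicTorsion.PureSpinor.node m k)
        (m * (m + 1) * (m - 2) / 2) ∧
      -- the description by projection maps
      (∀ (Γ : TensorProduct ℂ V D.so) (h : D.toW Γ ∈ D.Whalf),
        ((⟨D.toW Γ, h⟩ : D.grHalf) ∈ W₁₀ ↔ D.Pi11 ε hε Γ = 0) ∧
        ((⟨D.toW Γ, h⟩ : D.grHalf) ∈ W₁₁ ↔ D.Pi10 Γ = 0)) ∧
      (∀ Γ : TensorProduct ℂ V D.so,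
        ((LieSubmodule.Quotient.mk (D.toW Γ) : D.grThreeHalf) ∈ W₃₀ ↔ D.Pi31 Γ = 0) ∧
        ((LieSubmodule.Quotient.mk (D.toW Γ) : D.grThreeHalf) ∈ W₃₁ ↔ D.Pi30 Γ = 0)) ∧
      -- the graph
      ∀ M : Submodule ℂ V, D.IsSplitting M →
        ((∃ B : LieSubmodule ℂ (D.g0 M) D.W, D.IsCopy B W₁₀) ∧
          (∃ B : LieSubmodule ℂ (D.g0 M) D.W, D.IsCopy B W₁₁) ∧
          (∃ B : LieSubmodule ℂ (D.g0 M) D.W, D.IsCopy B W₃₀) ∧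
          (∃ B : LieSubmodule ℂ (D.g0 M) D.W, D.IsCopy B W₃₁)) ∧
        ∀ B₁₀ B₁₁ B₃₀ B₃₁ : LieSubmodule ℂ (D.g0 M) D.W,
          D.IsCopy B₁₀ W₁₀ → D.IsCopy B₁₁ W₁₁ → D.IsCopy B₃₀ W₃₀ → D.IsCopy B₃₁ W₃₁ →
          (B₁₁ : Submodule ℂ D.W) ≤ D.g1Span B₃₁ ∧
          (B₁₀ : Submodule ℂ D.W) ≤ D.g1Span B₃₁ ∧
          (B₁₀ : Submodule ℂ D.W) ≤ D.g1Span B₃₀ ∧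
          ((B₁₁ : Submodule ℂ D.W) ≤ D.g1Span B₃₀ ↔ 3 < m) := by
  -- The four submodules are defined by one arbitrary frame. For a given splitting, a frame adapted
  -- to it yields the same submodules.
  refine D.exists_basis.elim fun e => (D.exists_frame e).elim fun F _ => ?_
  refine ⟨F.W10, F.W11, F.W30, F.W31, F.isCompl_W1 hm, F.isCompl_W3,
    F.isIrreducibleOfType_W30 hm, F.isIrreducibleOfType_W31 hm, F.isIrreducibleOfType_W10 hm hε,
    F.isIrreducibleOfType_W11 hm, fun Γ h => ⟨F.mem_W10_iff hm hε Γ h, F.mem_W11_iff Γ h⟩,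
    fun Γ => ⟨F.mk_mem_W30_iff Γ, F.mk_mem_W31_iff Γ⟩, fun M hM => ?_⟩
  refine (D.exists_frame_of_isSplitting hM e).elim fun F' hF' => ?_
  have hM' := hF'.2
  clear hF'
  subst hM'
  exact F'.graph hm (IntrinsicTorsion.PureSpinor.Frame.W10_eq F F' hm hε)
    (IntrinsicTorsion.PureSpinor.Frame.W11_eq F F') (IntrinsicTorsion.PureSpinor.Frame.W30_eq F F')
    (IntrinsicTorsion.PureSpinor.Frame.W31_eq F F')
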